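/- Let $k$ be an algebraically closed field of characteristic $0$, let $s\ge 2$ be an integer, and let $f=y^2-x^s\in R=k[[x,y]]$. Let $\delta_1,\dots,\delta_d\in R$ represent a $k$-basis of the space of first-order deformations $R/(f,\partial f/\partial x,\partial f/\partial y)$ of $f$. For $a\in k^d$ let $X_a/B$, $B=\operatorname{Spf}k[[t]]$, be the one-parameter deformation with total space $F_a:=f+t\sum_i a_i\delta_i=0$, and let $\mathcal O=k[[x,y,t]]/(F_a)$. Call it admissible if its relative singular locus $\partial F_a/\partial x=\partial F_a/\partial y=0$ has codimension $2$ in the total space. Let $$\mathscr P^m=(\mathcal O\otimes_{k[[t]]}\mathcal O)/I_\Delta^m=k[[x,y,u,v,t]]/\big(F_a(x,y,t),\,F_a(u,v,t),\,(u-x,v-y)^m\big)$$ (completed tensor product) be its module of $m$-th order relative principal parts, an $\mathcal O$-module via $x,y,t$. For a list $\bar\tau=(\tau_1,\dots,\tau_{m-1})$ of elements of $\mathscr P^m$, let $I^m_{\bar\tau}\subset\mathcal O$ be the ideal of the degeneracy locus of the induced map $\mathcal O^{m-1}\to(\mathscr P^m)^{\vee\vee}$, that is, the ideal generated by the determinants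 $\det(\varphi_i(\tau_j))_{1\le i,j\le m-1}$ with $\varphi_i\in(\mathscr P^m)^\vee$ (the maximal minors of the matrix $(e_i(\tau_j))$ when $e_1,\dots,e_m$ is a basis of $(\mathscr P^m)^\vee$). The $m$-th order weight-$2$ type-(a) automatic degeneracy of $f$ is $$\mathrm{AD}^m_{(2)}(f)=\min_{X_a/B}\ \min_{\bar\tau}\ \dim_k\mathcal O/I^m_{\bar\tau},$$ the outer minimum being over all admissible one-parameter deformations. For $a,b\in k^d$ consider also the two-parameter deformation $f+t_0\sum_i a_i\delta_i+t_1\sum_i b_i\delta_i=0$ over $\operatorname{Spf}k[[t_0,t_1]]$, with principal parts and degeneracy ideals $\widetilde I^m_{\bar\tau}\subset\widetilde{\mathcal O}$ defined in the same way. The number of $m$-th order weight-$2$ type-(a) inflection points limiting to the singularity in a general two-parameter deformation is, for general $(a,b)$ and general $\bar\tau$, the total multiplicity of the part lying off the relative singular locus of the finite scheme $\operatorname{Spec}\big((\widetilde{\mathcal O}/\widetilde I^m_{\bar\tau})\otimes_{k[[t_0]]}K\big)$, where $K$ is an algebraic closure of $k((t_0))$. Then $$\mathrm{AD}^4_{(2)}(y^2-x^s)=\begin{cases}5&\text{if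 }s=2,\\10&\text{if }s=3,\\6(s-1)&\text{if }s\ge4,\end{cases}$$ and the number of fourth-order weight-$2$ type-(a) inflection points limiting to this singularity in a general two-parameter deformation is $0$ if $s\in\{2,3\}$ and $s-1$ if $s\ge4$. (In particular, for general data the scheme above is indeed finite.) -/

import Mathlib

open scoped PowerSeries TensorProduct

noncomputable section

namespace AutoDeg

/-- The ring `k[[x, y]]`, with `x = X 0` and `y = X 1`. -/
abbrev Plane (k : Type*) [Field k] := MvPowerSeries (Fin 2) k

/-- The ring `k[[x, y]][[t_0, …, t_{r-1}]]`; the variables `inl 0, inl 1` are `x, y` and the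
variables `inr j` are the parameters `t_j`. -/
abbrev Amb (k : Type*) [Field k] (r : ℕ) := MvPowerSeries (Fin 2 ⊕ Fin r) k

/-- The ring `k[[x, y, u, v]][[t_0, …, t_{r-1}]]`; the variables `inl (inl i)` are `x, y`, the
variables `inl (inr i)` are `u, v`, and the variables `inr j` are the parameters `t_j`. -/
abbrev Dbl (k : Type*) [Field k] (r : ℕ) := MvPowerSeries ((Fin 2 ⊕ Fin 2) ⊕ Fin r) k

variable {k : Type*} [Field k]

/-! ### First-order deformations -/

/-- The Tjurina ideal `(f, ∂f/∂x, ∂f/∂y)`. -/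
def tjurinaIdeal (f : Plane k) : Ideal (Plane k) :=
  Ideal.span {f, MvPowerSeries.pderiv k 0 f, MvPowerSeries.pderiv k 1 f}

/-- The space of first-order deformations of the plane curve germ `f = 0`. -/
abbrev Def1 (f : Plane k) := Plane k ⧸ tjurinaIdeal f

/-- The power series `δ 0, …, δ (d-1)` represent a `k`-basis of the space of first-order
deformations of `f`. -/
def IsDefBasis (f : Plane k) {d : ℕ} (δ : Fin d → Plane k) : Prop :=
  LinearIndependent k (fun i => Ideal.Quotient.mk (tjurinaIdeal f) (δ i)) ∧
    Submodule.span k (Set.range fun i => Ideal.Quotient.mk (tjurinaIdeal f) (δ i)) = ⊤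

/-- The inclusion `k[[x, y]] → k[[x, y]][[t_0, …, t_{r-1}]]`. -/
def ofPlane (k : Type*) [Field k] (r : ℕ) : Plane k →ₐ[k] Amb k r :=
  MvPowerSeries.rename Sum.inl

/-- The equation `f + ∑_j t_j ∑_i c_{ji} δ_i` of the total space of the `r`-parameter deformation
obtained from the family `f + ∑_i α_i δ_i` by the linear substitution `α_i = ∑_j c_{ji} t_j`. -/
def deformation (f : Plane k) {d : ℕ} (δ : Fin d → Plane k) {r : ℕ} (c : Fin r → Fin d → k) :
    Amb k r :=
  ofPlane k r f + ∑ j, MvPowerSeries.X (Sum.inr j) * ofPlane k r (∑ i, c j i • δ i)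

/-! ### The total space, and principal parts

In this part `F = 0` is the equation of the total space `X` of a family over
`B = Spf k[[t_0, …, t_{r-1}]]`. -/

/-- The coordinate ring `O_X` of the total space. -/
abbrev Total {r : ℕ} (F : Amb k r) := Amb k r ⧸ Ideal.span {F}

/-- The ideal `(∂F/∂x, ∂F/∂y)` of `O_X`, whose zero locus is the relative singular locus
`Sing(X/B)`. -/
def singIdeal {r : ℕ} (F : Amb k r) : Ideal (Total F) :=
  Ideal.span {Ideal.Quotient.mk _ (MvPowerSeries.pderiv k (Sum.inl 0) F),
    Ideal.Quotient.mk _ (MvPowerSeries.pderiv k (Sum.inl 1) F)}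

/-- The substitution `x ↦ x`, `y ↦ y`, `t_j ↦ t_j`. -/
def left (k : Type*) [Field k] (r : ℕ) : Amb k r →ₐ[k] Dbl k r :=
  MvPowerSeries.rename (Sum.map Sum.inl id)

/-- The substitution `x ↦ u`, `y ↦ v`, `t_j ↦ t_j`. -/
def right (k : Type*) [Field k] (r : ℕ) : Amb k r →ₐ[k] Dbl k r :=
  MvPowerSeries.rename (Sum.map Sum.inr id)

/-- The ideal `(F(x, y, t), F(u, v, t)) + (u - x, v - y)^m`. -/
def ppIdeal {r : ℕ} (F : Amb k r) (m : ℕ) : Ideal (Dbl k r) :=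
  Ideal.span {left k r F, right k r F} ⊔
    Ideal.span {MvPowerSeries.X (Sum.inl (Sum.inr 0)) - MvPowerSeries.X (Sum.inl (Sum.inl 0)),
      MvPowerSeries.X (Sum.inl (Sum.inr 1)) - MvPowerSeries.X (Sum.inl (Sum.inl 1))} ^ m

/-- The module of `m`-th order relative principal parts `(O_X ⊗_{O_B} O_X) / I_Δ^m`, where the
tensor product is that of formal schemes (the completed one), so that
`O_X ⊗_{O_B} O_X = k[[x, y, u, v, t]] / (F(x, y, t), F(u, v, t))` and `I_Δ = (u - x, v - y)`. -/
abbrev PP {r : ℕ} (F : Amb k r) (m : ℕ) := Dbl k r ⧸ ppIdeal F m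

theorem span_le_comap_left {r : ℕ} (F : Amb k r) (m : ℕ) :
    Ideal.span {F} ≤ (ppIdeal F m).comap (left k r : Amb k r →+* Dbl k r) := by
  rw [Ideal.span_le]
  rintro _ rfl
  exact Ideal.mem_sup_left (Ideal.subset_span (by simp))

/-- `O_X` acts on the principal parts through the left-hand factor. -/
instance {r : ℕ} (F : Amb k r) (m : ℕ) : Algebra (Total F) (PP F m) :=
  (Ideal.quotientMap (ppIdeal F m) (left k r : Amb k r →+* Dbl k r)
    (span_le_comap_left F m)).toAlgebra

/-! ### The degeneracy ideal -/

/-- The ideal of the degeneracy locus of the map `ξ : O_X^n → P^m → (P^m)^∨∨` given by elements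
`τ_1, …, τ_n` of the module of principal parts `P^m` (for `n ≤ m`): it is generated by the
determinants `det (φ_i (τ_j))` with `φ_1, …, φ_n` in the dual module `(P^m)^∨`. If `(P^m)^∨` is
free, this is the ideal of maximal minors of the matrix of `ξ`, see `degIdeal_eq_of_basis`. -/
def degIdeal {r : ℕ} (F : Amb k r) (m : ℕ) {n : ℕ} (τ : Fin n → PP F m) : Ideal (Total F) :=
  Ideal.span (Set.range fun φ : Fin n → Module.Dual (Total F) (PP F m) =>
    (Matrix.of fun i j => φ i (τ j)).det)

/-- For a basis `e_1, …, e_m` of `(P^m)^∨`, the degeneracy ideal is generated by the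
`n × n` minors of the matrix `(e_i (τ_j))`. -/
theorem degIdeal_eq_of_basis {r : ℕ} (F : Amb k r) (m : ℕ) {n : ℕ} (τ : Fin n → PP F m)
    (e : Module.Basis (Fin m) (Total F) (Module.Dual (Total F) (PP F m))) :
    degIdeal F m τ = Ideal.span (Set.range fun ι : Fin n → Fin m =>
      ((Matrix.of fun (i : Fin m) (j : Fin n) => e i (τ j)).submatrix ι id).det) := by
  apply le_antisymm
  · refine Ideal.span_le.2 ?_
    rintro _ ⟨φ, rfl⟩
    have h : (Matrix.of fun i j => φ i (τ j)) =
        fun i => ∑ l : Fin m, e.repr (φ i) l • fun j => e l (τ j) := by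
      funext i j
      have h1 := congrArg (fun ψ : Module.Dual (Total F) (PP F m) => ψ (τ j)) (e.sum_repr (φ i))
      simp only [LinearMap.sum_apply, LinearMap.smul_apply] at h1
      rw [Matrix.of_apply, ← h1, Finset.sum_apply]
      rfl
    have h2 := (Matrix.detRowAlternating (R := Total F) (n := Fin n)).toMultilinearMap.map_sum
      (fun (i : Fin n) (l : Fin m) => e.repr (φ i) l • fun j => e l (τ j))
    have h3 : (Matrix.of fun i j => φ i (τ j)).det = ∑ ι : Fin n → Fin m,
        (∏ i, e.repr (φ i) (ι i)) •
          ((Matrix.of fun (i : Fin m) (j : Fin n) => e i (τ j)).submatrix ι id).det := by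
      rw [h]
      refine h2.trans (Finset.sum_congr rfl fun ι _ => ?_)
      exact MultilinearMap.map_smul_univ _ (fun i => e.repr (φ i) (ι i))
        (fun i j => e (ι i) (τ j))
    simp only [SetLike.mem_coe]
    rw [h3]
    exact Ideal.sum_mem _ fun ι _ => Ideal.mul_mem_left _ _ (Ideal.subset_span ⟨ι, rfl⟩)
  · refine Ideal.span_le.2 ?_
    rintro _ ⟨ι, rfl⟩
    exact Ideal.subset_span ⟨fun i => e (ι i), rfl⟩

/-! ### The weight-2 type-(a) automatic degeneracy -/

/-- A `1`-parameter deformation is admissible if its relative singular locus has codimension `2`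
in the (two-dimensional) total space, i.e. is supported at the closed point. -/
def IsAdmissible (F : Amb k 1) : Prop :=
  Module.Finite k (Total F ⧸ singIdeal F)

/-- The colength `dim_k O_X / I`. -/
def colength {r : ℕ} (F : Amb k r) (I : Ideal (Total F)) : ℕ∞ :=
  Cardinal.toENat (Module.rank k (Total F ⧸ I))

/-- The `m`-th order weight-2 type-(a) automatic degeneracy of the germ `f`, computed in the family
`f + ∑_i α_i δ_i`: the minimum of the colength of the degeneracy ideal over all admissible
`1`-parameter deformations `f + t ∑_i a_i δ_i` and all lists of `m - 1` principal parts. -/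
def AD2 (f : Plane k) {d : ℕ} (δ : Fin d → Plane k) (m : ℕ) : ℕ∞ :=
  ⨅ (a : Fin d → k) (_ : IsAdmissible (deformation f δ fun _ : Fin 1 => a))
    (τ : Fin (m - 1) → PP (deformation f δ fun _ : Fin 1 => a) m),
    colength _ (degIdeal _ m τ)

/-! ### Limiting inflection points -/

/-- The coordinate ring `O_X / I` of a closed subscheme of the total space of a `2`-parameter
family. -/
def Sub (F : Amb k 2) (I : Ideal (Total F)) := Total F ⧸ I

instance (F : Amb k 2) (I : Ideal (Total F)) : CommRing (Sub F I) :=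
  inferInstanceAs (CommRing (Total F ⧸ I))

/-- The projection `O_X → O_X / I`. -/
def toSub (F : Amb k 2) (I : Ideal (Total F)) : Total F →+* Sub F I := Ideal.Quotient.mk I

/-- For a `2`-parameter family, `O_X / I` is an algebra over `k[[t_0]]`. -/
instance (F : Amb k 2) (I : Ideal (Total F)) : Algebra k⟦X⟧ (Sub F I) :=
  (((toSub F I).comp (Ideal.Quotient.mk (Ideal.span {F}))).comp
    (MvPowerSeries.rename (fun _ : Unit => (Sum.inr 0 : Fin 2 ⊕ Fin 2)) :
      MvPowerSeries Unit k →ₐ[k] Amb k 2).toRingHom).toAlgebra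

/-- The field of the geometric generic point of `Spec k[[t_0]]`. -/
abbrev GeomGen (k : Type*) [Field k] := AlgebraicClosure (LaurentSeries k)

/-- The coordinate ring of the geometric generic fiber, over `Spec k[[t_0]]`, of the closed
subscheme `I = 0` of the total space of a `2`-parameter family. -/
abbrev GenFiber (F : Amb k 2) (I : Ideal (Total F)) := GeomGen k ⊗[k⟦X⟧] Sub F I

/-- The ideal of the relative singular locus in `GenFiber F I`. -/
def genSing (F : Amb k 2) (I : Ideal (Total F)) : Ideal (GenFiber F I) :=
  (singIdeal F).map ((Algebra.TensorProduct.includeRight :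
    Sub F I →ₐ[k⟦X⟧] GenFiber F I).toRingHom.comp (toSub F I))

/-- The total multiplicity of the part of the geometric generic fiber of `I = 0` that lies off the
relative singular locus. -/
def smoothMultiplicity (F : Amb k 2) (I : Ideal (Total F)) : ℕ :=
  ∑ᶠ p : {p : PrimeSpectrum (GenFiber F I) // ¬ genSing F I ≤ p.asIdeal},
    Module.finrank (GeomGen k) (Localization.AtPrime p.1.asIdeal)

/-- The number of `m`-th order weight-2 type-(a) inflection points limiting to the germ `f` in a
general `2`-parameter deformation is `N`: for general coefficients `c` of the deformation
`f + t_0 ∑_i c_{0i} δ_i + t_1 ∑_i c_{1i} δ_i`, and for `m - 1` general principal parts, the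
degeneracy locus has finite geometric generic fiber over `Spec k[[t_0]]`, and the part of this
fiber off the relative singular locus has total multiplicity `N`. Here "general" means that some
nonzero polynomial in the coefficients (for the principal parts: in finitely many of the
coefficients of power series that represent them) does not vanish. -/
def HasLimitingNumber (f : Plane k) {d : ℕ} (δ : Fin d → Plane k) (m N : ℕ) : Prop :=
  ∃ p : MvPolynomial (Fin 2 × Fin d) k, p ≠ 0 ∧
    ∀ c : Fin 2 → Fin d → k, MvPolynomial.eval (fun ji => c ji.1 ji.2) p ≠ 0 →
      ∃ q : MvPolynomial (Fin (m - 1) × ((Fin 2 ⊕ Fin 2) ⊕ Fin 2 →₀ ℕ)) k, q ≠ 0 ∧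
        ∀ h : Fin (m - 1) → Dbl k 2,
          MvPolynomial.eval (fun jν => MvPowerSeries.coeff jν.2 (h jν.1)) q ≠ 0 →
            Module.Finite (GeomGen k) (GenFiber (deformation f δ c)
              (degIdeal _ m fun j => Ideal.Quotient.mk (ppIdeal (deformation f δ c) m) (h j))) ∧
            smoothMultiplicity (deformation f δ c)
              (degIdeal _ m fun j => Ideal.Quotient.mk (ppIdeal (deformation f δ c) m) (h j)) = N

end AutoDeg

end

/-! Write ξ = F_y, η = -F_x and D = F_y ∂_x - F_x ∂_y. When ξ, η is a regular sequence on the total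
space, the functionals h ↦ (D^i h)|_diagonal with i < 4 generate the dual of the principal parts
(`mem_span_opFun`). The degeneracy ideal of sections h_j is then the ideal of maximal minors of the
4 × 3 matrix (D^i h_j) (`degIdeal_eq_minorIdeal`). For general sections, column operations turn the
values and first derivatives of the h_j into the identity matrix. What remains are the 2 × 2 minors
of a 3 × 2 matrix with first row (ξ, η). Row reduction brings their ideal to the form (e ξ² + f ξ ζ
- L₂₁ ζ², ξ² ζ, ξ ζ²) with ζ = η + b ξ and L₂₁ a unit (`JetData.minorIdeal_symbol_mul_coeffs`). Its
colength is 5 len(ξ, ζ) + len(e, ζ) (`len_normalForm`).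

If the deformation has a nonzero constant term, the parameter can be eliminated: the total space is
smooth with coordinates x, y, the parameter lies in (y², x^s), and the jets of F are those of y² -
x^s up to that ideal. Hence (ξ, ζ) = (y, x^(s-1)) has colength s - 1. For s ≤ 3 and general sections
e is a unit, and the total is 5 (s - 1). For s ≥ 4, e = 2γ y + ρ x^(s-2) + ... with γ the constant
term of `c20`, and ζ is δ x^(s-1) + ... modulo e. So (e, ζ) also has colength s - 1, and the total
is 6 (s - 1). The constants ρ and δ receive a correction only for s = 4.

An arbitrary admissible deformation with arbitrary sections is joined by a line to a general choice;
upper semicontinuity of the colength shows that the general value is the minimum (`AD2_curve`).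

For two parameters the same computation applies modulo t₀. Where ξ is invertible the normal form
becomes (e, ζ), and on the degeneracy locus ξ = 0 is exactly the relative singular locus
(`prime_dichotomy`). For s ≤ 3 the unit e leaves nothing off that locus. For s ≥ 4 the scheme e = ζ
= 0 is finite and flat over k[[t₀]] of rank s - 1. Moreover t₀ lies in (e, ζ, ξ)
(`param_mem_of_pow_mem`), so its generic fibre misses the singular locus and the whole rank is
counted (`limiting_of_genericity`). -/

noncomputable section

namespace AutoDeg

/-! ### Regular elements modulo an ideal, and lengths -/

section CommAlg

variable {S : Type*} [CommRing S]

/-- Multiplication by `a` is injective modulo the ideal `K`. -/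
def RegMod (K : Ideal S) (a : S) : Prop := ∀ r, a * r ∈ K → r ∈ K

theorem mem_sup_span {K : Ideal S} {a z : S} :
    z ∈ K ⊔ Ideal.span {a} ↔ ∃ κ ∈ K, ∃ r, z = κ + a * r := by
  rw [Submodule.mem_sup]
  constructor
  · rintro ⟨κ, hκ, w, hw, rfl⟩
    obtain ⟨r, rfl⟩ := Ideal.mem_span_singleton'.1 hw
    exact ⟨κ, hκ, r, by ring⟩
  · rintro ⟨κ, hκ, r, rfl⟩
    exact ⟨κ, hκ, a * r, Ideal.mul_mem_right _ _ (Ideal.mem_span_singleton_self a), rfl⟩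

theorem RegMod.of_isUnit (K : Ideal S) {a : S} (h : IsUnit a) : RegMod K a := by
  intro r hr
  exact (Ideal.unit_mul_mem_iff_mem K h).1 hr

theorem RegMod.mul {K : Ideal S} {a b : S} (ha : RegMod K a) (hb : RegMod K b) :
    RegMod K (a * b) := fun r hr => hb r (ha _ (by rwa [← mul_assoc]))

theorem RegMod.pow {K : Ideal S} {a : S} (ha : RegMod K a) (n : ℕ) : RegMod K (a ^ n) := by
  induction n with
  | zero => exact RegMod.of_isUnit K (by simp)
  | succ n ih => rw [pow_succ]; exact ih.mul ha

/-- A power of the regular element a is a multiple of b modulo K, so anything killed by b is killed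
by that power. This is how regularity is transferred between systems of parameters. -/
theorem RegMod.exchange {K : Ideal S} {a b : S} (ha : RegMod K a) {N : ℕ}
    (h : a ^ N ∈ K ⊔ Ideal.span {b}) : RegMod K b := by
  intro r hr
  obtain ⟨κ, hκ, c, hc⟩ := mem_sup_span.1 h
  refine ha.pow N r ?_
  rw [hc, show (κ + b * c) * r = r * κ + c * (b * r) by ring]
  exact add_mem (Ideal.mul_mem_left _ _ hκ) (Ideal.mul_mem_left _ _ hr)

/-- Permutability of regular sequences in a Noetherian local ring: the colon ideal N = (K : b)
satisfies N ≤ K + m N, so Nakayama gives N ≤ K. -/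
theorem RegMod.swap [IsNoetherianRing S] [IsLocalRing S] {K : Ideal S} {a b : S}
    (ha : RegMod K a) (hb : RegMod (K ⊔ Ideal.span {a}) b)
    (ham : a ∈ IsLocalRing.maximalIdeal S) :
    RegMod K b ∧ RegMod (K ⊔ Ideal.span {b}) a := by
  have key : RegMod K b := by
    let N : Ideal S :=
      { carrier := {r | b * r ∈ K}
        add_mem' := fun {x y} hx hy => by
          simp only [Set.mem_ofPred_eq] at *
          rw [mul_add]; exact add_mem hx hy
        zero_mem' := by simp
        smul_mem' := fun c x hx => by
          simp only [Set.mem_ofPred_eq, smul_eq_mul] at *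
          rw [mul_left_comm]; exact Ideal.mul_mem_left _ _ hx }
    have hN : N ≤ K ⊔ IsLocalRing.maximalIdeal S • N := by
      intro r hr
      have hr' : b * r ∈ K := hr
      obtain ⟨κ, hκ, c, rfl⟩ := mem_sup_span.1 (hb r (Ideal.mem_sup_left hr'))
      have h1 : a * (b * c) ∈ K := by
        have : a * (b * c) = b * (κ + a * c) - b * κ := by ring
        rw [this]
        exact sub_mem hr' (Ideal.mul_mem_left _ _ hκ)
      have h2 : c ∈ N := ha _ h1
      exact add_mem (Ideal.mem_sup_left hκ)
        (Ideal.mem_sup_right (Submodule.smul_mem_smul ham h2))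
    have := Submodule.le_of_le_smul_of_le_jacobson_bot (I := IsLocalRing.maximalIdeal S)
      (IsNoetherian.noetherian N) (IsLocalRing.maximalIdeal_le_jacobson _) hN
    exact fun r hr => this hr
  refine ⟨key, fun r hr => ?_⟩
  obtain ⟨κ, hκ, c, hc⟩ := mem_sup_span.1 hr
  have h1 : c ∈ K ⊔ Ideal.span {a} := by
    apply hb
    rw [show b * c = a * r + (-κ) by rw [hc]; ring]
    exact add_mem (Ideal.mem_sup_right (Ideal.mul_mem_right _ _ (Ideal.mem_span_singleton_self a)))
      (Ideal.mem_sup_left (neg_mem hκ))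
  obtain ⟨κ', hκ', c', rfl⟩ := mem_sup_span.1 h1
  have h2 : r - b * c' ∈ K := by
    apply ha
    rw [show a * (r - b * c') = κ + b * κ' by rw [mul_sub, hc]; ring]
    exact add_mem hκ (Ideal.mul_mem_left _ _ hκ')
  exact mem_sup_span.2 ⟨_, h2, c', by ring⟩

variable (k : Type*) [Field k] [Algebra k S]

/-- The length over `k` of the quotient by an ideal. -/
def len (K : Ideal S) : ℕ∞ := Module.length k (S ⧸ K)

theorem len_mono {K L : Ideal S} (h : K ≤ L) : len k L ≤ len k K :=
  Module.length_le_of_surjective (Ideal.Quotient.factorₐ k h).toLinearMap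
    (Ideal.Quotient.factor_surjective h)

theorem len_top : len k (⊤ : Ideal S) = 0 := by
  have : Subsingleton (S ⧸ (⊤ : Ideal S)) := Ideal.Quotient.subsingleton_iff.2 rfl
  exact Module.length_eq_zero

/-- Additivity of length on 0 → S/(K : z) → S/K → S/(K + z) → 0, where the first map is
multiplication by z. -/
theorem len_eq_add_of_colon {K C : Ideal S} {z : S} (h : ∀ r, z * r ∈ K ↔ r ∈ C) :
    len k K = len k C + len k (K ⊔ Ideal.span {z}) := by
  let f₀ : S →ₗ[S] S ⧸ K := (LinearMap.mulLeft S z).range.subtype.comp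
    (LinearMap.mulLeft S z).rangeRestrict |> (Submodule.mkQ K).comp
  have hf₀ : ∀ r, f₀ r = Submodule.Quotient.mk (z * r) := fun r => rfl
  have hC : C ≤ LinearMap.ker f₀ := by
    intro r hr
    rw [LinearMap.mem_ker, hf₀, Submodule.Quotient.mk_eq_zero]
    exact (h r).2 hr
  let f : (S ⧸ C) →ₗ[S] S ⧸ K := Submodule.liftQ C f₀ hC
  have hf : ∀ r, f (Submodule.Quotient.mk r) = Submodule.Quotient.mk (z * r) := fun r => rfl
  let g : (S ⧸ K) →ₗ[S] S ⧸ (K ⊔ Ideal.span {z}) := Submodule.factor le_sup_left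
  have hg : ∀ r, g (Submodule.Quotient.mk r) = Submodule.Quotient.mk r := fun r => rfl
  refine Module.length_eq_add_of_exact (f.restrictScalars k) (g.restrictScalars k) ?_ ?_ ?_
  · rw [injective_iff_map_eq_zero]
    intro x
    obtain ⟨r, rfl⟩ := Submodule.Quotient.mk_surjective _ x
    intro hx
    have : f (Submodule.Quotient.mk r) = 0 := hx
    rw [hf, Submodule.Quotient.mk_eq_zero] at this
    exact (Submodule.Quotient.mk_eq_zero _).2 ((h r).1 this)
  · intro x
    obtain ⟨r, rfl⟩ := Submodule.Quotient.mk_surjective _ x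
    exact ⟨Submodule.Quotient.mk r, rfl⟩
  · intro x
    obtain ⟨r, rfl⟩ := Submodule.Quotient.mk_surjective _ x
    change g (Submodule.Quotient.mk r) = 0 ↔ _
    rw [hg, Submodule.Quotient.mk_eq_zero, mem_sup_span]
    constructor
    · rintro ⟨κ, hκ, c, rfl⟩
      refine ⟨Submodule.Quotient.mk c, ?_⟩
      change f _ = _
      rw [hf, Submodule.Quotient.eq]
      rw [show z * c - (κ + z * c) = -κ by ring]
      exact neg_mem hκ
    · rintro ⟨y, hy⟩
      obtain ⟨c, rfl⟩ := Submodule.Quotient.mk_surjective _ y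
      change f _ = _ at hy
      rw [hf, Submodule.Quotient.eq] at hy
      exact ⟨-(z * c - r), neg_mem hy, c, by ring⟩

theorem sup_span_sup_eq_of_dvd (K : Ideal S) {a b : S} (h : a ∣ b) :
    K ⊔ Ideal.span {b} ⊔ Ideal.span {a} = K ⊔ Ideal.span {a} := by
  rw [sup_assoc, sup_eq_right.2 (Ideal.span_singleton_le_span_singleton.2 h)]

theorem RegMod.len_mul {K : Ideal S} {a : S} (b : S) (ha : RegMod K a) :
    len k (K ⊔ Ideal.span {a * b}) = len k (K ⊔ Ideal.span {a}) + len k (K ⊔ Ideal.span {b}) := by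
  rw [len_eq_add_of_colon k (C := K ⊔ Ideal.span {b}) (z := a), add_comm,
    sup_span_sup_eq_of_dvd K (Dvd.intro b rfl)]
  intro r
  constructor
  · intro h
    obtain ⟨κ, hκ, c, hc⟩ := mem_sup_span.1 h
    refine mem_sup_span.2 ⟨r - b * c, ha _ ?_, c, by ring⟩
    rw [mul_sub, hc, show κ + a * b * c - a * (b * c) = κ by ring]
    exact hκ
  · intro h
    obtain ⟨κ, hκ, c, rfl⟩ := mem_sup_span.1 h
    exact mem_sup_span.2 ⟨a * κ, Ideal.mul_mem_left _ _ hκ, c, by ring⟩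

theorem RegMod.len_pow {K : Ideal S} {a : S} (ha : RegMod K a) (n : ℕ) :
    len k (K ⊔ Ideal.span {a ^ n}) = n * len k (K ⊔ Ideal.span {a}) := by
  induction n with
  | zero => simp [len_top]
  | succ n ih =>
    rw [pow_succ', ha.len_mul k, ih]
    push_cast
    ring

theorem mem_sup_span_triple {K : Ideal S} {a b c z : S} :
    z ∈ K ⊔ Ideal.span {a, b, c} ↔ ∃ κ ∈ K, ∃ p q u, z = κ + a * p + b * q + c * u := by
  rw [show ({a, b, c} : Set S) = {a} ∪ ({b} ∪ {c}) from rfl, Ideal.span_union, Ideal.span_union,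
    ← sup_assoc, ← sup_assoc, mem_sup_span]
  constructor
  · rintro ⟨κ, hκ, u, rfl⟩
    obtain ⟨κ', hκ', q, rfl⟩ := mem_sup_span.1 hκ
    obtain ⟨κ'', hκ'', p, rfl⟩ := mem_sup_span.1 hκ'
    exact ⟨κ'', hκ'', p, q, u, rfl⟩
  · rintro ⟨κ, hκ, p, q, u, rfl⟩
    exact ⟨_, mem_sup_span.2 ⟨_, mem_sup_span.2 ⟨κ, hκ, p, rfl⟩, q, rfl⟩, u, rfl⟩

/-- The length of an ideal of the form `(e ξ² + f ξ ζ + c ζ², ξ² ζ, ξ ζ²)`. -/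
theorem len_normalForm {K : Ideal S} {ξ ζ e f c : S} (hc : IsUnit c) (h1 : RegMod K ζ)
    (h2 : RegMod (K ⊔ Ideal.span {ζ}) ξ) (h3 : RegMod (K ⊔ Ideal.span {ζ}) e) :
    len k (K ⊔ Ideal.span {e * ξ ^ 2 + f * ξ * ζ + c * ζ ^ 2, ξ ^ 2 * ζ, ξ * ζ ^ 2}) =
      5 * len k (K ⊔ Ideal.span {ζ} ⊔ Ideal.span {ξ}) +
        len k (K ⊔ Ideal.span {ζ} ⊔ Ideal.span {e}) := by
  set A := e * ξ ^ 2 + f * ξ * ζ + c * ζ ^ 2 with hA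
  obtain ⟨c', hc'⟩ := hc.exists_left_inv
  -- The colon ideal by ζ is (ξ, ζ)². Modulo ζ a relation reads e ξ² p ≡ 0, which makes p divisible
  -- by ζ modulo K. Conversely ζ³ is reached because c is a unit.
  have e1 : ∀ r, ζ * r ∈ K ⊔ Ideal.span {A, ξ ^ 2 * ζ, ξ * ζ ^ 2} ↔
      r ∈ K ⊔ Ideal.span {ξ ^ 2, ξ * ζ, ζ ^ 2} := by
    intro r
    rw [mem_sup_span_triple, mem_sup_span_triple]
    constructor
    · rintro ⟨κ, hκ, p, q, u, hr⟩
      have hp : p ∈ K ⊔ Ideal.span {ζ} := by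
        apply h2.pow 2
        apply h3
        refine mem_sup_span.2 ⟨-κ, neg_mem hκ, r - f * ξ * p - c * ζ * p - ξ ^ 2 * q - ξ * ζ * u, ?_⟩
        linear_combination -hr + p * hA
      obtain ⟨κ', hκ', p', rfl⟩ := mem_sup_span.1 hp
      have h4 : r - (A * p' + ξ ^ 2 * q + ξ * ζ * u) ∈ K := by
        apply h1
        rw [show ζ * (r - (A * p' + ξ ^ 2 * q + ξ * ζ * u)) = κ + A * κ' by
          linear_combination hr]
        exact add_mem hκ (Ideal.mul_mem_left _ _ hκ')
      exact ⟨_, h4, e * p' + q, f * p' + u, c * p', by rw [hA]; ring⟩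
    · rintro ⟨κ, hκ, p, q, u, rfl⟩
      refine ⟨ζ * κ, Ideal.mul_mem_left _ _ hκ, c' * ζ * u, p - c' * e * u, q - c' * f * u, ?_⟩
      rw [hA]
      linear_combination (-ζ ^ 3 * u) * hc'
  -- A second colon by ζ reduces (ξ, ζ)² to (ξ, ζ).
  have e2 : ∀ r, ζ * r ∈ K ⊔ Ideal.span {ξ ^ 2, ξ * ζ, ζ ^ 2} ↔
      r ∈ K ⊔ Ideal.span {ζ} ⊔ Ideal.span {ξ} := by
    intro r
    rw [mem_sup_span_triple]
    constructor
    · rintro ⟨κ, hκ, p, q, u, hr⟩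
      have hp : p ∈ K ⊔ Ideal.span {ζ} := by
        apply h2.pow 2
        exact mem_sup_span.2 ⟨-κ, neg_mem hκ, r - ξ * q - ζ * u, by linear_combination -hr⟩
      obtain ⟨κ', hκ', p', rfl⟩ := mem_sup_span.1 hp
      have h4 : r - (ξ ^ 2 * p' + ξ * q + ζ * u) ∈ K := by
        apply h1
        rw [show ζ * (r - (ξ ^ 2 * p' + ξ * q + ζ * u)) = κ + ξ ^ 2 * κ' by
          linear_combination hr]
        exact add_mem hκ (Ideal.mul_mem_left _ _ hκ')
      exact mem_sup_span.2 ⟨_, mem_sup_span.2 ⟨_, h4, u, rfl⟩, ξ * p' + q, by ring⟩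
    · intro h
      obtain ⟨κ', hκ', p, rfl⟩ := mem_sup_span.1 h
      obtain ⟨κ, hκ, q, rfl⟩ := mem_sup_span.1 hκ'
      exact ⟨ζ * κ, Ideal.mul_mem_left _ _ hκ, 0, p, q, by ring⟩
  have e3 : K ⊔ Ideal.span {A, ξ ^ 2 * ζ, ξ * ζ ^ 2} ⊔ Ideal.span {ζ} =
      K ⊔ Ideal.span {ζ} ⊔ Ideal.span {e * ξ ^ 2} := by
    ext z
    rw [mem_sup_span, mem_sup_span]
    constructor
    · rintro ⟨κ', hκ', r, rfl⟩
      obtain ⟨κ, hκ, p, q, u, rfl⟩ := mem_sup_span_triple.1 hκ'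
      exact ⟨_, mem_sup_span.2 ⟨κ, hκ, (f * ξ + c * ζ) * p + ξ ^ 2 * q + ξ * ζ * u + r, rfl⟩, p,
        by rw [hA]; ring⟩
    · rintro ⟨κ', hκ', p, rfl⟩
      obtain ⟨κ, hκ, q, rfl⟩ := mem_sup_span.1 hκ'
      exact ⟨_, mem_sup_span_triple.2 ⟨κ, hκ, p, 0, 0, rfl⟩, q - (f * ξ + c * ζ) * p,
        by rw [hA]; ring⟩
  have e4 : K ⊔ Ideal.span {ξ ^ 2, ξ * ζ, ζ ^ 2} ⊔ Ideal.span {ζ} =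
      K ⊔ Ideal.span {ζ} ⊔ Ideal.span {ξ ^ 2} := by
    ext z
    rw [mem_sup_span, mem_sup_span]
    constructor
    · rintro ⟨κ', hκ', r, rfl⟩
      obtain ⟨κ, hκ, p, q, u, rfl⟩ := mem_sup_span_triple.1 hκ'
      exact ⟨_, mem_sup_span.2 ⟨κ, hκ, ξ * q + ζ * u + r, rfl⟩, p, by ring⟩
    · rintro ⟨κ', hκ', p, rfl⟩
      obtain ⟨κ, hκ, q, rfl⟩ := mem_sup_span.1 hκ'
      exact ⟨_, mem_sup_span_triple.2 ⟨κ, hκ, p, 0, 0, rfl⟩, q, by ring⟩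
  -- The two cuts by ζ contribute len(ζ, e ξ²) = len(ζ, e) + 2 len(ζ, ξ) and len(ζ, ξ²) = 2 len(ζ,
  -- ξ). The last colon ideal contributes len(ζ, ξ), which makes five copies.
  rw [len_eq_add_of_colon k e1, e3, len_eq_add_of_colon k e2, e4, h3.len_mul k, h2.len_pow k]
  push_cast
  ring

end CommAlg

/-! ### Power series -/

section PowerSeriesFacts

variable {σ τ : Type*} {k : Type*} [Field k]

open MvPowerSeries in
theorem mem_span_X_image_iff (A : Finset σ) (f : MvPowerSeries σ k) :
    f ∈ Ideal.span ((X : σ → MvPowerSeries σ k) '' (A : Set σ)) ↔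
      ∀ ν : σ →₀ ℕ, (∀ i ∈ A, ν i = 0) → coeff ν f = 0 := by
  classical
  constructor
  · let I₀ : Ideal (MvPowerSeries σ k) :=
      { carrier := {f | ∀ ν : σ →₀ ℕ, (∀ i ∈ A, ν i = 0) → coeff ν f = 0}
        add_mem' := fun {a b} ha hb ν hν => by rw [map_add, ha ν hν, hb ν hν, add_zero]
        zero_mem' := fun ν _ => by simp
        smul_mem' := fun c x hx ν hν => by
          rw [smul_eq_mul, coeff_mul]
          refine Finset.sum_eq_zero fun p hp => ?_
          rw [hx p.2, mul_zero]
          intro i hi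
          have h1 := DFunLike.congr_fun (Finset.HasAntidiagonal.mem_antidiagonal.1 hp) i
          rw [Finsupp.add_apply, hν i hi] at h1
          omega }
    intro hf
    have h : Ideal.span ((X : σ → MvPowerSeries σ k) '' (A : Set σ)) ≤ I₀ := by
      rw [Ideal.span_le]
      rintro _ ⟨i, hi, rfl⟩ ν hν
      exact X_dvd_iff.1 dvd_rfl ν (hν i hi)
    exact h hf
  · induction A using Finset.induction_on generalizing f with
    | empty =>
      intro h
      have : f = 0 := by ext ν; simpa using h ν (by simp)
      simp [this]
    | insert a A ha ih =>
      intro h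
      -- g collects the terms of f free of X a; the remainder is divisible by X a.
      let g : MvPowerSeries σ k := fun ν => if ν a = 0 then coeff ν f else 0
      have hg : ∀ ν, coeff ν g = if ν a = 0 then coeff ν f else 0 := fun ν => rfl
      have h1 : g ∈ Ideal.span ((X : σ → MvPowerSeries σ k) '' (A : Set σ)) := by
        refine ih g fun ν hν => ?_
        rw [hg]
        split_ifs with h0
        · exact h ν (by simpa [h0] using hν)
        · rfl
      have h2 : X a ∣ f - g := by
        rw [X_dvd_iff]
        intro ν hν
        rw [map_sub, hg, if_pos hν, sub_self]
      rw [show f = g + (f - g) by ring]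
      refine add_mem (Ideal.span_mono (Set.image_mono (by simp)) h1) ?_
      exact Ideal.mem_of_dvd _ h2 (Ideal.subset_span ⟨a, by simp, rfl⟩)

open MvPowerSeries in
theorem regMod_span_X (A : Finset σ) {j : σ} (hj : j ∉ A) :
    RegMod (Ideal.span ((X : σ → MvPowerSeries σ k) '' (A : Set σ))) (X j) := by
  classical
  intro r hr
  rw [mem_span_X_image_iff] at hr ⊢
  intro ν hν
  have := hr (Finsupp.single j 1 + ν) (fun i hi => by
    have : j ≠ i := fun h => hj (h ▸ hi)
    simp [this, hν i hi])
  rwa [X, coeff_add_monomial_mul, one_mul] at this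

theorem mem_maximalIdeal_iff (f : MvPowerSeries σ k) :
    f ∈ IsLocalRing.maximalIdeal (MvPowerSeries σ k) ↔ MvPowerSeries.constantCoeff f = 0 := by
  rw [IsLocalRing.mem_maximalIdeal, mem_nonunits_iff, MvPowerSeries.isUnit_iff_constantCoeff,
    isUnit_iff_ne_zero, not_not]

theorem maximalIdeal_eq_span_X [Finite σ] :
    IsLocalRing.maximalIdeal (MvPowerSeries σ k) = Ideal.span (Set.range MvPowerSeries.X) := by
  classical
  have := Fintype.ofFinite σ
  ext f
  rw [mem_maximalIdeal_iff, ← Set.image_univ, ← Finset.coe_univ, mem_span_X_image_iff]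
  constructor
  · intro h ν hν
    have : ν = 0 := by ext i; simpa using hν i (Finset.mem_univ i)
    rw [this]; simpa using h
  · intro h
    simpa using h 0 (by simp)

/-! ### Partial derivatives and renaming of variables -/

section Pderiv

open MvPowerSeries

theorem pderiv_rename_embedding (e : σ ↪ τ) (i : σ) (f : MvPowerSeries σ k) :
    pderiv k (e i) (rename e f) = rename e (pderiv k i f) := by
  ext n
  rw [coeff_pderiv]
  by_cases hn : n ∈ Set.range (Finsupp.embDomain e)
  · obtain ⟨m, rfl⟩ := hn
    rw [coeff_embDomain_rename, coeff_pderiv,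
      show Finsupp.embDomain e m + Finsupp.single (e i) 1 =
        Finsupp.embDomain e (m + Finsupp.single i 1) by
        rw [Finsupp.embDomain_add, Finsupp.embDomain_single], coeff_embDomain_rename,
      Finsupp.embDomain_apply_self]
  · have h (ν : τ →₀ ℕ) (hν : ν ∉ Set.range (Finsupp.embDomain e)) :
        coeff ν (rename e f) = 0 :=
      coeff_rename_eq_zero _ _ (by rwa [funext fun v => (Finsupp.embDomain_eq_mapDomain e v).symm])
    have h' : coeff n (rename e (pderiv k i f)) = 0 :=
      coeff_rename_eq_zero _ _ (by rwa [funext fun v => (Finsupp.embDomain_eq_mapDomain e v).symm])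
    rw [h', h, zero_mul]
    rw [Finsupp.mem_range_embDomain_iff] at hn ⊢
    intro h2
    refine hn (subset_trans ?_ h2)
    intro j hj
    simp only [Finset.mem_coe, Finsupp.mem_support_iff, Finsupp.add_apply] at hj ⊢
    omega

theorem pderiv_rename_of_notMem (e : σ ↪ τ) {j : τ} (hj : j ∉ Set.range e)
    (f : MvPowerSeries σ k) : pderiv k j (rename e f) = 0 := by
  ext n
  have h (ν : τ →₀ ℕ) (hν : ν ∉ Set.range (Finsupp.embDomain e)) : coeff ν (rename e f) = 0 :=
    coeff_rename_eq_zero _ _ (by rwa [funext fun v => (Finsupp.embDomain_eq_mapDomain e v).symm])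
  rw [coeff_pderiv, h, zero_mul, map_zero]
  rw [Finsupp.mem_range_embDomain_iff]
  exact fun h2 => hj (h2 (by simp))

theorem pderiv_pderiv_comm (i j : σ) (f : MvPowerSeries σ k) :
    pderiv k i (pderiv k j f) = pderiv k j (pderiv k i f) := by
  classical
  ext n
  simp only [coeff_pderiv, Finsupp.add_apply]
  rw [add_right_comm]
  by_cases h : i = j
  · subst h; ring
  · simp [h, Ne.symm h]; ring

end Pderiv

end PowerSeriesFacts

/-! ### The ideal of maximal minors of a `4 × 3` matrix -/

section Minors

variable {S : Type*} [CommRing S]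

/-- The ideal of maximal minors of a `4 × 3` matrix. -/
def minorIdeal (E : Matrix (Fin 4) (Fin 3) S) : Ideal S :=
  Ideal.span (Set.range fun ι : Fin 3 → Fin 4 => (E.submatrix ι id).det)

theorem minorIdeal_mul_le (E : Matrix (Fin 4) (Fin 3) S) (C : Matrix (Fin 3) (Fin 3) S) :
    minorIdeal (E * C) ≤ minorIdeal E := by
  refine Ideal.span_le.2 ?_
  rintro _ ⟨ι, rfl⟩
  have h : (E * C).submatrix ι id = E.submatrix ι id * C := by
    ext i j; simp [Matrix.mul_apply]
  simp only [SetLike.mem_coe]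
  rw [h, Matrix.det_mul]
  exact Ideal.mul_mem_right _ _ (Ideal.subset_span ⟨ι, rfl⟩)

theorem minorIdeal_mul_of_isUnit (E : Matrix (Fin 4) (Fin 3) S) {C : Matrix (Fin 3) (Fin 3) S}
    (hC : IsUnit C.det) : minorIdeal (E * C) = minorIdeal E := by
  refine le_antisymm (minorIdeal_mul_le E C) ?_
  have h := minorIdeal_mul_le (E * C) C⁻¹
  rwa [Matrix.mul_assoc, Matrix.mul_nonsing_inv C hC, Matrix.mul_one] at h

theorem mem_span_triple {a b c z : S} :
    z ∈ Ideal.span {a, b, c} ↔ ∃ p q u, z = a * p + b * q + c * u := by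
  have h := mem_sup_span_triple (K := (⊥ : Ideal S)) (a := a) (b := b) (c := c) (z := z)
  rw [bot_sup_eq] at h
  rw [h]
  simp

theorem span_triple_eq {a b c a' b' c' : S} (h1 : a ∈ Ideal.span {a', b', c'})
    (h2 : b ∈ Ideal.span {a', b', c'}) (h3 : c ∈ Ideal.span {a', b', c'})
    (h1' : a' ∈ Ideal.span {a, b, c}) (h2' : b' ∈ Ideal.span {a, b, c})
    (h3' : c' ∈ Ideal.span {a, b, c}) : Ideal.span {a, b, c} = Ideal.span {a', b', c'} := by
  apply le_antisymm <;> rw [Ideal.span_le] <;> rintro _ (rfl | rfl | rfl) <;> assumption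

/-- Expansion along the first column writes each 3 × 3 minor in terms of 2 × 2 minors of the last
two columns. Minors through the first row recover these, and the entries 0 in that row leave only
three of them. -/
theorem minorIdeal_eq_of_first_row {E : Matrix (Fin 4) (Fin 3) S} (h0 : E 0 0 = 1)
    (h1 : E 0 1 = 0) (h2 : E 0 2 = 0) :
    minorIdeal E = Ideal.span {E 1 1 * E 2 2 - E 1 2 * E 2 1, E 1 1 * E 3 2 - E 1 2 * E 3 1,
      E 2 1 * E 3 2 - E 2 2 * E 3 1} := by
  apply le_antisymm
  · refine Ideal.span_le.2 ?_
    rintro _ ⟨ι, rfl⟩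
    set I := Ideal.span {E 1 1 * E 2 2 - E 1 2 * E 2 1, E 1 1 * E 3 2 - E 1 2 * E 3 1,
      E 2 1 * E 3 2 - E 2 2 * E 3 1} with hI
    have g1 : E 1 1 * E 2 2 - E 1 2 * E 2 1 ∈ I := Ideal.subset_span (by simp)
    have g2 : E 1 1 * E 3 2 - E 1 2 * E 3 1 ∈ I := Ideal.subset_span (by simp)
    have g3 : E 2 1 * E 3 2 - E 2 2 * E 3 1 ∈ I := Ideal.subset_span (by simp)
    have key : ∀ i j : Fin 4, E i 1 * E j 2 - E i 2 * E j 1 ∈ I := by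
      have hlt : ∀ i j : Fin 4, i < j → E i 1 * E j 2 - E i 2 * E j 1 ∈ I := by
        intro i j hij
        fin_cases i <;> fin_cases j <;> simp [h1, h2] at hij ⊢ <;> assumption
      intro i j
      rcases lt_trichotomy i j with h | rfl | h
      · exact hlt i j h
      · rw [show E i 1 * E i 2 - E i 2 * E i 1 = 0 by ring]
        exact zero_mem _
      · rw [show E i 1 * E j 2 - E i 2 * E j 1 = -(E j 1 * E i 2 - E j 2 * E i 1) by ring]
        exact neg_mem (hlt j i h)
    simp only [SetLike.mem_coe, Matrix.det_fin_three, Matrix.submatrix_apply, id]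
    rw [show ∀ a b c d e f g h i : S, a * e * i - a * f * h - b * d * i + b * f * g + c * d * h -
      c * e * g = a * (e * i - f * h) - d * (b * i - c * h) + g * (b * f - c * e) by intros; ring]
    exact add_mem (sub_mem (Ideal.mul_mem_left _ _ (key _ _)) (Ideal.mul_mem_left _ _ (key _ _)))
      (Ideal.mul_mem_left _ _ (key _ _))
  · rw [Ideal.span_le]
    have key : ∀ i j : Fin 4, E i 1 * E j 2 - E i 2 * E j 1 ∈ minorIdeal E := by
      intro i j
      have : (E.submatrix ![0, i, j] id).det ∈ minorIdeal E := Ideal.subset_span ⟨_, rfl⟩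
      rw [Matrix.det_fin_three] at this
      simpa [h0, h1, h2] using this
    rintro _ (rfl | rfl | rfl) <;> exact key _ _

/-- Row reduction of the minors of a `3 × 2` matrix whose first row is `(ξ, η)` and whose other
entries lie in the ideal `(ξ, η)`. -/
theorem span_minors_eq {ξ η X Y X' Y' μ lam w L11 L21 l b1 b2 b2' c ζ : S}
    (hX' : X' = μ * ξ + lam * X) (hY' : Y' = μ * η + lam * Y + w)
    (hX : X = ξ * L11 + η * L21) (hl : l * L21 = 1)
    (hw : w = ξ * (b1 * ξ + b2 * η) + c * (ξ * Y - η * X)) (hb : b2' * b2 = 1)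
    (hζ : ζ = η + b2' * b1 * ξ) :
    Ideal.span {ξ * Y - η * X, ξ * Y' - η * X', X * Y' - Y * X'} =
      Ideal.span {ξ * Y - η * X, ξ ^ 2 * ζ, ξ * ζ ^ 2} := by
  have hB : b1 * ξ + b2 * η = b2 * ζ := by rw [hζ]; linear_combination (-b1 * ξ) * hb
  rw [hB] at hw
  set A := ξ * Y - η * X with hA
  have hη : η = ζ - b2' * b1 * ξ := by rw [hζ]; ring
  have hXζ : X = ξ * (L11 - b2' * b1 * L21) + ζ * L21 := by rw [hX, hη]; ring
  -- The μ-terms cancel and the λ-terms give λ A, so modulo A only ξ w = b₂ ξ² ζ is left.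
  have e2 : ξ * Y' - η * X' = (lam + ξ * c) * A + b2 * (ξ ^ 2 * ζ) := by
    rw [hX', hY', hw]; linear_combination (-lam) * hA
  -- Modulo A this minor is X w, that is b₂ X ξ ζ. The coefficient of ζ in X is the unit L₂₁, so
  -- modulo ξ² ζ the new generator is ξ ζ².
  have e3 : X * Y' - Y * X' = (X * c - μ) * A + (L11 - b2' * b1 * L21) * b2 * (ξ ^ 2 * ζ) +
      L21 * b2 * (ξ * ζ ^ 2) := by
    rw [hX', hY', hw]; linear_combination μ * hA + (ξ * b2 * ζ) * hXζ
  apply span_triple_eq <;> rw [mem_span_triple]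
  · exact ⟨1, 0, 0, by ring⟩
  · exact ⟨lam + ξ * c, b2, 0, by rw [e2]; ring⟩
  · exact ⟨X * c - μ, (L11 - b2' * b1 * L21) * b2, L21 * b2, by rw [e3]; ring⟩
  · exact ⟨1, 0, 0, by ring⟩
  · exact ⟨-b2' * (lam + ξ * c), b2', 0, by rw [e2]; linear_combination (-ξ ^ 2 * ζ) * hb⟩
  · refine ⟨-b2' * l * (X * c - μ) + b2' * l * (L11 - b2' * b1 * L21) * (lam + ξ * c),
      -b2' * l * (L11 - b2' * b1 * L21), b2' * l, ?_⟩
    rw [e3, e2]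
    linear_combination (-ξ * ζ ^ 2) * hb + (-ξ * ζ ^ 2 * b2' * b2) * hl

end Minors

/-! ### Third-order jets -/

/-- Values of the partial derivatives of a function `F`, up to order three (`ξ = F_y`, `η = -F_x`),
and of the partial derivatives of orders two and three of two further functions. -/
structure JetData (S : Type*) where
  (ξ η fxx fxy fyy fxxx fxxy fxyy fyyy : S)
  (a20 a11 a02 a30 a21 a12 a03 c20 c11 c02 c30 c21 c12 c03 : S)

/-- The matrix that expresses `h, Dh, D²h, D³h`, for `D = F_y ∂_x - F_x ∂_y`, by the partial
derivatives `h, h_x, h_y, h_xx, h_xy, h_yy, h_xxx, h_xxy, h_xyy, h_yyy`. -/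
def symbolMatrix {S : Type*} [CommRing S] (ξ η fxx fxy fyy fxxx fxxy fxyy fyyy : S) :
    Matrix (Fin 4) (Fin 10) S :=
  !![1, 0, 0, 0, 0, 0, 0, 0, 0, 0;
    0, ξ, η, 0, 0, 0, 0, 0, 0, 0;
    0, fxy * ξ + fyy * η, -fxx * ξ - fxy * η, ξ ^ 2, 2 * ξ * η, η ^ 2, 0, 0, 0, 0;
    0, (fxy ^ 2 - fxx * fyy) * ξ + fxxy * ξ ^ 2 + 2 * fxyy * ξ * η + fyyy * η ^ 2,
      (fxy ^ 2 - fxx * fyy) * η - (fxxx * ξ ^ 2 + 2 * fxxy * ξ * η + fxyy * η ^ 2),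
      3 * ξ * (fxy * ξ + fyy * η),
      3 * (ξ * (-fxx * ξ - fxy * η) + η * (fxy * ξ + fyy * η)),
      3 * η * (-fxx * ξ - fxy * η), ξ ^ 3, 3 * ξ ^ 2 * η, 3 * ξ * η ^ 2, η ^ 3]

namespace JetData

variable {S : Type*} [CommRing S] (j : JetData S)

/-- Coefficients of the 3 × 2 matrix (D^i p, D^i q) for the two nonconstant normalized sections. The
second row is (ξ L₁₁ + η L₂₁, ξ L₁₂ + η L₂₂). The third row is (f_xy² - f_xx f_yy) times (ξ, η),
plus (ξ Z₁₁ + η Z₂₁, ξ Z₁₂ + η Z₂₂), where each Z is a form with coefficients Zx, Ze in ξ, η. -/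
def L11 : S := j.fxy + j.a20 * j.ξ + 2 * j.a11 * j.η
def L21 : S := j.fyy + j.a02 * j.η
def L12 : S := -j.fxx + j.c20 * j.ξ + 2 * j.c11 * j.η
def L22 : S := -j.fxy + j.c02 * j.η
def Z11x : S := j.fxxy + 3 * j.a20 * j.fxy - 3 * j.a11 * j.fxx + j.a30 * j.ξ
def Z11e : S := 2 * j.fxyy + 3 * j.a20 * j.fyy - 3 * j.a11 * j.fxy +
  3 * j.a21 * j.ξ + 3 * j.a12 * j.η
def Z21x : S := 3 * j.a11 * j.fxy - 3 * j.a02 * j.fxx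
def Z21e : S := j.fyyy + 3 * j.a11 * j.fyy - 3 * j.a02 * j.fxy + j.a03 * j.η
def Z12x : S := -j.fxxx + 3 * j.c20 * j.fxy - 3 * j.c11 * j.fxx + j.c30 * j.ξ
def Z12e : S := -2 * j.fxxy + 3 * j.c20 * j.fyy - 3 * j.c11 * j.fxy + 3 * j.c21 * j.ξ +
  3 * j.c12 * j.η
def Z22x : S := 3 * j.c11 * j.fxy - 3 * j.c02 * j.fxx
def Z22e : S := -j.fxyy + 3 * j.c11 * j.fyy - 3 * j.c02 * j.fxy + j.c03 * j.η
-- λ = lamx ξ + lame η is the multiple of the second row whose subtraction removes the η-part of the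
-- first entry of the third row; this needs L₂₁ invertible. A multiple of the first row removes the
-- ξ-part, and the second entry is left with w20 ξ² + w11 ξ η + w02 η².
def lamx : S := Ring.inverse j.L21 * j.Z21x
def lame : S := Ring.inverse j.L21 * j.Z21e
def w20 : S := j.Z12x - j.lamx * j.L12
def w11 : S := j.Z12e - j.lame * j.L12 + j.Z22x - j.Z11x - j.lamx * (j.L22 - j.L11)
def w02 : S := j.Z22e - j.Z11e - j.lame * (j.L22 - j.L11)
-- The first minor A = L₁₂ ξ² + (L₂₂ - L₁₁) ξ η - L₂₁ η² expresses η² modulo A, which turns the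
-- remaining quadratic form into ξ (b1 ξ + b2 η).
def b1 : S := j.w20 + Ring.inverse j.L21 * j.w02 * j.L12
def b2 : S := j.w11 + Ring.inverse j.L21 * j.w02 * (j.L22 - j.L11)
def b : S := Ring.inverse j.b2 * j.b1
def ζ : S := j.η + j.b * j.ξ
-- e and f are the coefficients of ξ² and ξ ζ in A after the substitution η = ζ - b ξ.
def e : S := j.L12 - j.b * (j.L22 - j.L11) - j.b ^ 2 * j.L21
def f : S := (j.L22 - j.L11) + 2 * j.b * j.L21

/-- The symbol matrix of the jet. -/
def symbol : Matrix (Fin 4) (Fin 10) S :=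
  symbolMatrix j.ξ j.η j.fxx j.fxy j.fyy j.fxxx j.fxxy j.fxyy j.fyyy

/-- The partial derivatives of three functions with first-order parts `1`, `p` and `q`. -/
def coeffs (z : Fin 10 → S) : Matrix (Fin 10) (Fin 3) S :=
  !![1, 0, 0; 0, 1, 0; 0, 0, 1; z 3, j.a20, j.c20; z 4, j.a11, j.c11; z 5, j.a02, j.c02;
    z 6, j.a30, j.c30; z 7, j.a21, j.c21; z 8, j.a12, j.c12; z 9, j.a03, j.c03]

/-- The ideal `(e ξ² + f ξ ζ - L₂₁ ζ², ξ² ζ, ξ ζ²)`. -/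
def normalIdeal : Ideal S :=
  Ideal.span {j.e * j.ξ ^ 2 + j.f * j.ξ * j.ζ + -j.L21 * j.ζ ^ 2, j.ξ ^ 2 * j.ζ, j.ξ * j.ζ ^ 2}

theorem minorIdeal_symbol_mul_coeffs (z : Fin 10 → S) (h1 : IsUnit j.L21) (h2 : IsUnit j.b2) :
    minorIdeal (j.symbol * j.coeffs z) = j.normalIdeal := by
  set X := j.ξ * j.L11 + j.η * j.L21 with hX
  set Y := j.ξ * j.L12 + j.η * j.L22 with hY
  set X' := (j.fxy ^ 2 - j.fxx * j.fyy) * j.ξ + j.ξ * (j.Z11x * j.ξ + j.Z11e * j.η) +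
    j.η * (j.Z21x * j.ξ + j.Z21e * j.η) with hX'
  set Y' := (j.fxy ^ 2 - j.fxx * j.fyy) * j.η + j.ξ * (j.Z12x * j.ξ + j.Z12e * j.η) +
    j.η * (j.Z22x * j.ξ + j.Z22e * j.η) with hY'
  have hl : Ring.inverse j.L21 * j.L21 = 1 := Ring.inverse_mul_cancel _ h1
  have hb : Ring.inverse j.b2 * j.b2 = 1 := Ring.inverse_mul_cancel _ h2
  have E11 : (j.symbol * j.coeffs z) 1 1 = j.ξ := by
    simp [symbol, symbolMatrix, coeffs, Matrix.mul_apply, Fin.sum_univ_succ]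
  have E12 : (j.symbol * j.coeffs z) 1 2 = j.η := by
    simp [symbol, symbolMatrix, coeffs, Matrix.mul_apply, Fin.sum_univ_succ]
  have E21 : (j.symbol * j.coeffs z) 2 1 = X := by
    simp [symbol, symbolMatrix, coeffs, Matrix.mul_apply, Fin.sum_univ_succ]
    rw [hX, L11, L21]; ring
  have E22 : (j.symbol * j.coeffs z) 2 2 = Y := by
    simp [symbol, symbolMatrix, coeffs, Matrix.mul_apply, Fin.sum_univ_succ]
    rw [hY, L12, L22]; ring
  have E31 : (j.symbol * j.coeffs z) 3 1 = X' := by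
    simp [symbol, symbolMatrix, coeffs, Matrix.mul_apply, Fin.sum_univ_succ]
    rw [hX', Z11x, Z11e, Z21x, Z21e]; ring
  have E32 : (j.symbol * j.coeffs z) 3 2 = Y' := by
    simp [symbol, symbolMatrix, coeffs, Matrix.mul_apply, Fin.sum_univ_succ]
    rw [hY', Z12x, Z12e, Z22x, Z22e]; ring
  have E00 : (j.symbol * j.coeffs z) 0 0 = 1 := by
    simp [symbol, symbolMatrix, coeffs, Matrix.mul_apply, Fin.sum_univ_succ]
  have E01 : (j.symbol * j.coeffs z) 0 1 = 0 := by
    simp [symbol, symbolMatrix, coeffs, Matrix.mul_apply, Fin.sum_univ_succ]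
  have E02 : (j.symbol * j.coeffs z) 0 2 = 0 := by
    simp [symbol, symbolMatrix, coeffs, Matrix.mul_apply, Fin.sum_univ_succ]
  rw [minorIdeal_eq_of_first_row E00 E01 E02, E11, E12, E21, E22, E31, E32]
  set lam := j.lamx * j.ξ + j.lame * j.η with hlam
  have hlam' : lam * j.L21 = j.Z21x * j.ξ + j.Z21e * j.η := by
    rw [hlam, lamx, lame]
    linear_combination (j.Z21x * j.ξ + j.Z21e * j.η) * hl
  have hA : j.ξ * Y - j.η * X = j.e * j.ξ ^ 2 + j.f * j.ξ * j.ζ + -j.L21 * j.ζ ^ 2 := by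
    rw [hX, hY, e, f, ζ]; ring
  rw [normalIdeal, ← hA]
  -- The constant c = -w02 / L₂₁ records the multiple of A used to eliminate η² from w.
  refine span_minors_eq (μ := (j.fxy ^ 2 - j.fxx * j.fyy) + (j.Z11x * j.ξ + j.Z11e * j.η) -
    lam * j.L11) (lam := lam) (w := j.ξ * (j.w20 * j.ξ + j.w11 * j.η) + j.w02 * j.η ^ 2)
    (c := -(Ring.inverse j.L21 * j.w02)) (b1 := j.b1) (b2 := j.b2) ?_ ?_ hX hl ?_ hb ?_
  · rw [hX', hX]; linear_combination (-j.η) * hlam'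
  · rw [hY', hY, w20, w11, w02, hlam]; ring
  · rw [b1, b2, hX, hY]; linear_combination (-j.w02 * j.η ^ 2) * hl
  · rw [ζ, b]

end JetData

/-! ### Surface germs -/

section Germ

variable {k : Type*} [Field k] {S : Type*} [CommRing S] [Algebra k S]

/-- `S` is a local ring with residue field `k` and evaluation map `ev`, and `x, y` are regular
parameters modulo the ideal `K`. -/
structure IsGerm [IsLocalRing S] (ev : S →ₐ[k] k) (K : Ideal S) (x y : S) : Prop where
  mem_iff : ∀ a, a ∈ IsLocalRing.maximalIdeal S ↔ ev a = 0
  sup_eq : K ⊔ Ideal.span {x} ⊔ Ideal.span {y} = IsLocalRing.maximalIdeal S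
  regx : RegMod K x
  regy : RegMod (K ⊔ Ideal.span {x}) y

/-- The ideal `K + (y², x^s)`. -/
abbrev errIdeal (K : Ideal S) (x y : S) (s : ℕ) : Ideal S :=
  K ⊔ Ideal.span {y ^ 2} ⊔ Ideal.span {x ^ s}

/-- The partial derivatives in `j` agree with those of `y² - x^s` modulo `K + (y², x^s)`. -/
structure HasShape (K : Ideal S) (x y : S) (s : ℕ) (j : JetData S) : Prop where
  ξ : j.ξ - 2 * y ∈ errIdeal K x y s
  η : j.η - s * x ^ (s - 1) ∈ errIdeal K x y s
  fxx : j.fxx + s * (s - 1) * x ^ (s - 2) ∈ errIdeal K x y s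
  fxy : j.fxy ∈ errIdeal K x y s
  fyy : j.fyy - 2 ∈ errIdeal K x y s
  fxxx : j.fxxx + s * (s - 1) * (s - 2) * x ^ (s - 3) ∈ errIdeal K x y s
  fxxy : j.fxxy ∈ errIdeal K x y s
  fxyy : j.fxyy ∈ errIdeal K x y s
  fyyy : j.fyyy ∈ errIdeal K x y s

theorem mem_errIdeal {K : Ideal S} {x y z : S} {s : ℕ} :
    z ∈ errIdeal K x y s ↔ ∃ κ ∈ K, ∃ p q, z = κ + y ^ 2 * p + x ^ s * q := by
  rw [mem_sup_span]
  constructor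
  · rintro ⟨κ, hκ, q, rfl⟩
    obtain ⟨κ', hκ', p, rfl⟩ := mem_sup_span.1 hκ
    exact ⟨κ', hκ', p, q, rfl⟩
  · rintro ⟨κ, hκ, p, q, rfl⟩
    exact ⟨_, mem_sup_span.2 ⟨κ, hκ, p, rfl⟩, q, rfl⟩

theorem mem_sup_span_pair {K : Ideal S} {a b z : S} :
    z ∈ K ⊔ Ideal.span {a} ⊔ Ideal.span {b} ↔ ∃ κ ∈ K, ∃ p q, z = κ + a * p + b * q := by
  rw [mem_sup_span]
  constructor
  · rintro ⟨κ, hκ, q, rfl⟩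
    obtain ⟨κ', hκ', p, rfl⟩ := mem_sup_span.1 hκ
    exact ⟨κ', hκ', p, q, rfl⟩
  · rintro ⟨κ, hκ, p, q, rfl⟩
    exact ⟨_, mem_sup_span.2 ⟨κ, hκ, p, rfl⟩, q, rfl⟩

theorem ev_inverse {ev : S →ₐ[k] k} {a : S} (ha : IsUnit a) :
    ev (Ring.inverse a) = (ev a)⁻¹ := by
  have h1 := congrArg ev (Ring.inverse_mul_cancel a ha)
  rw [map_mul, map_one] at h1
  exact eq_inv_of_mul_eq_one_left h1

theorem self_mem_sup_span (K : Ideal S) (a : S) : a ∈ K ⊔ Ideal.span {a} :=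
  Ideal.mem_sup_right (Ideal.mem_span_singleton_self a)

theorem mul_mem_sup_span (K : Ideal S) (a r : S) : a * r ∈ K ⊔ Ideal.span {a} :=
  Ideal.mul_mem_right _ _ (self_mem_sup_span K a)

/-- The coefficient of `x ^ (s - 2)` in `e`, where `γ` is the constant term of `c20`. -/
def rho (s : ℕ) (γ : k) : k := s * (s - 1) - if s = 4 then 32 / γ ^ 2 else 0

/-- The coefficient of `x ^ (s - 1)` in `ζ` modulo `e`, where `γ` is the constant term of `c20`. -/
def del (s : ℕ) (γ : k) : k := s - if s = 4 then 4 * rho s γ / γ ^ 2 else 0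

variable [IsLocalRing S] {ev : S →ₐ[k] k} {K : Ideal S} {x y : S}

namespace IsGerm

variable (h : IsGerm ev K x y)
include h

theorem ev_of_mem {a : S} (ha : a ∈ K) : ev a = 0 := by
  rw [← h.mem_iff, ← h.sup_eq]
  exact Ideal.mem_sup_left (Ideal.mem_sup_left ha)

theorem ev_x : ev x = 0 := by
  rw [← h.mem_iff, ← h.sup_eq]
  exact Ideal.mem_sup_left (self_mem_sup_span _ _)

theorem ev_y : ev y = 0 := by
  rw [← h.mem_iff, ← h.sup_eq]
  exact self_mem_sup_span _ _

theorem isUnit_iff {a : S} : IsUnit a ↔ ev a ≠ 0 := by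
  rw [Ne, ← h.mem_iff, IsLocalRing.mem_maximalIdeal, mem_nonunits_iff, not_not]

theorem len_maximalIdeal : len k (IsLocalRing.maximalIdeal S) = 1 := by
  have hker : IsLocalRing.maximalIdeal S = RingHom.ker ev := by
    ext a; rw [h.mem_iff, RingHom.mem_ker]
  have hs : Function.Surjective ev := fun c => ⟨algebraMap k S c, by simp⟩
  rw [len, hker, (Ideal.quotientKerAlgEquivOfSurjective hs).toLinearEquiv.length_eq,
    Module.length_eq_finrank, Module.finrank_self]
  rfl

theorem mem_iff_exists {a : S} :
    ev a = 0 ↔ ∃ κ ∈ K, ∃ p q, a = κ + x * p + y * q := by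
  rw [← h.mem_iff, ← h.sup_eq, mem_sup_span_pair]

theorem ev_err {s : ℕ} (hs : 1 ≤ s) {a : S} (ha : a ∈ errIdeal K x y s) : ev a = 0 := by
  obtain ⟨κ, hκ, p, q, rfl⟩ := mem_errIdeal.1 ha
  simp [h.ev_of_mem hκ, h.ev_x, h.ev_y, show s ≠ 0 by omega]

variable {s : ℕ} {j : JetData S} (hj : HasShape K x y s j) (hs : 2 ≤ s)
include hj hs

theorem ev_ξ : ev j.ξ = 0 := by
  have := h.ev_err (by omega) hj.ξ
  simpa [h.ev_y] using this

theorem ev_η : ev j.η = 0 := by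
  have := h.ev_err (by omega) hj.η
  simpa [h.ev_x, show s - 1 ≠ 0 by omega] using this

theorem ev_fxy : ev j.fxy = 0 := h.ev_err (by omega) hj.fxy
theorem ev_fxxy : ev j.fxxy = 0 := h.ev_err (by omega) hj.fxxy
theorem ev_fxyy : ev j.fxyy = 0 := h.ev_err (by omega) hj.fxyy
theorem ev_fyyy : ev j.fyyy = 0 := h.ev_err (by omega) hj.fyyy

theorem ev_fyy : ev j.fyy = 2 := by
  have := h.ev_err (by omega) hj.fyy
  rw [map_sub, map_ofNat] at this
  linear_combination this

/-- The power of 0 is the value of x^(s-2) at the closed point, so only s = 2 contributes. -/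
theorem ev_fxx : ev j.fxx = -(s * (s - 1) * 0 ^ (s - 2)) := by
  have := h.ev_err (by omega) hj.fxx
  simp only [map_add, map_mul, map_sub, map_pow, map_natCast, map_one, h.ev_x] at this
  linear_combination this

/-- Only s = 3 contributes. For s = 2 the truncated exponent makes the power of 0 equal to 1, but
the factor s - 2 vanishes. -/
theorem ev_fxxx : ev j.fxxx = -(s * (s - 1) * (s - 2) * 0 ^ (s - 3)) := by
  have := h.ev_err (by omega) hj.fxxx
  simp only [map_add, map_mul, map_sub, map_pow, map_natCast, map_one, map_ofNat, h.ev_x] at this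
  linear_combination this

theorem ev_L21 : ev j.L21 = 2 := by
  simp [JetData.L21, h.ev_fyy hj hs, h.ev_η hj hs]

theorem isUnit_L21 [CharZero k] : IsUnit j.L21 := by
  rw [h.isUnit_iff, h.ev_L21 hj hs]; exact two_ne_zero

theorem ev_b1 [CharZero k] : ev j.b1 = s * (s - 1) * (s - 2) * 0 ^ (s - 3) +
    s * (s - 1) * 0 ^ (s - 2) * (6 * ev j.c11 - 3 * ev j.a20 -
      3 / 2 * (s * (s - 1) * 0 ^ (s - 2)) * ev j.a02) := by
  have hl := ev_inverse (ev := ev) (h.isUnit_L21 hj hs)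
  rw [h.ev_L21 hj hs] at hl
  simp only [JetData.b1, JetData.w20, JetData.w02, JetData.Z12x, JetData.lamx, JetData.lame,
    JetData.Z21x, JetData.Z21e, JetData.Z22e, JetData.Z11e, JetData.L12, JetData.L22, JetData.L11,
    map_add, map_sub, map_mul, map_neg, map_ofNat, hl, h.ev_ξ hj hs, h.ev_η hj hs,
    h.ev_fxy hj hs, h.ev_fxyy hj hs, h.ev_fyyy hj hs, h.ev_fyy hj hs,
    h.ev_fxx hj hs, h.ev_fxxx hj hs]
  ring

theorem ev_b2 [CharZero k] : ev j.b2 = 6 * ev j.c20 +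
    3 * (s * (s - 1) * 0 ^ (s - 2)) * (ev j.c02 - 2 * ev j.a11) := by
  have hl := ev_inverse (ev := ev) (h.isUnit_L21 hj hs)
  rw [h.ev_L21 hj hs] at hl
  simp only [JetData.b2, JetData.w11, JetData.w02, JetData.Z12e, JetData.lamx, JetData.lame,
    JetData.Z21x, JetData.Z21e, JetData.Z22e, JetData.Z11e, JetData.Z22x, JetData.Z11x,
    JetData.L12, JetData.L22, JetData.L11,
    map_add, map_sub, map_mul, map_neg, map_ofNat, hl, h.ev_ξ hj hs, h.ev_η hj hs,
    h.ev_fxy hj hs, h.ev_fxxy hj hs, h.ev_fxyy hj hs, h.ev_fyyy hj hs, h.ev_fyy hj hs,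
    h.ev_fxx hj hs]
  ring

theorem ev_e [CharZero k] : ev j.e = s * (s - 1) * 0 ^ (s - 2) - 2 * ev j.b ^ 2 := by
  simp only [JetData.e, JetData.L12, JetData.L22, JetData.L11,
    map_add, map_sub, map_mul, map_neg, map_pow, map_ofNat, h.ev_L21 hj hs, h.ev_ξ hj hs,
    h.ev_η hj hs, h.ev_fxy hj hs, h.ev_fxx hj hs]
  ring

/-- Modulo K, the elements ξ and η are 2 y and s x^(s-1) up to m · (y, x^(s-1)), so Nakayama
identifies the ideals; adding a multiple of ξ to η changes nothing. -/
theorem sup_span_ξ_eq [IsNoetherianRing S] [CharZero k] (b : S) :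
    K ⊔ Ideal.span {j.ξ} ⊔ Ideal.span {j.η + b * j.ξ} =
      K ⊔ Ideal.span {y} ⊔ Ideal.span {x ^ (s - 1)} := by
  obtain ⟨κ1, hκ1, p1, q1, e1⟩ := mem_errIdeal.1 hj.ξ
  obtain ⟨κ2, hκ2, p2, q2, e2⟩ := mem_errIdeal.1 hj.η
  have hxs : x ^ s = x * x ^ (s - 1) := by rw [← pow_succ']; congr 1; omega
  rw [hxs] at e1 e2
  set X := x ^ (s - 1) with hX
  set N := K ⊔ Ideal.span {y} ⊔ Ideal.span {X} with hN
  set M := K ⊔ Ideal.span {j.ξ} ⊔ Ideal.span {j.η + b * j.ξ} with hM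
  have hKN : K ≤ N := le_sup_left.trans le_sup_left
  have hKM : K ≤ M := le_sup_left.trans le_sup_left
  have hyN : y ∈ N := Ideal.mem_sup_left (self_mem_sup_span _ _)
  have hXN : X ∈ N := self_mem_sup_span _ _
  have hξM : j.ξ ∈ M := Ideal.mem_sup_left (self_mem_sup_span _ _)
  have hζM : j.η + b * j.ξ ∈ M := self_mem_sup_span _ _
  have hMN : M ≤ N := by
    have h1 : j.ξ ∈ N := by
      rw [show j.ξ = κ1 + (2 + y * p1) * y + (x * q1) * X by linear_combination e1]
      exact add_mem (add_mem (hKN hκ1) (Ideal.mul_mem_left _ _ hyN)) (Ideal.mul_mem_left _ _ hXN)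
    have h2 : j.η ∈ N := by
      rw [show j.η = κ2 + (y * p2) * y + (s + x * q2) * X by linear_combination e2]
      exact add_mem (add_mem (hKN hκ2) (Ideal.mul_mem_left _ _ hyN)) (Ideal.mul_mem_left _ _ hXN)
    refine sup_le (sup_le hKN ?_) ?_ <;> rw [Ideal.span_singleton_le_iff_mem]
    · exact h1
    · exact add_mem h2 (Ideal.mul_mem_left _ _ h1)
  have hxm : x ∈ IsLocalRing.maximalIdeal S := (h.mem_iff _).2 h.ev_x
  have hym : y ∈ IsLocalRing.maximalIdeal S := (h.mem_iff _).2 h.ev_y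
  have hNM : N ≤ M ⊔ IsLocalRing.maximalIdeal S • N := by
    have key : ∀ c : k, c ≠ 0 → ∀ z : S, algebraMap k S c * z ∈ M ⊔ IsLocalRing.maximalIdeal S • N →
        z ∈ M ⊔ IsLocalRing.maximalIdeal S • N := by
      intro c hc z hz
      have := Ideal.mul_mem_left _ (algebraMap k S c⁻¹) hz
      rwa [← mul_assoc, ← map_mul, inv_mul_cancel₀ hc, map_one, one_mul] at this
    have hsm : ∀ a ∈ IsLocalRing.maximalIdeal S, ∀ n ∈ N, ∀ r,
        a * n * r ∈ M ⊔ IsLocalRing.maximalIdeal S • N := fun a ha n hn r =>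
      Ideal.mul_mem_right _ _ (Ideal.mem_sup_right (Submodule.smul_mem_smul ha hn))
    refine sup_le (sup_le (hKM.trans le_sup_left) ?_) ?_ <;> rw [Ideal.span_singleton_le_iff_mem]
    · refine key 2 two_ne_zero y ?_
      rw [map_ofNat, show 2 * y = j.ξ - κ1 - y * y * p1 - x * X * q1 by linear_combination -e1]
      exact sub_mem (sub_mem (Ideal.mem_sup_left (sub_mem hξM (hKM hκ1))) (hsm _ hym _ hyN _))
        (hsm _ hxm _ hXN _)
    · refine key s (Nat.cast_ne_zero.2 (by omega)) X ?_
      rw [map_natCast, show s * X = (j.η + b * j.ξ) - b * j.ξ - κ2 - y * y * p2 - x * X * q2 by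
        linear_combination -e2]
      exact sub_mem (sub_mem (Ideal.mem_sup_left (sub_mem (sub_mem hζM
        (Ideal.mul_mem_left _ _ hξM)) (hKM hκ2))) (hsm _ hym _ hyN _)) (hsm _ hxm _ hXN _)
  exact le_antisymm hMN (Submodule.le_of_le_smul_of_le_jacobson_bot
    (IsNoetherian.noetherian N) (IsLocalRing.maximalIdeal_le_jacobson _) hNM)

/-- `ξ` and `η + b ξ` form a regular sequence modulo `K`, in either order. -/
theorem regMod_ξ [IsNoetherianRing S] [CharZero k] (b : S) :
    (RegMod K j.ξ ∧ RegMod (K ⊔ Ideal.span {j.ξ}) (j.η + b * j.ξ)) ∧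
      (RegMod K (j.η + b * j.ξ) ∧ RegMod (K ⊔ Ideal.span {j.η + b * j.ξ}) j.ξ) := by
  have hxm : x ∈ IsLocalRing.maximalIdeal S := (h.mem_iff _).2 h.ev_x
  have hξm : j.ξ ∈ IsLocalRing.maximalIdeal S := (h.mem_iff _).2 (h.ev_ξ hj hs)
  obtain ⟨κ1, hκ1, p1, q1, e1⟩ := mem_errIdeal.1 hj.ξ
  have hu : IsUnit (2 + y * p1) := by
    rw [h.isUnit_iff, map_add, map_mul, map_ofNat, h.ev_y]; simp
  obtain ⟨v, hv⟩ := hu.exists_left_inv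
  -- Modulo K + (x), ξ is a unit multiple of y.
  have h1 : RegMod (K ⊔ Ideal.span {x}) j.ξ := by
    refine h.regy.exchange (N := 1) ?_
    have hxs : x ^ s = x * x ^ (s - 1) := by rw [← pow_succ']; congr 1; omega
    rw [mem_sup_span_pair]
    refine ⟨-(v * κ1), neg_mem (Ideal.mul_mem_left _ _ hκ1), -(v * x ^ (s - 1) * q1), v, ?_⟩
    rw [hxs] at e1
    linear_combination (-v) * e1 - y * hv
  obtain ⟨h2, h3⟩ := h.regx.swap h1 hxm
  have h4 : RegMod (K ⊔ Ideal.span {j.ξ}) (j.η + b * j.ξ) := by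
    refine h3.exchange (N := s - 1) ?_
    rw [h.sup_span_ξ_eq hj hs b]
    exact self_mem_sup_span _ _
  exact ⟨⟨h2, h4⟩, h2.swap h4 hξm⟩

theorem len_ξ [IsNoetherianRing S] [CharZero k] (b : S) :
    len k (K ⊔ Ideal.span {j.η + b * j.ξ} ⊔ Ideal.span {j.ξ}) = (s - 1 : ℕ) := by
  have hxm : x ∈ IsLocalRing.maximalIdeal S := (h.mem_iff _).2 h.ev_x
  rw [sup_right_comm, h.sup_span_ξ_eq hj hs b, (h.regx.swap h.regy hxm).2.len_pow k,
    sup_right_comm, h.sup_eq, h.len_maximalIdeal, mul_one]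

theorem len_normalIdeal [IsNoetherianRing S] [CharZero k]
    (he : RegMod (K ⊔ Ideal.span {j.ζ}) j.e) :
    len k (K ⊔ j.normalIdeal) = 5 * (s - 1 : ℕ) + len k (K ⊔ Ideal.span {j.ζ} ⊔ Ideal.span {j.e}) := by
  have h1 := h.regMod_ξ hj hs j.b
  have h2 : len k (K ⊔ Ideal.span {j.ζ} ⊔ Ideal.span {j.ξ}) = (s - 1 : ℕ) := h.len_ξ hj hs j.b
  rw [JetData.normalIdeal, len_normalForm (ζ := j.ζ) k (h.isUnit_L21 hj hs).neg h1.2.1 h1.2.2 he,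
    h2]

theorem len_normalIdeal_of_isUnit [IsNoetherianRing S] [CharZero k] (he : IsUnit j.e) :
    len k (K ⊔ j.normalIdeal) = 5 * (s - 1 : ℕ) := by
  have h0 : K ⊔ Ideal.span {j.ζ} ⊔ Ideal.span {j.e} = ⊤ := by
    rw [Ideal.span_singleton_eq_top.2 he, sup_top_eq]
  rw [h.len_normalIdeal hj hs (RegMod.of_isUnit _ he), h0, len_top, add_zero]

/-- The first-order behaviour of `b` along `y = 0`. -/
theorem b_sub_mem [CharZero k] (hs4 : 4 ≤ s) (hγ : ev j.c20 ≠ 0) :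
    j.b - algebraMap k S (s * (s - 1) * (s - 2) / (6 * ev j.c20)) * x ^ (s - 3) ∈
      K ⊔ Ideal.span {x ^ (s - 2)} ⊔ Ideal.span {y} := by
  set Q := K ⊔ Ideal.span {x ^ (s - 2)} ⊔ Ideal.span {y} with hQ
  have hKQ : K ≤ Q := le_sup_left.trans le_sup_left
  have hyQ : y ∈ Q := self_mem_sup_span _ _
  have hxQ : x ^ (s - 2) ∈ Q := Ideal.mem_sup_left (self_mem_sup_span _ _)
  have hT : errIdeal K x y s ≤ Q := by
    refine sup_le (sup_le hKQ ?_) ?_ <;> rw [Ideal.span_singleton_le_iff_mem]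
    · exact Ideal.pow_mem_of_mem _ hyQ 2 (by omega)
    · exact Ideal.mem_of_dvd _ (pow_dvd_pow x (by omega)) hxQ
  have h0 : (0 : k) ^ (s - 2) = 0 := zero_pow (by omega)
  have hb2 : ev j.b2 = 6 * ev j.c20 := by rw [h.ev_b2 hj hs, h0]; ring
  have hb2' : ev j.b2 ≠ 0 := by rw [hb2]; exact mul_ne_zero (by norm_num) hγ
  have hinv := ev_inverse (ev := ev) (h.isUnit_iff.2 hb2')
  have hξ : j.ξ ∈ Q := by
    rw [show j.ξ = (j.ξ - 2 * y) + 2 * y by ring]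
    exact add_mem (hT hj.ξ) (Ideal.mul_mem_left _ _ hyQ)
  have hη : j.η ∈ Q := by
    rw [show j.η = (j.η - s * x ^ (s - 1)) + s * x ^ (s - 1) by ring]
    exact add_mem (hT hj.η) (Ideal.mul_mem_left _ _
      (Ideal.mem_of_dvd _ (pow_dvd_pow x (by omega)) hxQ))
  have hfxx : j.fxx ∈ Q := by
    rw [show j.fxx = (j.fxx + s * (s - 1) * x ^ (s - 2)) - s * (s - 1) * x ^ (s - 2) by ring]
    exact sub_mem (hT hj.fxx) (Ideal.mul_mem_left _ _ hxQ)
  have hfxy := hT hj.fxy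
  have hL12 : j.L12 ∈ Q := add_mem (add_mem (neg_mem hfxx) (Ideal.mul_mem_left _ _ hξ))
    (Ideal.mul_mem_left _ _ hη)
  have hlamx : j.lamx ∈ Q := Ideal.mul_mem_left _ _
    (sub_mem (Ideal.mul_mem_left _ _ hfxy) (Ideal.mul_mem_left _ _ hfxx))
  have hb1 : j.b1 - s * (s - 1) * (s - 2) * x ^ (s - 3) ∈ Q := by
    rw [show j.b1 - s * (s - 1) * (s - 2) * x ^ (s - 3) =
      -(j.fxxx + s * (s - 1) * (s - 2) * x ^ (s - 3)) + 3 * j.c20 * j.fxy - 3 * j.c11 * j.fxx +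
        j.c30 * j.ξ - j.L12 * j.lamx + Ring.inverse j.L21 * j.w02 * j.L12 by
      rw [JetData.b1, JetData.w20, JetData.Z12x]; ring]
    exact add_mem (sub_mem (add_mem (sub_mem (add_mem (neg_mem (hT hj.fxxx))
      (Ideal.mul_mem_left _ _ hfxy)) (Ideal.mul_mem_left _ _ hfxx)) (Ideal.mul_mem_left _ _ hξ))
      (Ideal.mul_mem_left _ _ hlamx)) (Ideal.mul_mem_left _ _ hL12)
  set c := algebraMap k S (6 * ev j.c20)⁻¹ with hc
  -- Replacing 1 / b2 by its value at the closed point costs an element of the maximal ideal; its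
  -- x-part raises x^(s-3) to x^(s-2) and is absorbed by Q.
  obtain ⟨κ, hκ, p, q, hpq⟩ := h.mem_iff_exists.1
    (show ev (Ring.inverse j.b2 - c) = 0 by rw [map_sub, hinv, hb2, hc]; simp)
  have hxx : x ^ (s - 2) = x * x ^ (s - 3) := by rw [← pow_succ']; congr 1; omega
  have e0 : algebraMap k S (s * (s - 1) * (s - 2) / (6 * ev j.c20)) = s * (s - 1) * (s - 2) * c := by
    rw [div_eq_mul_inv, map_mul, map_mul, map_mul, map_sub, map_sub, map_natCast, map_one,
      map_ofNat]
  rw [e0, show j.b - s * (s - 1) * (s - 2) * c * x ^ (s - 3) =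
      Ring.inverse j.b2 * (j.b1 - s * (s - 1) * (s - 2) * x ^ (s - 3)) +
      (s * (s - 1) * (s - 2) * x ^ (s - 3)) * κ + s * (s - 1) * (s - 2) * p * x ^ (s - 2) +
      (s * (s - 1) * (s - 2) * x ^ (s - 3)) * q * y by
    rw [JetData.b, hxx]
    linear_combination (s * (s - 1) * (s - 2) * x ^ (s - 3)) * hpq]
  exact add_mem (add_mem (add_mem (Ideal.mul_mem_left _ _ hb1) (Ideal.mul_mem_left _ _ (hKQ hκ)))
    (Ideal.mul_mem_left _ _ hxQ)) (Ideal.mul_mem_left _ _ hyQ)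

/-- The first-order behaviour of `e`. -/
theorem e_eq [IsNoetherianRing S] [CharZero k] (hs4 : 4 ≤ s) (hγ : ev j.c20 ≠ 0) :
    ∃ κ ∈ K, ∃ p ν, ev ν = 0 ∧ j.e = algebraMap k S (2 * ev j.c20) * y +
      algebraMap k S (rho s (ev j.c20)) * x ^ (s - 2) + κ + x ^ (s - 1) * p + ν * y := by
  -- The error ideal Q = K + (x^(s-1)) + m y contains all terms that do not affect the leading part
  -- of e.
  set X := x ^ (s - 1) with hX
  set Q : Ideal S := K ⊔ Ideal.span {X} ⊔ IsLocalRing.maximalIdeal S * Ideal.span {y} with hQ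
  suffices hsuff : j.e - (algebraMap k S (2 * ev j.c20) * y +
      algebraMap k S (rho s (ev j.c20)) * x ^ (s - 2)) ∈ Q by
    obtain ⟨a, ha, c, hc, hac⟩ := Submodule.mem_sup.1 hsuff
    obtain ⟨κ, hκ, p, rfl⟩ := mem_sup_span.1 ha
    obtain ⟨ν, hν, rfl⟩ := Ideal.mem_mul_span_singleton.1 hc
    exact ⟨κ, hκ, p, ν, (h.mem_iff _).1 hν, by linear_combination -hac⟩
  have hKQ : K ≤ Q := le_sup_left.trans le_sup_left
  have hXQ : X ∈ Q := Ideal.mem_sup_left (self_mem_sup_span _ _)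
  have hyQ : ∀ ν, ev ν = 0 → ν * y ∈ Q := fun ν hν => Ideal.mem_sup_right
    (Ideal.mul_mem_mul ((h.mem_iff _).2 hν) (Ideal.mem_span_singleton_self y))
  have hT : errIdeal K x y s ≤ Q := by
    refine sup_le (sup_le hKQ ?_) ?_ <;> rw [Ideal.span_singleton_le_iff_mem]
    · rw [pow_two]; exact hyQ _ h.ev_y
    · exact Ideal.mem_of_dvd _ (pow_dvd_pow x (by omega)) hXQ
  set N : Ideal S := K ⊔ Ideal.span {y} ⊔ Ideal.span {X} with hN
  have hNQ : ∀ a, ev a = 0 → ∀ n ∈ N, a * n ∈ Q := by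
    intro a ha n hn
    obtain ⟨κ, hκ, p, q, rfl⟩ := mem_sup_span_pair.1 hn
    rw [show a * (κ + y * p + X * q) = a * κ + (a * p) * y + (a * q) * X by ring]
    exact add_mem (add_mem (Ideal.mul_mem_left _ _ (hKQ hκ)) (hyQ _ (by rw [map_mul, ha, zero_mul])))
      (Ideal.mul_mem_left _ _ hXQ)
  have hξN : j.ξ ∈ N := by
    rw [hN, hX, ← h.sup_span_ξ_eq hj hs 0]; exact Ideal.mem_sup_left (self_mem_sup_span _ _)
  have hηN : j.η ∈ N := by
    have : j.η + 0 * j.ξ ∈ N := by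
      rw [hN, hX, ← h.sup_span_ξ_eq hj hs 0]; exact self_mem_sup_span _ _
    simpa using this
  have hTN : errIdeal K x y s ≤ N := by
    refine sup_le (sup_le (le_sup_left.trans le_sup_left) ?_) ?_ <;>
      rw [Ideal.span_singleton_le_iff_mem]
    · exact Ideal.pow_mem_of_mem _ (Ideal.mem_sup_left (self_mem_sup_span _ _)) 2 (by omega)
    · exact Ideal.mem_of_dvd _ (pow_dvd_pow x (by omega)) (self_mem_sup_span _ X)
  have hLN : j.L22 - j.L11 ∈ N := by
    rw [show j.L22 - j.L11 = (-2) * j.fxy + (j.c02 - 2 * j.a11) * j.η - j.a20 * j.ξ by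
      rw [JetData.L22, JetData.L11]; ring]
    exact sub_mem (add_mem (Ideal.mul_mem_left _ _ (hTN hj.fxy)) (Ideal.mul_mem_left _ _ hηN))
      (Ideal.mul_mem_left _ _ hξN)
  have hL21 : j.L21 - 2 ∈ N := by
    rw [show j.L21 - 2 = (j.fyy - 2) + j.a02 * j.η by rw [JetData.L21]; ring]
    exact add_mem (hTN hj.fyy) (Ideal.mul_mem_left _ _ hηN)
  set κ₀ := (s * (s - 1) * (s - 2) / (6 * ev j.c20) : k) with hκ₀
  obtain ⟨κ, hκ, p, q, hb⟩ := mem_sup_span_pair.1 (h.b_sub_mem hj hs hs4 hγ)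
  have hevb : ev j.b = 0 := by
    have := congrArg ev hb
    simp only [map_sub, map_add, map_mul, map_pow, h.ev_x, h.ev_y, h.ev_of_mem hκ,
      zero_pow (show s - 3 ≠ 0 by omega), zero_pow (show s - 2 ≠ 0 by omega)] at this
    linear_combination this
  have hxx : x ^ (s - 2) * x = X := by rw [← pow_succ, hX]; congr 1; omega
  have hb2 : j.b ^ 2 - (algebraMap k S κ₀ * x ^ (s - 3)) ^ 2 ∈ Q := by
    set B := j.b + algebraMap k S κ₀ * x ^ (s - 3) with hB
    have hevB : ev B = 0 := by
      rw [hB, map_add, hevb, map_mul, map_pow, h.ev_x, zero_pow (by omega)]; simp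
    obtain ⟨κ', hκ', p', q', hB'⟩ := h.mem_iff_exists.1 hevB
    rw [show j.b ^ 2 - (algebraMap k S κ₀ * x ^ (s - 3)) ^ 2 = B * κ + (q * B) * y +
        (p * x ^ (s - 2)) * κ' + (p * p') * X + (x ^ (s - 2) * p * q') * y by
      rw [← hxx]; linear_combination B * hb + (x ^ (s - 2) * p) * hB']
    refine add_mem (add_mem (add_mem (add_mem (Ideal.mul_mem_left _ _ (hKQ hκ)) (hyQ _ ?_))
      (Ideal.mul_mem_left _ _ (hKQ hκ'))) (Ideal.mul_mem_left _ _ hXQ)) (hyQ _ ?_)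
    · rw [map_mul, hevB, mul_zero]
    · rw [map_mul, map_mul, map_pow, h.ev_x, zero_pow (by omega)]; simp
  -- The term -b² L₂₁ of e contributes -2 κ₀² x^(2s-6). The exponent 2s - 6 equals s - 2 for s = 4,
  -- where κ₀ = 4/γ and 2 κ₀² = 32/γ²; for s ≥ 5 it is at least s - 1 and the term is negligible.
  have hκx : (algebraMap k S κ₀ * x ^ (s - 3)) ^ 2 * 2 -
      algebraMap k S (if s = 4 then 32 / ev j.c20 ^ 2 else 0) * x ^ (s - 2) ∈ Q := by
    by_cases h4 : s = 4
    · subst h4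
      have : κ₀ = 4 / ev j.c20 := by
        rw [hκ₀]; field_simp; norm_num
      rw [this, if_pos rfl, show (32 : k) / ev j.c20 ^ 2 = (4 / ev j.c20) ^ 2 * 2 by
        field_simp; norm_num, map_mul, map_pow, map_ofNat]
      norm_num
      ring_nf
      exact zero_mem _
    · rw [if_neg h4, map_zero, zero_mul, sub_zero, mul_pow, ← pow_mul]
      exact Ideal.mul_mem_right _ _ (Ideal.mul_mem_left _ _
        (Ideal.mem_of_dvd _ (pow_dvd_pow x (by omega)) hXQ))
  have hc20 : ev (j.c20 - algebraMap k S (ev j.c20)) = 0 := by simp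
  have hL12 : j.L12 - (algebraMap k S (2 * ev j.c20) * y + s * (s - 1) * x ^ (s - 2)) ∈ Q := by
    rw [show j.L12 - (algebraMap k S (2 * ev j.c20) * y + s * (s - 1) * x ^ (s - 2)) =
      -(j.fxx + s * (s - 1) * x ^ (s - 2)) + j.c20 * (j.ξ - 2 * y) +
        (2 * (j.c20 - algebraMap k S (ev j.c20))) * y + 2 * j.c11 * (j.η - s * X) +
        (2 * j.c11 * s) * X by
      rw [JetData.L12, map_mul, map_ofNat]; ring]
    exact add_mem (add_mem (add_mem (add_mem (neg_mem (hT hj.fxx)) (Ideal.mul_mem_left _ _ (hT hj.ξ)))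
      (hyQ _ (by rw [map_mul, hc20, mul_zero]))) (Ideal.mul_mem_left _ _ (hT hj.η)))
      (Ideal.mul_mem_left _ _ hXQ)
  rw [show j.e - (algebraMap k S (2 * ev j.c20) * y +
      algebraMap k S (rho s (ev j.c20)) * x ^ (s - 2)) =
      (j.L12 - (algebraMap k S (2 * ev j.c20) * y + s * (s - 1) * x ^ (s - 2))) -
      j.b * (j.L22 - j.L11) - j.b ^ 2 * (j.L21 - 2) -
      2 * (j.b ^ 2 - (algebraMap k S κ₀ * x ^ (s - 3)) ^ 2) -
      ((algebraMap k S κ₀ * x ^ (s - 3)) ^ 2 * 2 -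
      algebraMap k S (if s = 4 then 32 / ev j.c20 ^ 2 else 0) * x ^ (s - 2)) by
    have h1 : algebraMap k S (s * (s - 1)) = s * (s - 1) := by simp
    rw [JetData.e, rho, map_sub (algebraMap k S) (_ * _), h1]; ring]
  exact sub_mem (sub_mem (sub_mem (sub_mem hL12 (hNQ _ hevb _ hLN))
    (hNQ _ (by rw [map_pow, hevb, zero_pow two_ne_zero]) _ hL21)) (Ideal.mul_mem_left _ _ hb2)) hκx

end IsGerm

end Germ

/-! ### The case s ≥ 4: the ideal (e, ζ) -/

section Germ

variable {k : Type*} [Field k] {S : Type*} [CommRing S] [Algebra k S]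
variable [IsLocalRing S] {ev : S →ₐ[k] k} {K : Ideal S} {x y : S}

namespace IsGerm

variable (h : IsGerm ev K x y) {s : ℕ} {j : JetData S} (hj : HasShape K x y s j) (hs : 4 ≤ s)
include h hj hs

/-- The coefficient of y in e is a unit, so the equation e = 0 can be solved for y: the curve e = 0
is smooth with coordinate x, and on it y has leading term -(ρ / 2γ) x^(s-2). -/
theorem y_eq [IsNoetherianRing S] [CharZero k] (hγ : ev j.c20 ≠ 0) :
    ∃ κ ∈ K, ∃ r p, ev p = -(rho s (ev j.c20) / (2 * ev j.c20)) ∧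
      y = κ + j.e * r + x ^ (s - 2) * p := by
  obtain ⟨κ, hκ, p, ν, hν, he⟩ := h.e_eq hj (by omega) hs hγ
  have hu : IsUnit (algebraMap k S (2 * ev j.c20) + ν) := by
    rw [h.isUnit_iff, map_add, hν, add_zero]
    simpa using hγ
  have hv := Ring.inverse_mul_cancel _ hu
  have hev := ev_inverse (ev := ev) hu
  set v := Ring.inverse (algebraMap k S (2 * ev j.c20) + ν)
  rw [map_add, hν, add_zero, AlgHom.commutes, Algebra.algebraMap_self, RingHom.id_apply] at hev
  have hxx : x ^ (s - 1) = x * x ^ (s - 2) := by rw [← pow_succ']; congr 1; omega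
  refine ⟨-v * κ, Ideal.mul_mem_left _ _ hκ, v,
    -v * (algebraMap k S (rho s (ev j.c20)) + x * p), ?_, ?_⟩
  · rw [map_mul, map_neg, hev, map_add, map_mul, h.ev_x, zero_mul, add_zero, AlgHom.commutes,
      Algebra.algebraMap_self, RingHom.id_apply]
    ring
  · rw [hxx] at he
    linear_combination (-v) * he - y * hv

/-- Along e = 0, η has leading term s x^(s-1), while b ξ behaves like κ₀ x^(s-3) · 2y = -(κ₀ ρ / γ)
x^(2s-5). The exponents agree exactly for s = 4, which explains the correction in `del`. -/
theorem ζ_eq [IsNoetherianRing S] [CharZero k] (hγ : ev j.c20 ≠ 0) :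
    ∃ p, ev p = del s (ev j.c20) ∧ j.ζ - x ^ (s - 1) * p ∈ K ⊔ Ideal.span {j.e} := by
  obtain ⟨κ0, hκ0, r, p, hp, hy⟩ := h.y_eq hj hs hγ
  obtain ⟨κ1, hκ1, p1, q1, e1⟩ := mem_errIdeal.1 hj.ξ
  obtain ⟨κ2, hκ2, p2, q2, e2⟩ := mem_errIdeal.1 hj.η
  obtain ⟨κ3, hκ3, p3, q3, e3⟩ := mem_sup_span_pair.1 (h.b_sub_mem hj (by omega) hs hγ)
  set Q := K ⊔ Ideal.span {j.e}
  have hKQ : ∀ κ ∈ K, Ideal.Quotient.mk Q κ = 0 := fun κ hκ =>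
    Ideal.Quotient.eq_zero_iff_mem.2 (Ideal.mem_sup_left hκ)
  have heQ : Ideal.Quotient.mk Q j.e = 0 := Ideal.Quotient.eq_zero_iff_mem.2 (self_mem_sup_span _ _)
  obtain ⟨n, rfl⟩ : ∃ n, s = n + 4 := ⟨s - 4, by omega⟩
  rw [show n + 4 - 2 = n + 2 by omega] at hy e3
  rw [show n + 4 - 3 = n + 1 by omega] at e3
  rw [show n + 4 - 1 = n + 3 by omega] at e2 ⊢
  set κ₀ := ((n + 4 : ℕ) * ((n + 4 : ℕ) - 1) * ((n + 4 : ℕ) - 2) / (6 * ev j.c20) : k) with hκ₀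
  set ρ := rho (n + 4) (ev j.c20) with hρ
  -- The quotient of ζ by x^(n+3) after y is eliminated: b has order at least n + 1 and ξ order at
  -- least n + 2 in x, so b ξ keeps a factor x^n.
  refine ⟨(n + 4 : ℕ) + x * (x ^ n * p ^ 2 * p2 + q2) +
    x ^ n * ((algebraMap k S κ₀ + x * (p3 + p * q3)) * (2 * p + x * (x ^ (n + 1) * p ^ 2 * p1 +
      x * q1))), ?_, ?_⟩
  · simp only [map_add, map_mul, map_natCast, map_pow, map_ofNat, h.ev_x, zero_mul, add_zero,
      AlgHom.commutes, Algebra.algebraMap_self, RingHom.id_apply, hp, del, ← hρ]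
    rcases Nat.eq_zero_or_pos n with rfl | hn
    · rw [if_pos rfl, hκ₀]
      field_simp
      norm_num
      ring
    · rw [zero_pow (by omega), if_neg (by omega)]
      ring
  · rw [← Ideal.Quotient.eq]
    have e0 := congrArg (Ideal.Quotient.mk Q) hy
    have e1 := congrArg (Ideal.Quotient.mk Q) e1
    have e2 := congrArg (Ideal.Quotient.mk Q) e2
    have e3 := congrArg (Ideal.Quotient.mk Q) e3
    simp only [JetData.ζ, map_add, map_sub, map_mul, map_pow, map_natCast, map_ofNat, hKQ _ hκ0,
      hKQ _ hκ1, hKQ _ hκ2, hKQ _ hκ3, heQ, zero_mul, zero_add] at e0 e1 e2 e3 ⊢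
    rw [e0] at e1 e2 e3
    rw [sub_eq_iff_eq_add] at e1 e2 e3
    rw [e1, e2, e3]
    ring

theorem sup_span_e_ζ [IsNoetherianRing S] [CharZero k] (hγ : ev j.c20 ≠ 0)
    (hδ : del s (ev j.c20) ≠ 0) :
    K ⊔ Ideal.span {j.e} ⊔ Ideal.span {j.ζ} = K ⊔ Ideal.span {j.e} ⊔ Ideal.span {x ^ (s - 1)} := by
  obtain ⟨p, hp, hζ⟩ := h.ζ_eq hj hs hγ
  have hu : IsUnit p := by rw [h.isUnit_iff, hp]; exact hδ
  obtain ⟨v, hv⟩ := hu.exists_right_inv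
  apply le_antisymm <;> refine sup_le le_sup_left ?_ <;> rw [Ideal.span_singleton_le_iff_mem]
  · rw [show j.ζ = (j.ζ - x ^ (s - 1) * p) + x ^ (s - 1) * p by ring]
    exact add_mem (Ideal.mem_sup_left hζ) (mul_mem_sup_span _ _ _)
  · rw [show x ^ (s - 1) = j.ζ * v + (-v) * (j.ζ - x ^ (s - 1) * p) by
      linear_combination (-x ^ (s - 1)) * hv]
    exact add_mem (mul_mem_sup_span _ _ _) (Ideal.mul_mem_left _ _ (Ideal.mem_sup_left hζ))

theorem ev_e_eq_zero [IsNoetherianRing S] [CharZero k] (hγ : ev j.c20 ≠ 0) : ev j.e = 0 := by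
  obtain ⟨κ, hκ, p, ν, hν, he⟩ := h.e_eq hj (by omega) hs hγ
  rw [he]
  simp [h.ev_x, h.ev_y, h.ev_of_mem hκ, show s - 2 ≠ 0 by omega, show s - 1 ≠ 0 by omega]

/-- Since y lies in K + (x, e), the pair x, e replaces x, y as parameters. Modulo e the element ζ
generates the same ideal as x^(s-1), which gives regularity and length s - 1. -/
theorem regMod_e [IsNoetherianRing S] [CharZero k] (hγ : ev j.c20 ≠ 0)
    (hδ : del s (ev j.c20) ≠ 0) :
    (RegMod K j.e ∧ RegMod (K ⊔ Ideal.span {j.e}) j.ζ) ∧ RegMod (K ⊔ Ideal.span {j.ζ}) j.e ∧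
      len k (K ⊔ Ideal.span {j.ζ} ⊔ Ideal.span {j.e}) = (s - 1 : ℕ) := by
  have hxm : x ∈ IsLocalRing.maximalIdeal S := (h.mem_iff _).2 h.ev_x
  have hem : j.e ∈ IsLocalRing.maximalIdeal S := (h.mem_iff _).2 (h.ev_e_eq_zero hj hs hγ)
  obtain ⟨κ0, hκ0, r, p, -, hy⟩ := h.y_eq hj hs hγ
  have hxx : x ^ (s - 2) = x * x ^ (s - 3) := by rw [← pow_succ']; congr 1; omega
  have hy' : y ∈ K ⊔ Ideal.span {x} ⊔ Ideal.span {j.e} := by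
    rw [mem_sup_span_pair]
    exact ⟨κ0, hκ0, x ^ (s - 3) * p, r, by rw [hxx] at hy; linear_combination hy⟩
  have h1 : RegMod (K ⊔ Ideal.span {x}) j.e := h.regy.exchange (N := 1) (by rwa [pow_one])
  obtain ⟨h2, h3⟩ := h.regx.swap h1 hxm
  have h4 : RegMod (K ⊔ Ideal.span {j.e}) j.ζ := by
    refine h3.exchange (N := s - 1) ?_
    rw [h.sup_span_e_ζ hj hs hγ hδ]
    exact self_mem_sup_span _ _
  refine ⟨⟨h2, h4⟩, (h2.swap h4 hem).2, ?_⟩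
  have hmax : K ⊔ Ideal.span {j.e} ⊔ Ideal.span {x} = IsLocalRing.maximalIdeal S := by
    rw [sup_right_comm]
    apply le_antisymm
    · rw [← h.sup_eq]
      refine sup_le le_sup_left ?_
      rwa [h.sup_eq, Ideal.span_singleton_le_iff_mem]
    · rw [← h.sup_eq]
      refine sup_le le_sup_left ?_
      rwa [Ideal.span_singleton_le_iff_mem]
  rw [sup_right_comm, h.sup_span_e_ζ hj hs hγ hδ, h3.len_pow k, hmax, h.len_maximalIdeal, mul_one]

/-- The ideal `(ξ, ζ, e)` contains `x ^ (s - 2)` modulo `K`. -/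
theorem pow_mem_sup [IsNoetherianRing S] [CharZero k] (hγ : ev j.c20 ≠ 0)
    (hρ : rho s (ev j.c20) ≠ 0) :
    x ^ (s - 2) ∈ K ⊔ Ideal.span {j.ξ} ⊔ Ideal.span {j.ζ} ⊔ Ideal.span {j.e} := by
  obtain ⟨κ, hκ, p, ν, hν, he⟩ := h.e_eq hj (by omega) hs hγ
  have h1 : K ⊔ Ideal.span {j.ξ} ⊔ Ideal.span {j.ζ} = K ⊔ Ideal.span {y} ⊔ Ideal.span {x ^ (s - 1)} :=
    h.sup_span_ξ_eq hj (by omega) j.b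
  rw [h1]
  set Q := K ⊔ Ideal.span {y} ⊔ Ideal.span {x ^ (s - 1)} ⊔ Ideal.span {j.e}
  have hQ : K ⊔ Ideal.span {y} ⊔ Ideal.span {x ^ (s - 1)} ≤ Q := le_sup_left
  have e1 : x ^ (s - 2) = algebraMap k S (rho s (ev j.c20))⁻¹ *
      (algebraMap k S (rho s (ev j.c20)) * x ^ (s - 2)) := by
    rw [← mul_assoc, ← map_mul, inv_mul_cancel₀ hρ, map_one, one_mul]
  rw [e1]
  refine Ideal.mul_mem_left _ _ ?_
  rw [show algebraMap k S (rho s (ev j.c20)) * x ^ (s - 2) =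
    j.e - (κ + y * (algebraMap k S (2 * ev j.c20) + ν) + x ^ (s - 1) * p) by rw [he]; ring]
  exact sub_mem (self_mem_sup_span _ _) (hQ (mem_sup_span_pair.2 ⟨κ, hκ, _, _, rfl⟩))

end IsGerm

end Germ

/-! ### Comparing homomorphisms on power series -/

/-- No continuity is assumed. After the constant term is split off, an induction puts f h - g h in
every power of the maximal ideal, and Krull's intersection theorem finishes. -/
theorem algHom_congr {σ : Type*} [Finite σ] {k : Type*} [Field k] {S : Type*} [CommRing S]
    [Algebra k S] [IsNoetherianRing S] [IsLocalRing S] (f g : MvPowerSeries σ k →ₐ[k] S)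
    (hX : ∀ i, f (MvPowerSeries.X i) = g (MvPowerSeries.X i))
    (hm : ∀ i, f (MvPowerSeries.X i) ∈ IsLocalRing.maximalIdeal S) : f = g := by
  have key : ∀ n : ℕ, ∀ h, f h - g h ∈ IsLocalRing.maximalIdeal S ^ n := by
    intro n
    induction n with
    | zero => simp
    | succ n ih =>
      have h1 : ∀ z ∈ Ideal.span (Set.range (MvPowerSeries.X : σ → MvPowerSeries σ k)),
          ∀ a, f (a * z) - g (a * z) ∈ IsLocalRing.maximalIdeal S ^ (n + 1) := by
        intro z hz
        induction hz using Submodule.span_induction with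
        | mem x hx =>
          obtain ⟨i, rfl⟩ := hx
          intro a
          rw [map_mul, map_mul, ← hX, ← sub_mul, pow_succ]
          exact Ideal.mul_mem_mul (ih a) (hm i)
        | zero => simp
        | add x y _ _ hx hy =>
          intro a
          rw [mul_add, map_add, map_add, add_sub_add_comm]; exact add_mem (hx a) (hy a)
        | smul b x _ hx => intro a; rw [smul_eq_mul, ← mul_assoc]; exact hx _
      intro h
      have h2 : h - MvPowerSeries.C (MvPowerSeries.constantCoeff h) ∈
          Ideal.span (Set.range (MvPowerSeries.X : σ → MvPowerSeries σ k)) := by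
        rw [← maximalIdeal_eq_span_X, mem_maximalIdeal_iff]; simp
      have h3 := h1 _ h2 1
      have hC : ∀ c : k, (MvPowerSeries.C c : MvPowerSeries σ k) = algebraMap k _ c := fun c => rfl
      rw [hC, one_mul, map_sub, map_sub, AlgHom.commutes, AlgHom.commutes] at h3
      simpa using h3
  ext h
  have h1 : f h - g h ∈ (⨅ n : ℕ, IsLocalRing.maximalIdeal S ^ n) := by
    rw [Ideal.mem_iInf]; exact fun n => key n h
  rw [Ideal.iInf_pow_eq_bot_of_isLocalRing _ (Ideal.IsPrime.ne_top inferInstance)] at h1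
  exact sub_eq_zero.1 (by simpa using h1)

/-! ### Differential operators along the fibres -/

section Operators

variable {k : Type*} [Field k] {r : ℕ}

theorem left_injective : Function.Injective
    (Sum.map Sum.inl id : Fin 2 ⊕ Fin r → (Fin 2 ⊕ Fin 2) ⊕ Fin r) :=
  Sum.map_injective.2 ⟨Sum.inl_injective, Function.injective_id⟩

theorem right_injective : Function.Injective
    (Sum.map Sum.inr id : Fin 2 ⊕ Fin r → (Fin 2 ⊕ Fin 2) ⊕ Fin r) :=
  Sum.map_injective.2 ⟨Sum.inr_injective, Function.injective_id⟩

theorem pderiv_left (i : Fin 2) (a : Amb k r) :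
    MvPowerSeries.pderiv k (Sum.inl (Sum.inr i)) (left k r a) = 0 := by
  refine pderiv_rename_of_notMem ⟨_, left_injective⟩ ?_ a
  rintro ⟨(j | j), hj⟩ <;> simp at hj

theorem pderiv_right (i : Fin 2) (a : Amb k r) :
    MvPowerSeries.pderiv k (Sum.inl (Sum.inr i)) (right k r a) =
      right k r (MvPowerSeries.pderiv k (Sum.inl i) a) :=
  pderiv_rename_embedding ⟨_, right_injective⟩ (Sum.inl i) a

/-- The restriction to the diagonal: `u ↦ x`, `v ↦ y`. -/
def diag (k : Type*) [Field k] (r : ℕ) : Dbl k r →ₐ[k] Amb k r :=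
  MvPowerSeries.rename (Sum.map (Sum.elim id id) id)

theorem diag_left (a : Amb k r) : diag k r (left k r a) = a := by
  rw [diag, left, MvPowerSeries.rename_rename]
  convert! MvPowerSeries.rename_id_apply a
  ext (i | i) <;> rfl

theorem diag_right (a : Amb k r) : diag k r (right k r a) = a := by
  rw [diag, right, MvPowerSeries.rename_rename]
  convert! MvPowerSeries.rename_id_apply a
  ext (i | i) <;> rfl

/-- The differences `u - x` (for `i = 0`) and `v - y` (for `i = 1`). -/
def dif (k : Type*) [Field k] (r : ℕ) (i : Fin 2) : Dbl k r :=
  MvPowerSeries.X (Sum.inl (Sum.inr i)) - MvPowerSeries.X (Sum.inl (Sum.inl i))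

/-- The ideal `(u - x, v - y)` of the diagonal. -/
def diagIdeal (k : Type*) [Field k] (r : ℕ) : Ideal (Dbl k r) := Ideal.span {dif k r 0, dif k r 1}

theorem dif_mem (i : Fin 2) : dif k r i ∈ diagIdeal k r := by
  fin_cases i <;> exact Ideal.subset_span (by simp)

theorem diag_dif (i : Fin 2) : diag k r (dif k r i) = 0 := by
  simp [diag, dif, MvPowerSeries.rename_X]

theorem diag_of_mem {z : Dbl k r} (hz : z ∈ diagIdeal k r) : diag k r z = 0 := by
  have : diagIdeal k r ≤ RingHom.ker (diag k r) := by
    rw [diagIdeal, Ideal.span_le]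
    rintro _ (rfl | rfl) <;> exact diag_dif _
  exact this hz

/-- Modulo (u - x, v - y), the identity and h ↦ h(x, y, x, y, t) agree on the variables, hence
everywhere by `algHom_congr`. -/
theorem sub_left_diag_mem (h : Dbl k r) : h - left k r (diag k r h) ∈ diagIdeal k r := by
  have hm : diagIdeal k r ≤ IsLocalRing.maximalIdeal (Dbl k r) := by
    rw [diagIdeal, Ideal.span_le]
    rintro _ (rfl | rfl) <;> exact (mem_maximalIdeal_iff _).2 (by simp [dif])
  have : Nontrivial (Dbl k r ⧸ diagIdeal k r) := Ideal.Quotient.nontrivial_iff.2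
    (fun h => (Ideal.IsPrime.ne_top (I := IsLocalRing.maximalIdeal (Dbl k r)) inferInstance)
      (top_le_iff.1 (h ▸ hm)))
  have : IsLocalRing (Dbl k r ⧸ diagIdeal k r) :=
    IsLocalRing.of_surjective' (Ideal.Quotient.mk _) Ideal.Quotient.mk_surjective
  have h1 := algHom_congr (Ideal.Quotient.mkₐ k (diagIdeal k r))
    (((Ideal.Quotient.mkₐ k (diagIdeal k r)).comp (left k r)).comp (diag k r)) ?_ ?_
  · have := DFunLike.congr_fun h1 h
    exact Ideal.Quotient.eq.1 this
  · rintro ((i | i) | i)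
    · simp [left, diag, MvPowerSeries.rename_X]
    · simp only [left, diag, AlgHom.comp_apply, MvPowerSeries.rename_X, Ideal.Quotient.mkₐ_eq_mk]
      exact Ideal.Quotient.eq.2 (dif_mem i)
    · simp [left, diag, MvPowerSeries.rename_X]
  · intro i
    rw [IsLocalRing.mem_maximalIdeal, mem_nonunits_iff]
    intro hu
    obtain ⟨z, hz⟩ := hu.exists_right_inv
    obtain ⟨w, rfl⟩ := Ideal.Quotient.mk_surjective z
    rw [Ideal.Quotient.mkₐ_eq_mk, ← map_mul, ← map_one (Ideal.Quotient.mk _), Ideal.Quotient.eq] at hz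
    have := (mem_maximalIdeal_iff _).1 (hm hz)
    simp at this

theorem eq_left_add (h : Dbl k r) : ∃ h₁ h₂, h = left k r (diag k r h) + h₁ * dif k r 0 +
    h₂ * dif k r 1 := by
  obtain ⟨a, b, hab⟩ := Ideal.mem_span_pair.1 (sub_left_diag_mem h)
  exact ⟨a, b, by linear_combination -hab⟩

theorem pderiv_dif (i j : Fin 2) : MvPowerSeries.pderiv k (Sum.inl (Sum.inr i)) (dif k r j) =
    if i = j then 1 else 0 := by
  rw [dif, map_sub, MvPowerSeries.pderiv_X_of_ne (i := Sum.inl (Sum.inr i))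
    (j := (Sum.inl (Sum.inl j))) (by simp), sub_zero]
  split_ifs with h
  · rw [h, MvPowerSeries.pderiv_X_self]
  · rw [MvPowerSeries.pderiv_X_of_ne]; simp [Ne.symm h]

/-- First-order Taylor expansion along the diagonal. -/
theorem taylor_mem (h : Dbl k r) : h - (left k r (diag k r h) +
    left k r (diag k r (MvPowerSeries.pderiv k (Sum.inl (Sum.inr 0)) h)) * dif k r 0 +
    left k r (diag k r (MvPowerSeries.pderiv k (Sum.inl (Sum.inr 1)) h)) * dif k r 1) ∈
      diagIdeal k r ^ 2 := by
  obtain ⟨h₁, h₂, e⟩ := eq_left_add h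
  have e0 : diag k r (MvPowerSeries.pderiv k (Sum.inl (Sum.inr 0)) h) = diag k r h₁ := by
    rw [e]; simp [pderiv_left, pderiv_dif, diag_dif]
  have e1 : diag k r (MvPowerSeries.pderiv k (Sum.inl (Sum.inr 1)) h) = diag k r h₂ := by
    rw [e]; simp [pderiv_left, pderiv_dif, diag_dif]
  rw [e0, e1, show h - (left k r (diag k r h) + left k r (diag k r h₁) * dif k r 0 +
    left k r (diag k r h₂) * dif k r 1) = (h₁ - left k r (diag k r h₁)) * dif k r 0 +
    (h₂ - left k r (diag k r h₂)) * dif k r 1 by linear_combination e, pow_two]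
  exact add_mem (Ideal.mul_mem_mul (sub_left_diag_mem _) (dif_mem _))
    (Ideal.mul_mem_mul (sub_left_diag_mem _) (dif_mem _))

/-- The derivation `F_y(u, v, t) ∂_u - F_x(u, v, t) ∂_v`. -/
def flow (F : Amb k r) : Derivation k (Dbl k r) (Dbl k r) :=
  right k r (MvPowerSeries.pderiv k (Sum.inl 1) F) • MvPowerSeries.pderiv k (Sum.inl (Sum.inr 0)) -
    right k r (MvPowerSeries.pderiv k (Sum.inl 0) F) • MvPowerSeries.pderiv k (Sum.inl (Sum.inr 1))

theorem flow_apply (F : Amb k r) (h : Dbl k r) : flow F h =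
    right k r (MvPowerSeries.pderiv k (Sum.inl 1) F) *
      MvPowerSeries.pderiv k (Sum.inl (Sum.inr 0)) h -
    right k r (MvPowerSeries.pderiv k (Sum.inl 0) F) *
      MvPowerSeries.pderiv k (Sum.inl (Sum.inr 1)) h := rfl

theorem flow_left_mul (F a : Amb k r) (h : Dbl k r) :
    flow F (left k r a * h) = left k r a * flow F h := by
  simp only [flow_apply, Derivation.leibniz, pderiv_left, smul_eq_mul]; ring

/-- D annihilates F(u, v, t) because F_y F_x - F_x F_y = 0. -/
theorem flow_right_mul (F : Amb k r) (h : Dbl k r) :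
    flow F (right k r F * h) = right k r F * flow F h := by
  simp only [flow_apply, Derivation.leibniz, pderiv_right, smul_eq_mul]; ring

theorem flow_iterate_left_mul (F a : Amb k r) (h : Dbl k r) (i : ℕ) :
    (flow F)^[i] (left k r a * h) = left k r a * (flow F)^[i] h := by
  induction i generalizing h with
  | zero => rfl
  | succ i ih => rw [Function.iterate_succ_apply, Function.iterate_succ_apply, flow_left_mul, ih]

theorem flow_iterate_right_mul (F : Amb k r) (h : Dbl k r) (i : ℕ) :
    (flow F)^[i] (right k r F * h) = right k r F * (flow F)^[i] h := by
  induction i generalizing h with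
  | zero => rfl
  | succ i ih => rw [Function.iterate_succ_apply, Function.iterate_succ_apply, flow_right_mul, ih]

theorem flow_iterate_add (F : Amb k r) (h h' : Dbl k r) (i : ℕ) :
    (flow F)^[i] (h + h') = (flow F)^[i] h + (flow F)^[i] h' := iterate_map_add _ _ _ _

theorem derivation_mem_pow {A : Type*} [CommRing A] [Algebra k A] (D : Derivation k A A)
    (I : Ideal A) (n : ℕ) {z : A} (hz : z ∈ I ^ (n + 1)) : D z ∈ I ^ n := by
  induction n generalizing z with
  | zero => simp
  | succ n ih =>
    rw [pow_succ'] at hz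
    induction hz using Submodule.mul_induction_on' with
    | mem_mul_mem a ha b hb =>
      rw [Derivation.leibniz, smul_eq_mul, smul_eq_mul]
      refine add_mem ?_ (Ideal.mul_mem_right _ _ hb)
      rw [pow_succ']
      exact Ideal.mul_mem_mul ha (ih hb)
    | add x _ y _ hx hy => rw [map_add]; exact add_mem hx hy

theorem flow_iterate_mem (F : Amb k r) (n i : ℕ) {z : Dbl k r} (hz : z ∈ diagIdeal k r ^ (n + i)) :
    (flow F)^[i] z ∈ diagIdeal k r ^ n := by
  induction i generalizing z with
  | zero => exact hz
  | succ i ih =>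
    rw [Function.iterate_succ_apply]
    exact ih (derivation_mem_pow _ _ _ hz)

theorem diag_flow_iterate_of_mem (F : Amb k r) {i : ℕ} {z : Dbl k r}
    (hz : z ∈ diagIdeal k r ^ (i + 1)) : diag k r ((flow F)^[i] z) = 0 := by
  apply diag_of_mem
  rw [← pow_one (diagIdeal k r)]
  exact flow_iterate_mem F 1 i (by rwa [add_comm])

/-- In the Leibniz expansion of D^(n+1)(a z), a D^(n+1) z vanishes on the diagonal, and so does
every term with fewer than n derivatives on z. Only (n + 1) (D a) (D^n z) remains. -/
theorem diag_flow_iterate_mul (F : Amb k r) (n : ℕ) {a z : Dbl k r} (ha : a ∈ diagIdeal k r)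
    (hz : z ∈ diagIdeal k r ^ n) : diag k r ((flow F)^[n + 1] (a * z)) =
      (n + 1) * diag k r (flow F a) * diag k r ((flow F)^[n] z) := by
  -- The neglected terms after i + 1 derivatives lie in I^(n+1-i); each further derivative lowers
  -- the power by one.
  have key : ∀ i, i ≤ n → (flow F)^[i + 1] (a * z) - (a * (flow F)^[i + 1] z +
      (i + 1) * flow F a * (flow F)^[i] z) ∈ diagIdeal k r ^ (n + 1 - i) := by
    intro i hi
    induction i with
    | zero =>
      simp only [Function.iterate_succ_apply, Function.iterate_zero_apply, Derivation.leibniz,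
        smul_eq_mul]
      rw [show a * flow F z + z * flow F a - (a * flow F z + ((0 : ℕ) + 1) * flow F a * z) = 0 by
        push_cast; ring]
      exact zero_mem _
    | succ i ih =>
      have h1 := ih (by omega)
      rw [show n + 1 - i = (n + 1 - (i + 1)) + 1 by omega] at h1
      have h2 := derivation_mem_pow (flow F) _ _ h1
      have h3 : (flow F)^[i] z ∈ diagIdeal k r ^ (n + 1 - (i + 1)) :=
        flow_iterate_mem F _ i (by rwa [show n + 1 - (i + 1) + i = n by omega])
      have h4 : (flow F)^[i + 1 + 1] (a * z) - (a * (flow F)^[i + 1 + 1] z +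
          ((i + 1 : ℕ) + 1) * flow F a * (flow F)^[i + 1] z) =
          flow F ((flow F)^[i + 1] (a * z) - (a * (flow F)^[i + 1] z +
            (i + 1) * flow F a * (flow F)^[i] z)) +
            ((i + 1) * flow F (flow F a)) * (flow F)^[i] z := by
        have h5 : flow F ((i : Dbl k r) + 1) = 0 := by
          rw [map_add, Derivation.map_one_eq_zero, Derivation.map_natCast, add_zero]
        simp only [Function.iterate_succ_apply', map_sub, map_add (flow F) (_ * _) (_ * _),
          Derivation.leibniz, smul_eq_mul, h5]
        push_cast
        ring
      rw [h4]
      exact add_mem h2 (Ideal.mul_mem_left _ _ h3)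
  have h1 := key n le_rfl
  rw [show n + 1 - n = 1 by omega, pow_one] at h1
  have h2 := diag_of_mem h1
  rw [map_sub, sub_eq_zero] at h2
  rw [h2]
  simp [diag_of_mem ha]

end Operators

/-! ### The dual of the module of principal parts -/

section Dual

variable {k : Type*} [Field k] {r : ℕ}

theorem ppIdeal_eq (F : Amb k r) (m : ℕ) :
    ppIdeal F m = Ideal.span {left k r F, right k r F} ⊔ diagIdeal k r ^ m := rfl

theorem algebraMap_PP (F : Amb k r) (m : ℕ) (a : Amb k r) :
    algebraMap (Total F) (PP F m) (Ideal.Quotient.mk _ a) = Ideal.Quotient.mk _ (left k r a) := rfl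

theorem mk_smul_mk (F : Amb k r) (m : ℕ) (a : Amb k r) (h : Dbl k r) :
    (Ideal.Quotient.mk (Ideal.span {F}) a : Total F) • (Ideal.Quotient.mk (ppIdeal F m) h) =
      Ideal.Quotient.mk _ (left k r a * h) := by
  rw [Algebra.smul_def, algebraMap_PP, map_mul]

/-- D is linear over functions of (x, y, t) and over F(u, v, t), and i < m derivatives do not take
I^m out of the diagonal ideal; hence the functionals descend to the principal parts. -/
theorem mk_diag_flow_iterate_eq_zero (F : Amb k r) {i m : ℕ} (hi : i < m) {h : Dbl k r}
    (hh : h ∈ ppIdeal F m) :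
    Ideal.Quotient.mk (Ideal.span {F}) (diag k r ((flow F)^[i] h)) = 0 := by
  rw [ppIdeal_eq] at hh
  obtain ⟨a, ha, z, hz, rfl⟩ := Submodule.mem_sup.1 hh
  obtain ⟨c, c', rfl⟩ := Ideal.mem_span_pair.1 ha
  rw [flow_iterate_add, flow_iterate_add, mul_comm c, mul_comm c', flow_iterate_left_mul,
    flow_iterate_right_mul, map_add (diag k r), map_add (diag k r), map_mul (diag k r),
    map_mul (diag k r), diag_left, diag_right,
    diag_flow_iterate_of_mem F (Ideal.pow_le_pow_right hi hz), add_zero,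
    Ideal.Quotient.eq_zero_iff_mem]
  exact add_mem (Ideal.mul_mem_right _ _ (Ideal.mem_span_singleton_self F))
    (Ideal.mul_mem_right _ _ (Ideal.mem_span_singleton_self F))

/-- The functional `h ↦ (D^i h)|_{u = x, v = y}` on the principal parts, where `D` is the
derivation `F_y ∂_u - F_x ∂_v`. -/
def opFun (F : Amb k r) (m : ℕ) (i : Fin m) : Module.Dual (Total F) (PP F m) where
  toFun := QuotientAddGroup.lift (Submodule.toAddSubgroup (ppIdeal F m))
    ((Ideal.Quotient.mk (Ideal.span {F})).toAddMonoidHom.comp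
      ((diag k r).toRingHom.toAddMonoidHom.comp
        { toFun := fun h => (flow F)^[i] h
          map_zero' := iterate_map_zero _ _
          map_add' := fun a b => flow_iterate_add F a b i }))
    (fun _ hh => mk_diag_flow_iterate_eq_zero F i.2 hh)
  map_add' := map_add _
  map_smul' := by
    intro a h
    obtain ⟨a, rfl⟩ := Ideal.Quotient.mk_surjective a
    obtain ⟨h, rfl⟩ := Ideal.Quotient.mk_surjective h
    rw [mk_smul_mk]
    change Ideal.Quotient.mk (Ideal.span {F}) (diag k r ((flow F)^[i] (left k r a * h))) =
      Ideal.Quotient.mk _ a * Ideal.Quotient.mk (Ideal.span {F}) (diag k r ((flow F)^[i] h))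
    rw [flow_iterate_left_mul, map_mul, diag_left, map_mul]

theorem opFun_mk (F : Amb k r) (m : ℕ) (i : Fin m) (h : Dbl k r) :
    opFun F m i (Ideal.Quotient.mk _ h) =
      Ideal.Quotient.mk (Ideal.span {F}) (diag k r ((flow F)^[i] h)) := rfl

/-- The recursion resembles that of the geometric progression ξ^a η^(n-a); regularity of ξ, η forces
every solution to be a multiple of it. -/
theorem exists_eq_pow_mul {S : Type*} [CommRing S] {ξ η : S} (h1 : RegMod ⊥ ξ)
    (h2 : RegMod (⊥ ⊔ Ideal.span {ξ}) η) (n : ℕ) (v : ℕ → S)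
    (hv : ∀ a < n, ξ * v a = η * v (a + 1)) :
    ∃ γ, ∀ a ≤ n, v a = ξ ^ a * η ^ (n - a) * γ := by
  -- η remains a nonzerodivisor modulo every power of ξ.
  have hpow : ∀ n r, ξ ^ n ∣ η * r → ξ ^ n ∣ r := by
    intro n
    induction n with
    | zero => simp
    | succ n ih =>
      rintro r ⟨c, hc⟩
      obtain ⟨κ, hκ, r', rfl⟩ := mem_sup_span.1 (h2 r (by
        rw [hc, pow_succ', mul_assoc]; exact mul_mem_sup_span _ _ _))
      rw [Ideal.mem_bot.1 hκ, zero_add] at hc ⊢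
      have h3 : ξ ^ n ∣ η * r' := by
        refine ⟨c, ?_⟩
        have := h1 (η * r' - ξ ^ n * c) (by rw [Ideal.mem_bot]; linear_combination hc)
        exact sub_eq_zero.1 (Ideal.mem_bot.1 this)
      rw [pow_succ']
      exact mul_dvd_mul_left _ (ih _ h3)
  induction n with
  | zero => exact ⟨v 0, fun a ha => by simp [Nat.le_zero.1 ha]⟩
  | succ n ih =>
    obtain ⟨γ, hγ⟩ := ih fun a ha => hv a (by omega)
    have h3 := hv n (by omega)
    rw [hγ n le_rfl, Nat.sub_self, pow_zero, mul_one] at h3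
    obtain ⟨γ', hγ'⟩ := hpow (n + 1) (v (n + 1)) ⟨γ, by rw [← h3]; ring⟩
    have h4 : γ = η * γ' := by
      have := h1.pow (n + 1) (γ - η * γ') (by
        rw [Ideal.mem_bot]; rw [hγ'] at h3; linear_combination h3)
      exact sub_eq_zero.1 (Ideal.mem_bot.1 this)
    refine ⟨γ', fun a ha => ?_⟩
    rcases Nat.lt_or_ge n a with h5 | h5
    · rw [show a = n + 1 by omega, hγ']; simp
    · rw [hγ a h5, h4, show n + 1 - a = (n - a) + 1 by omega]; ring

theorem diagIdeal_pow_eq (n : ℕ) : diagIdeal k r ^ n =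
    Ideal.span (Set.range fun a : Fin (n + 1) => dif k r 0 ^ (a : ℕ) * dif k r 1 ^ (n - a)) := by
  apply le_antisymm
  · induction n with
    | zero =>
      rw [pow_zero, Ideal.one_eq_top, top_le_iff, Ideal.eq_top_iff_one]
      exact Ideal.subset_span ⟨0, by simp⟩
    | succ n ih =>
      rw [pow_succ]
      refine (Ideal.mul_mono_left ih).trans ?_
      rw [diagIdeal, Ideal.span_mul_span', Ideal.span_le]
      rintro _ ⟨_, ⟨a, rfl⟩, _, (rfl | rfl), rfl⟩
      · exact Ideal.subset_span ⟨a.succ, by simp; ring⟩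
      · refine Ideal.subset_span ⟨a.castSucc, ?_⟩
        have := a.2
        simp only [Fin.val_castSucc]
        rw [show n + 1 - (a : ℕ) = (n - a) + 1 by omega]; ring
  · rw [Ideal.span_le]
    rintro _ ⟨a, rfl⟩
    have := a.2
    have h1 := Ideal.mul_mem_mul (Ideal.pow_mem_pow (dif_mem (k := k) (r := r) 0) (a : ℕ))
      (Ideal.pow_mem_pow (dif_mem (k := k) (r := r) 1) (n - a))
    rwa [← pow_add, show (a : ℕ) + (n - a) = n by omega] at h1

theorem dif_mul_mem (a b : ℕ) : dif k r 0 ^ a * dif k r 1 ^ b ∈ diagIdeal k r ^ (a + b) := by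
  rw [pow_add]
  exact Ideal.mul_mem_mul (Ideal.pow_mem_pow (dif_mem 0) a) (Ideal.pow_mem_pow (dif_mem 1) b)

theorem diag_flow_dif (F : Amb k r) :
    diag k r (flow F (dif k r 0)) = MvPowerSeries.pderiv k (Sum.inl 1) F ∧
      diag k r (flow F (dif k r 1)) = -MvPowerSeries.pderiv k (Sum.inl 0) F := by
  simp [flow_apply, pderiv_dif, diag_right]

theorem diag_flow_iterate_dif (F : Amb k r) (a b : ℕ) :
    diag k r ((flow F)^[a + b] (dif k r 0 ^ a * dif k r 1 ^ b)) = ((a + b).factorial : Amb k r) *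
      (MvPowerSeries.pderiv k (Sum.inl 1) F ^ a * (-MvPowerSeries.pderiv k (Sum.inl 0) F) ^ b) := by
  induction a with
  | zero =>
    induction b with
    | zero => simp
    | succ b ih =>
      simp only [pow_zero, one_mul, zero_add] at ih ⊢
      rw [pow_succ', diag_flow_iterate_mul F b (dif_mem 1) (by
        simpa using dif_mul_mem (k := k) (r := r) 0 b), ih, (diag_flow_dif F).2,
        Nat.factorial_succ]
      push_cast; ring
  | succ a ih =>
    rw [show a + 1 + b = (a + b) + 1 by ring, pow_succ', mul_assoc,
      diag_flow_iterate_mul F (a + b) (dif_mem 0) (dif_mul_mem a b), ih, (diag_flow_dif F).1,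
      Nat.factorial_succ]
    push_cast; ring

/-! ### Generation of the dual by the iterates of D -/

section Span

variable [CharZero k] {F : Amb k r} {m : ℕ}
  (h1 : RegMod ⊥ (Ideal.Quotient.mk (Ideal.span {F}) (MvPowerSeries.pderiv k (Sum.inl 1) F)))
  (h2 : RegMod (⊥ ⊔ Ideal.span {Ideal.Quotient.mk (Ideal.span {F})
    (MvPowerSeries.pderiv k (Sum.inl 1) F)})
    (Ideal.Quotient.mk (Ideal.span {F}) (-MvPowerSeries.pderiv k (Sum.inl 0) F)))
include h1 h2

/-- On I^n a functional killing I^(n+1) is determined by its values on the monomials (u - x)^a (v -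
y)^(n-a). The relation F(u, v, t) = 0 forces these values to be γ ξ^a η^(n-a), which is γ / n! times
the values of D^n. -/
theorem exists_sub_smul_opFun (n : Fin m) (φ : Module.Dual (Total F) (PP F m))
    (hφ : ∀ z ∈ diagIdeal k r ^ ((n : ℕ) + 1), φ (Ideal.Quotient.mk _ z) = 0) :
    ∃ c : Total F, ∀ z ∈ diagIdeal k r ^ (n : ℕ),
      (φ - c • opFun F m n) (Ideal.Quotient.mk _ z) = 0 := by
  have hleft : ∀ (a : Amb k r) (z : Dbl k r), φ (Ideal.Quotient.mk _ (left k r a * z)) =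
      Ideal.Quotient.mk _ a * φ (Ideal.Quotient.mk _ z) := fun a z => by
    rw [← mk_smul_mk, map_smul, smul_eq_mul]
  have hrel : ∀ a b : ℕ, a + b + 1 = n →
      Ideal.Quotient.mk _ (MvPowerSeries.pderiv k (Sum.inl 1) F) *
        φ (Ideal.Quotient.mk _ (dif k r 0 ^ a * dif k r 1 ^ (b + 1))) =
      Ideal.Quotient.mk _ (-MvPowerSeries.pderiv k (Sum.inl 0) F) *
        φ (Ideal.Quotient.mk _ (dif k r 0 ^ (a + 1) * dif k r 1 ^ b)) := by
    intro a b hab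
    -- First-order Taylor expansion of F(u, v, t), multiplied by a monomial of degree n - 1, gives a
    -- linear relation between the values on adjacent monomials of degree n; the remainder lies in
    -- I^(n+1).
    have h3 := taylor_mem (right k r F)
    rw [diag_right, pderiv_right, pderiv_right, diag_right, diag_right] at h3
    have h4 := hφ _ (show _ ∈ diagIdeal k r ^ ((n : ℕ) + 1) by
      rw [← hab, show a + b + 1 + 1 = 2 + (a + b) by ring, pow_add]
      exact Ideal.mul_mem_mul h3 (dif_mul_mem a b))
    have h5 : φ (Ideal.Quotient.mk _ (left k r F * (dif k r 0 ^ a * dif k r 1 ^ b))) = 0 := by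
      rw [hleft, Ideal.Quotient.eq_zero_iff_mem.2 (Ideal.mem_span_singleton_self F), zero_mul]
    have h6 : φ (Ideal.Quotient.mk _ (right k r F * (dif k r 0 ^ a * dif k r 1 ^ b))) = 0 := by
      rw [Ideal.Quotient.eq_zero_iff_mem.2, map_zero]
      exact Ideal.mem_sup_left (Ideal.mul_mem_right _ _ (Ideal.subset_span (by simp)))
    have h7 : ∀ A B P Q M : Dbl k r, (A - (B + P * dif k r 0 + Q * dif k r 1)) * M =
      A * M - B * M - P * (dif k r 0 * M) - Q * (dif k r 1 * M) := by intros; ring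
    rw [h7, map_sub, map_sub, map_sub, map_sub, map_sub, map_sub, h5, h6, hleft, hleft] at h4
    rw [show dif k r 0 ^ a * dif k r 1 ^ (b + 1) = dif k r 1 * (dif k r 0 ^ a * dif k r 1 ^ b) by
      ring, show dif k r 0 ^ (a + 1) * dif k r 1 ^ b =
        dif k r 0 * (dif k r 0 ^ a * dif k r 1 ^ b) by ring, map_neg]
    linear_combination -h4
  obtain ⟨γ, hγ⟩ := exists_eq_pow_mul h1 h2 n
    (fun a => φ (Ideal.Quotient.mk _ (dif k r 0 ^ a * dif k r 1 ^ ((n : ℕ) - a)))) (by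
      intro a ha
      have := hrel a (n - (a + 1)) (by omega)
      rwa [show (n : ℕ) - (a + 1) + 1 = n - a by omega] at this)
  refine ⟨algebraMap k (Total F) ((n : ℕ).factorial : k)⁻¹ * γ, fun z hz => ?_⟩
  rw [diagIdeal_pow_eq] at hz
  set ψ := φ - (algebraMap k (Total F) ((n : ℕ).factorial : k)⁻¹ * γ) • opFun F m n with hψ
  have hψ1 : ∀ z ∈ diagIdeal k r ^ ((n : ℕ) + 1), ψ (Ideal.Quotient.mk _ z) = 0 := by
    intro z hz
    rw [hψ, LinearMap.sub_apply, LinearMap.smul_apply, hφ z hz, opFun_mk,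
      diag_flow_iterate_of_mem F hz, map_zero, smul_zero, sub_zero]
  have hψ2 : ∀ a : Fin ((n : ℕ) + 1),
      ψ (Ideal.Quotient.mk _ (dif k r 0 ^ (a : ℕ) * dif k r 1 ^ ((n : ℕ) - a))) = 0 := by
    intro a
    have ha := a.2
    have h3 := diag_flow_iterate_dif F a (n - a)
    rw [show (a : ℕ) + (n - a) = n by omega] at h3
    rw [hψ, LinearMap.sub_apply, LinearMap.smul_apply, hγ a (by omega), opFun_mk, h3, smul_eq_mul,
      map_mul, map_mul, map_pow, map_pow, map_natCast]
    have h4 : algebraMap k (Total F) ((n : ℕ).factorial : k)⁻¹ * ((n : ℕ).factorial : Total F) = 1 := by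
      rw [← map_natCast (algebraMap k (Total F)), ← map_mul, inv_mul_cancel₀, map_one]
      exact Nat.cast_ne_zero.2 (Nat.factorial_ne_zero _)
    rw [sub_eq_zero]
    linear_combination (-(Ideal.Quotient.mk (Ideal.span {F})
      (MvPowerSeries.pderiv k (Sum.inl 1) F)) ^ (a : ℕ) * (Ideal.Quotient.mk (Ideal.span {F})
      (-MvPowerSeries.pderiv k (Sum.inl 0) F)) ^ ((n : ℕ) - a) * γ) * h4
  -- ψ is linear only over functions of (x, y, t). A coefficient c may be replaced by its
  -- restriction to the diagonal, since the difference pushes the monomial into I^(n+1).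
  have hψ3 : ∀ z ∈ Ideal.span (Set.range fun a : Fin ((n : ℕ) + 1) =>
      dif k r 0 ^ (a : ℕ) * dif k r 1 ^ ((n : ℕ) - a)), ∀ c,
      ψ (Ideal.Quotient.mk _ (c * z)) = 0 := by
    intro z hz
    induction hz using Submodule.span_induction with
    | mem x hx =>
      obtain ⟨a, rfl⟩ := hx
      intro c
      have ha := a.2
      have hmem := dif_mul_mem (k := k) (r := r) a (n - a)
      rw [show (a : ℕ) + (n - a) = n by omega] at hmem
      have h3 := hψ1 ((c - left k r (diag k r c)) *
        (dif k r 0 ^ (a : ℕ) * dif k r 1 ^ ((n : ℕ) - a))) (by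
          rw [pow_succ']; exact Ideal.mul_mem_mul (sub_left_diag_mem c) hmem)
      rw [sub_mul, map_sub, map_sub, ← mk_smul_mk, map_smul, hψ2, smul_zero, sub_zero] at h3
      exact h3
    | zero => simp
    | add x y _ _ hx hy => intro c; rw [mul_add, map_add, map_add, hx, hy, add_zero]
    | smul b x _ hx => intro c; rw [smul_eq_mul, ← mul_assoc]; exact hx _
  simpa using hψ3 z hz 1

/-- Every functional kills I^m. Subtracting multiples of D^(m-1), ..., D^0 makes it kill I^(m-1),
..., I^0 successively, hence vanish. -/
theorem mem_span_opFun (φ : Module.Dual (Total F) (PP F m)) :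
    ∃ c : Fin m → Total F, ∀ h, φ h = ∑ i, c i * opFun F m i h := by
  have key : ∀ n : ℕ, ∀ _ : n ≤ m, ∀ φ : Module.Dual (Total F) (PP F m),
      (∀ z ∈ diagIdeal k r ^ n, φ (Ideal.Quotient.mk _ z) = 0) →
      ∃ c : Fin m → Total F, ∀ h, φ h = ∑ i, c i * opFun F m i h := by
    intro n
    induction n with
    | zero =>
      intro _ φ hφ
      refine ⟨fun _ => 0, fun h => ?_⟩
      simp only [zero_mul, Finset.sum_const_zero]
      obtain ⟨h, rfl⟩ := Ideal.Quotient.mk_surjective h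
      exact hφ h (by simp)
    | succ n ih =>
      intro hn φ hφ
      obtain ⟨c, hc⟩ := exists_sub_smul_opFun h1 h2 ⟨n, hn⟩ φ hφ
      obtain ⟨b, hb⟩ := ih (Nat.le_of_succ_le hn) _ hc
      refine ⟨b + Pi.single ⟨n, hn⟩ c, fun h => ?_⟩
      have h3 := hb h
      rw [LinearMap.sub_apply, LinearMap.smul_apply, smul_eq_mul, sub_eq_iff_eq_add] at h3
      rw [h3]
      simp only [Pi.add_apply, add_mul, Finset.sum_add_distrib, Pi.single_apply, ite_mul,
        zero_mul, Finset.sum_ite_eq', Finset.mem_univ, if_true]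
  exact key m le_rfl φ (fun z hz => by
    rw [Ideal.Quotient.eq_zero_iff_mem.2 (show z ∈ ppIdeal F m from Ideal.mem_sup_right hz),
      map_zero])

end Span

/-- The matrix `(D^i h_j)`. -/
def opMatrix (F : Amb k r) (h : Fin 3 → Dbl k r) : Matrix (Fin 4) (Fin 3) (Amb k r) :=
  Matrix.of fun i j => diag k r ((flow F)^[(i : ℕ)] (h j))

theorem minorIdeal_le_degIdeal (F : Amb k r) (h : Fin 3 → Dbl k r) :
    minorIdeal ((opMatrix F h).map (Ideal.Quotient.mk (Ideal.span {F}))) ≤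
      degIdeal F 4 fun j => Ideal.Quotient.mk (ppIdeal F 4) (h j) := by
  refine Ideal.span_le.2 ?_
  rintro _ ⟨ι, rfl⟩
  exact Ideal.subset_span ⟨fun i => opFun F 4 (ι i), rfl⟩

/-- Arbitrary functionals are combinations of the D^i, so multilinearity of the determinant expands
each defining generator into minors of (D^i h_j). Only generation of the dual is used, not
independence. -/
theorem degIdeal_eq_minorIdeal [CharZero k] {F : Amb k r}
    (h1 : RegMod ⊥ (Ideal.Quotient.mk (Ideal.span {F}) (MvPowerSeries.pderiv k (Sum.inl 1) F)))
    (h2 : RegMod (⊥ ⊔ Ideal.span {Ideal.Quotient.mk (Ideal.span {F})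
      (MvPowerSeries.pderiv k (Sum.inl 1) F)})
      (Ideal.Quotient.mk (Ideal.span {F}) (-MvPowerSeries.pderiv k (Sum.inl 0) F)))
    (h : Fin 3 → Dbl k r) :
    degIdeal F 4 (fun j => Ideal.Quotient.mk (ppIdeal F 4) (h j)) =
      minorIdeal ((opMatrix F h).map (Ideal.Quotient.mk (Ideal.span {F}))) := by
  refine le_antisymm (Ideal.span_le.2 ?_) (minorIdeal_le_degIdeal F h)
  rintro _ ⟨φ, rfl⟩
  choose c hc using fun i => mem_span_opFun h1 h2 (φ i)
  set E := (opMatrix F h).map (Ideal.Quotient.mk (Ideal.span {F})) with hE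
  have e1 : (Matrix.of fun i j => φ i (Ideal.Quotient.mk (ppIdeal F 4) (h j))) =
      fun i => ∑ l : Fin 4, c i l • fun j => E l j := by
    funext i j
    rw [Matrix.of_apply, hc i, Finset.sum_apply]
    rfl
  have e2 := (Matrix.detRowAlternating (R := Total F) (n := Fin 3)).toMultilinearMap.map_sum
    (fun (i : Fin 3) (l : Fin 4) => c i l • fun j => E l j)
  have e3 : (Matrix.of fun i j => φ i (Ideal.Quotient.mk (ppIdeal F 4) (h j))).det =
      ∑ ι : Fin 3 → Fin 4, (∏ i, c i (ι i)) • (E.submatrix ι id).det := by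
    rw [e1]
    refine e2.trans (Finset.sum_congr rfl fun ι _ => ?_)
    exact MultilinearMap.map_smul_univ _ (fun i => c i (ι i)) (fun i j => E (ι i) j)
  simp only [SetLike.mem_coe]
  rw [e3]
  exact Ideal.sum_mem _ fun ι _ => Ideal.mul_mem_left _ _ (Ideal.subset_span ⟨ι, rfl⟩)

end Dual

/-! ### The chain rule -/

section Chain

variable {k : Type*} [Field k] {r : ℕ}

/-- The partial derivatives of order at most three in the variables `u, v`. -/
def jet (h : Dbl k r) : Fin 10 → Dbl k r :=
  let u := MvPowerSeries.pderiv k (Sum.inl (Sum.inr 0) : (Fin 2 ⊕ Fin 2) ⊕ Fin r)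
  let v := MvPowerSeries.pderiv k (Sum.inl (Sum.inr 1) : (Fin 2 ⊕ Fin 2) ⊕ Fin r)
  ![h, u h, v h, u (u h), u (v h), v (v h), u (u (u h)), u (u (v h)), u (v (v h)), v (v (v h))]

/-- The restrictions to the diagonal of the partial derivatives in the variables `u, v`. -/
def jetMatrix (h : Fin 3 → Dbl k r) : Matrix (Fin 10) (Fin 3) (Amb k r) :=
  Matrix.of fun i j => diag k r (jet (h j) i)

/-- The symbol matrix of the derivation `F_y ∂_x - F_x ∂_y`. -/
def ambSymbol (F : Amb k r) : Matrix (Fin 4) (Fin 10) (Amb k r) :=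
  let x := MvPowerSeries.pderiv k (Sum.inl 0 : Fin 2 ⊕ Fin r)
  let y := MvPowerSeries.pderiv k (Sum.inl 1 : Fin 2 ⊕ Fin r)
  symbolMatrix (y F) (-x F) (x (x F)) (x (y F)) (y (y F)) (x (x (x F))) (x (x (y F)))
    (x (y (y F))) (y (y (y F)))

theorem opMatrix_eq (F : Amb k r) (h : Fin 3 → Dbl k r) :
    opMatrix F h = ambSymbol F * jetMatrix h := by
  have c1 : ∀ f : Amb k r, MvPowerSeries.pderiv k (Sum.inl 1) (MvPowerSeries.pderiv k (Sum.inl 0) f) =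
      MvPowerSeries.pderiv k (Sum.inl 0) (MvPowerSeries.pderiv k (Sum.inl 1) f) :=
    pderiv_pderiv_comm _ _
  have c2 : ∀ f : Dbl k r, MvPowerSeries.pderiv k (Sum.inl (Sum.inr 1))
      (MvPowerSeries.pderiv k (Sum.inl (Sum.inr 0)) f) =
      MvPowerSeries.pderiv k (Sum.inl (Sum.inr 0)) (MvPowerSeries.pderiv k (Sum.inl (Sum.inr 1)) f) :=
    pderiv_pderiv_comm _ _
  refine Matrix.ext fun i j => ?_
  rw [opMatrix, Matrix.of_apply, Matrix.mul_apply]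
  simp only [Fin.sum_univ_succ, jetMatrix, Matrix.of_apply, jet, ambSymbol, symbolMatrix]
  fin_cases i
  · simp
  · simp [flow_apply, diag_right, sub_eq_add_neg]
  · simp [flow_apply, diag_right, pderiv_right, c1, c2, Derivation.leibniz]
    ring
  · simp [flow_apply, diag_right, pderiv_right, c1, c2, Derivation.leibniz]
    ring

end Chain

/-! ### Normalization of the sections -/

section Normalize

variable {S : Type*} [CommRing S]

/-- The values and first derivatives in a matrix of derivatives. -/
def topBlock (Γ : Matrix (Fin 10) (Fin 3) S) : Matrix (Fin 3) (Fin 3) S :=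
  Γ.submatrix (Fin.castLE (by norm_num)) id

/-- Normalization of the values and first derivatives to the identity matrix. -/
def normalize (Γ : Matrix (Fin 10) (Fin 3) S) : Matrix (Fin 10) (Fin 3) S := Γ * (topBlock Γ)⁻¹

/-- The jet data of a function and of a normalized matrix of derivatives. -/
def normalJet (ξ η fxx fxy fyy fxxx fxxy fxyy fyyy : S) (G : Matrix (Fin 10) (Fin 3) S) :
    JetData S where
  ξ := ξ
  η := η
  fxx := fxx
  fxy := fxy
  fyy := fyy
  fxxx := fxxx
  fxxy := fxxy
  fxyy := fxyy
  fyyy := fyyy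
  a20 := G 3 1
  a11 := G 4 1
  a02 := G 5 1
  a30 := G 6 1
  a21 := G 7 1
  a12 := G 8 1
  a03 := G 9 1
  c20 := G 3 2
  c11 := G 4 2
  c02 := G 5 2
  c30 := G 6 2
  c21 := G 7 2
  c12 := G 8 2
  c03 := G 9 2

theorem coeffs_normalJet (ξ η fxx fxy fyy fxxx fxxy fxyy fyyy : S) {G : Matrix (Fin 10) (Fin 3) S}
    (hG : topBlock G = 1) :
    (normalJet ξ η fxx fxy fyy fxxx fxxy fxyy fyyy G).coeffs (fun i => G i 0) = G := by
  have htop : ∀ i j : Fin 3, (1 : Matrix (Fin 3) (Fin 3) S) i j = G (Fin.castLE (by norm_num) i) j :=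
    fun i j => by rw [← hG]; rfl
  refine Matrix.ext fun i j => ?_
  fin_cases i
  · refine Eq.trans ?_ (htop 0 j)
    fin_cases j <;> rfl
  · refine Eq.trans ?_ (htop 1 j)
    fin_cases j <;> rfl
  · refine Eq.trans ?_ (htop 2 j)
    fin_cases j <;> rfl
  all_goals fin_cases j <;> rfl

theorem topBlock_normalize {Γ : Matrix (Fin 10) (Fin 3) S} (hC : IsUnit (topBlock Γ).det) :
    topBlock (normalize Γ) = 1 := Matrix.mul_nonsing_inv _ hC

/-- Normalizing multiplies on the right by an invertible 3 × 3 matrix over the ring, which does not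
change the ideal of maximal minors. -/
theorem minorIdeal_symbolMatrix_mul {ξ η fxx fxy fyy fxxx fxxy fxyy fyyy : S}
    {Γ : Matrix (Fin 10) (Fin 3) S} (hC : IsUnit (topBlock Γ).det)
    (h1 : IsUnit (normalJet ξ η fxx fxy fyy fxxx fxxy fxyy fyyy (normalize Γ)).L21)
    (h2 : IsUnit (normalJet ξ η fxx fxy fyy fxxx fxxy fxyy fyyy (normalize Γ)).b2) :
    minorIdeal (symbolMatrix ξ η fxx fxy fyy fxxx fxxy fxyy fyyy * Γ) =
      (normalJet ξ η fxx fxy fyy fxxx fxxy fxyy fyyy (normalize Γ)).normalIdeal := by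
  rw [← JetData.minorIdeal_symbol_mul_coeffs _ (fun i => normalize Γ i 0) h1 h2,
    coeffs_normalJet _ _ _ _ _ _ _ _ _ (topBlock_normalize hC), normalize, ← Matrix.mul_assoc,
    minorIdeal_mul_of_isUnit _ (Matrix.isUnit_nonsing_inv_det _ hC)]
  rfl

theorem map_normalize {T : Type*} [CommRing T] (φ : S →+* T)
    {Γ : Matrix (Fin 10) (Fin 3) S} (hC : IsUnit (topBlock Γ).det) (i j) :
    φ (normalize Γ i j) = normalize (Γ.map φ) i j := by
  have h1 : (topBlock Γ)⁻¹.map φ = (topBlock (Γ.map φ))⁻¹ := by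
    symm
    apply Matrix.inv_eq_left_inv
    rw [show topBlock (Γ.map φ) = (topBlock Γ).map φ from rfl, ← Matrix.map_mul,
      Matrix.nonsing_inv_mul _ hC, Matrix.map_one _ (map_zero φ) (map_one φ)]
  rw [normalize, normalize, ← h1, ← Matrix.map_mul, Matrix.map_apply]

end Normalize

/-! ### Regular sequences -/

section Rotate

variable {S : Type*} [CommRing S]

/-- Moves the first element of a regular sequence to the end. With a the deformation parameter, this
converts facts about the special fibre into flatness. -/
theorem RegMod.rotate [IsNoetherianRing S] [IsLocalRing S] {K : Ideal S} {a b c : S}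
    (ha : RegMod K a) (hb : RegMod (K ⊔ Ideal.span {a}) b)
    (hc : RegMod (K ⊔ Ideal.span {a} ⊔ Ideal.span {b}) c)
    (ham : a ∈ IsLocalRing.maximalIdeal S) :
    RegMod K b ∧ RegMod (K ⊔ Ideal.span {b}) c ∧
      RegMod (K ⊔ Ideal.span {b} ⊔ Ideal.span {c}) a := by
  have h1 := ha.swap hb ham
  rw [sup_right_comm] at hc
  have h2 := h1.2.swap hc ham
  exact ⟨h1.1, h2.1, h2.2⟩

theorem RegMod.congr {K : Ideal S} {a b u : S} (ha : RegMod K a) (hu : IsUnit u)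
    (h : b - u * a ∈ K) : RegMod K b := by
  intro r hr
  refine ha r ((Ideal.unit_mul_mem_iff_mem K hu).1 ?_)
  rw [show u * (a * r) = b * r - (b - u * a) * r by ring]
  exact sub_mem hr (Ideal.mul_mem_right _ _ h)

theorem RegMod.map_mk {I J : Ideal S} {a : S} (h : RegMod (J ⊔ I) a) :
    RegMod (J.map (Ideal.Quotient.mk I)) (Ideal.Quotient.mk I a) := by
  intro r hr
  obtain ⟨r, rfl⟩ := Ideal.Quotient.mk_surjective r
  rw [← map_mul, Ideal.mem_quotient_iff_mem_sup] at hr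
  rw [Ideal.mem_quotient_iff_mem_sup]
  exact h r hr

end Rotate

/-! ### Families of plane curves -/

section Family

variable {k : Type*} [Field k] {r : ℕ}

/-- The family `f + ∑ t_j g_j`. -/
def family (f : Plane k) (g : Fin r → Plane k) : Amb k r :=
  ofPlane k r f + ∑ j, MvPowerSeries.X (Sum.inr j) * ofPlane k r (g j)

theorem pderiv_family (f : Plane k) (g : Fin r → Plane k) (i : Fin 2) :
    MvPowerSeries.pderiv k (Sum.inl i) (family f g) =
      family (MvPowerSeries.pderiv k i f) fun j => MvPowerSeries.pderiv k i (g j) := by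
  have h1 : ∀ p : Plane k, MvPowerSeries.pderiv k (Sum.inl i) (ofPlane k r p) =
      ofPlane k r (MvPowerSeries.pderiv k i p) := fun p =>
    pderiv_rename_embedding ⟨Sum.inl, Sum.inl_injective⟩ i p
  have h2 : ∀ j : Fin r, MvPowerSeries.pderiv k (Sum.inl i)
      (MvPowerSeries.X (Sum.inr j) : Amb k r) = 0 := fun j =>
    MvPowerSeries.pderiv_X_of_ne (by simp)
  simp only [family, map_add, map_sum, Derivation.leibniz, h1, h2, smul_eq_mul, mul_zero, add_zero]

theorem constantCoeff_rename {σ τ : Type*} [Finite σ] (e : σ → τ) (h : MvPowerSeries σ k) :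
    MvPowerSeries.constantCoeff (MvPowerSeries.rename e h) = MvPowerSeries.constantCoeff h := by
  have h1 : h - MvPowerSeries.C (MvPowerSeries.constantCoeff h) ∈
      Ideal.span (Set.range (MvPowerSeries.X : σ → MvPowerSeries σ k)) := by
    rw [← maximalIdeal_eq_span_X, mem_maximalIdeal_iff]; simp
  have h2 : Ideal.span (Set.range (MvPowerSeries.X : σ → MvPowerSeries σ k)) ≤
      RingHom.ker (MvPowerSeries.constantCoeff.comp
        (MvPowerSeries.rename (R := k) e).toRingHom) := by
    rw [Ideal.span_le]
    rintro _ ⟨i, rfl⟩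
    simp [RingHom.mem_ker]
  have h3 := h2 h1
  rw [RingHom.mem_ker, map_sub, sub_eq_zero] at h3
  refine h3.trans ?_
  have hC : (MvPowerSeries.C (MvPowerSeries.constantCoeff h) : MvPowerSeries σ k) =
    algebraMap k _ (MvPowerSeries.constantCoeff h) := rfl
  rw [hC]
  change MvPowerSeries.constantCoeff (MvPowerSeries.rename e (algebraMap k _ _)) = _
  rw [AlgHom.commutes]
  rfl

theorem constantCoeff_ofPlane (p : Plane k) :
    MvPowerSeries.constantCoeff (ofPlane k r p) = MvPowerSeries.constantCoeff p :=
  constantCoeff_rename _ _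

theorem constantCoeff_family (f : Plane k) (g : Fin r → Plane k) :
    MvPowerSeries.constantCoeff (family f g) = MvPowerSeries.constantCoeff f := by
  simp [family, constantCoeff_ofPlane]

theorem mk_family {F : Amb k r} {E : Ideal (Total F)}
    (ht : ∀ j, Ideal.Quotient.mk (Ideal.span {F}) (MvPowerSeries.X (Sum.inr j)) ∈ E)
    (f : Plane k) (g : Fin r → Plane k) :
    Ideal.Quotient.mk (Ideal.span {F}) (family f g) -
      Ideal.Quotient.mk (Ideal.span {F}) (ofPlane k r f) ∈ E := by
  rw [family, map_add, add_sub_cancel_left, map_sum]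
  refine Ideal.sum_mem _ fun j _ => ?_
  rw [map_mul]
  exact Ideal.mul_mem_right _ _ (ht j)

section Total

variable {F : Amb k r}

theorem isLocalRing_total (hF : MvPowerSeries.constantCoeff F = 0) : IsLocalRing (Total F) := by
  have : Nontrivial (Total F) := Ideal.Quotient.nontrivial_iff.2 fun h => by
    have h1 : (1 : Amb k r) ∈ Ideal.span {F} := h ▸ Submodule.mem_top
    obtain ⟨a, ha⟩ := Ideal.mem_span_singleton'.1 h1
    have := congrArg MvPowerSeries.constantCoeff ha
    simp [hF] at this
  exact IsLocalRing.of_surjective' (Ideal.Quotient.mk _) Ideal.Quotient.mk_surjective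

/-- The value at the closed point. -/
def evTotal (hF : MvPowerSeries.constantCoeff F = 0) : Total F →ₐ[k] k :=
  Ideal.Quotient.liftₐ _ ({ (MvPowerSeries.constantCoeff : Amb k r →+* k) with
    commutes' := fun _ => MvPowerSeries.constantCoeff_C _ } : Amb k r →ₐ[k] k) (by
    intro a ha
    obtain ⟨b, rfl⟩ := Ideal.mem_span_singleton'.1 ha
    change MvPowerSeries.constantCoeff (b * F) = 0
    rw [map_mul, hF, mul_zero])

theorem evTotal_mk (hF : MvPowerSeries.constantCoeff F = 0) (a : Amb k r) :
    evTotal hF (Ideal.Quotient.mk _ a) = MvPowerSeries.constantCoeff a := rfl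

theorem mk_mem_maximalIdeal_iff [IsLocalRing (Total F)] (hF : MvPowerSeries.constantCoeff F = 0)
    (a : Total F) : a ∈ IsLocalRing.maximalIdeal (Total F) ↔ evTotal hF a = 0 := by
  obtain ⟨a, rfl⟩ := Ideal.Quotient.mk_surjective a
  rw [evTotal_mk, IsLocalRing.mem_maximalIdeal, mem_nonunits_iff]
  constructor
  · intro h
    by_contra h1
    exact h ((MvPowerSeries.isUnit_iff_constantCoeff.2 (isUnit_iff_ne_zero.2 h1)).map _)
  · intro h h1
    have := h1.map (evTotal hF)
    rw [evTotal_mk, h] at this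
    exact not_isUnit_zero this

/-- F is a unit times t modulo K + (x, y), so F replaces t in the regular sequence x, y, t modulo K.
Moving F to the front leaves x, y as regular parameters modulo K on F = 0. -/
theorem isGerm_total [IsLocalRing (Total F)] (hF : MvPowerSeries.constantCoeff F = 0)
    {K : Ideal (Amb k r)} {x y t G : Amb k r}
    (hx : RegMod K x) (hy : RegMod (K ⊔ Ideal.span {x}) y)
    (ht : RegMod (K ⊔ Ideal.span {x} ⊔ Ideal.span {y}) t)
    (hm : K ⊔ Ideal.span {x} ⊔ Ideal.span {y} ⊔ Ideal.span {t} =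
      IsLocalRing.maximalIdeal (Amb k r))
    (hG : IsUnit G) (hFt : F - G * t ∈ K ⊔ Ideal.span {x} ⊔ Ideal.span {y}) :
    RegMod K F ∧ IsGerm (evTotal hF) (K.map (Ideal.Quotient.mk (Ideal.span {F})))
      (Ideal.Quotient.mk _ x) (Ideal.Quotient.mk _ y) := by
  have hFm : F ∈ IsLocalRing.maximalIdeal (Amb k r) := (mem_maximalIdeal_iff _).2 hF
  have hxm : x ∈ IsLocalRing.maximalIdeal (Amb k r) := by
    rw [← hm]; exact Ideal.mem_sup_left (Ideal.mem_sup_left (self_mem_sup_span _ _))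
  have hym : y ∈ IsLocalRing.maximalIdeal (Amb k r) := by
    rw [← hm]; exact Ideal.mem_sup_left (self_mem_sup_span _ _)
  have h1 := hy.swap (ht.congr hG hFt) hym
  have h2 := hx.swap h1.1 hxm
  have h3 := h1.2
  rw [sup_right_comm] at h3
  have hmF : K ⊔ Ideal.span {x} ⊔ Ideal.span {y} ⊔ Ideal.span {F} =
      IsLocalRing.maximalIdeal (Amb k r) := by
    rw [← hm]
    apply le_antisymm <;> refine sup_le le_sup_left ?_ <;> rw [Ideal.span_singleton_le_iff_mem]
    · rw [← sub_add_cancel F (G * t)]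
      exact add_mem (Ideal.mem_sup_left hFt) (Ideal.mem_sup_right (Ideal.mul_mem_left _ _
        (Ideal.mem_span_singleton_self t)))
    · obtain ⟨v, hv⟩ := hG.exists_right_inv
      rw [show t = F * v - v * (F - G * t) by linear_combination (-t) * hv]
      exact sub_mem (mul_mem_sup_span _ _ _) (Ideal.mem_sup_left (Ideal.mul_mem_left _ _ hFt))
  refine ⟨h2.1, fun a => mk_mem_maximalIdeal_iff hF a, ?_, h2.2.map_mk, ?_⟩
  · rw [← Set.image_singleton, ← Set.image_singleton (f := Ideal.Quotient.mk (Ideal.span {F})),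
      ← Ideal.map_span, ← Ideal.map_span, ← Ideal.map_sup, ← Ideal.map_sup]
    ext a
    obtain ⟨a, rfl⟩ := Ideal.Quotient.mk_surjective a
    rw [Ideal.mem_quotient_iff_mem_sup, hmF, mk_mem_maximalIdeal_iff hF, evTotal_mk,
      mem_maximalIdeal_iff]
  · rw [← Set.image_singleton, ← Ideal.map_span, ← Ideal.map_sup]
    apply RegMod.map_mk
    rwa [sup_right_comm]

end Total

/-- The equation `y² - x^s`. -/
abbrev curve (k : Type*) [Field k] (s : ℕ) : Plane k := MvPowerSeries.X 1 ^ 2 - MvPowerSeries.X 0 ^ s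

theorem ofPlane_X (i : Fin 2) :
    ofPlane k r (MvPowerSeries.X i) = MvPowerSeries.X (Sum.inl i) := by
  simp [ofPlane, MvPowerSeries.rename_X]

theorem constantCoeff_curve {s : ℕ} (hs : 2 ≤ s) : MvPowerSeries.constantCoeff (curve k s) = 0 := by
  simp [curve, show s ≠ 0 by omega]

/-- The coordinates `x` (for `i = 0`) and `y` (for `i = 1`) on the total space. -/
abbrev coord (F : Amb k r) (i : Fin 2) : Total F := Ideal.Quotient.mk _ (MvPowerSeries.X (Sum.inl i))

/-- The parameters on the total space. -/
abbrev param (F : Amb k r) (j : Fin r) : Total F := Ideal.Quotient.mk _ (MvPowerSeries.X (Sum.inr j))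

/-- A direction with nonzero constant term makes the total space smooth, with t eliminated in favour
of x, y. -/
theorem isGerm_one {s : ℕ} (hs : 2 ≤ s) {g : Fin 1 → Plane k}
    (hg : MvPowerSeries.constantCoeff (g 0) ≠ 0) (hF : MvPowerSeries.constantCoeff (family (curve k s) g) = 0)
    [IsLocalRing (Total (family (curve k s) g))] :
    IsGerm (evTotal hF) ⊥ (coord (family (curve k s) g) 0) (coord (family (curve k s) g) 1) := by
  have h1 := regMod_span_X (k := k) (∅ : Finset (Fin 2 ⊕ Fin 1)) (j := Sum.inl 0) (by simp)
  have h2 := regMod_span_X (k := k) ({Sum.inl 0} : Finset (Fin 2 ⊕ Fin 1)) (j := Sum.inl 1) (by simp)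
  have h3 := regMod_span_X (k := k) ({Sum.inl 0, Sum.inl 1} : Finset (Fin 2 ⊕ Fin 1))
    (j := Sum.inr 0) (by simp)
  simp only [Finset.coe_empty, Set.image_empty, Ideal.span_empty] at h1
  simp only [Finset.coe_singleton, Set.image_singleton] at h2
  simp only [Finset.coe_insert, Finset.coe_singleton, Set.image_pair, Ideal.span_insert] at h3
  have h4 := isGerm_total hF (K := ⊥) (x := MvPowerSeries.X (Sum.inl 0))
    (y := MvPowerSeries.X (Sum.inl 1)) (t := MvPowerSeries.X (Sum.inr 0)) (G := ofPlane k 1 (g 0))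
    h1 (by rwa [bot_sup_eq]) (by rwa [bot_sup_eq]) ?_ ?_ ?_
  · rw [Ideal.map_bot] at h4
    exact h4.2
  · rw [bot_sup_eq, maximalIdeal_eq_span_X]
    apply le_antisymm
    · refine sup_le (sup_le ?_ ?_) ?_ <;> rw [Ideal.span_singleton_le_iff_mem] <;>
        exact Ideal.subset_span ⟨_, rfl⟩
    · rw [Ideal.span_le]
      rintro _ ⟨(i | i), rfl⟩ <;> fin_cases i
      · exact Ideal.mem_sup_left (Ideal.mem_sup_left (Ideal.mem_span_singleton_self _))
      · exact Ideal.mem_sup_left (self_mem_sup_span _ _)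
      · exact self_mem_sup_span _ _
  · rw [MvPowerSeries.isUnit_iff_constantCoeff, constantCoeff_ofPlane, isUnit_iff_ne_zero]
    exact hg
  · rw [family]
    simp only [Finset.univ_unique, Fin.default_eq_zero, Finset.sum_singleton, map_sub, map_pow,
      ofPlane_X]
    rw [mem_sup_span_pair]
    refine ⟨0, zero_mem _, -MvPowerSeries.X (Sum.inl 0) ^ (s - 1), MvPowerSeries.X (Sum.inl 1), ?_⟩
    obtain ⟨s, rfl⟩ := Nat.exists_eq_add_of_le' (show 1 ≤ s by omega)
    simp only [Nat.add_sub_cancel]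
    ring

/-- Here t₁ is eliminated and K = (t₀): the germ is read modulo t₀, while t₀ stays regular on the
total space. -/
theorem isGerm_two {s : ℕ} (hs : 2 ≤ s) {g : Fin 2 → Plane k}
    (hg : MvPowerSeries.constantCoeff (g 1) ≠ 0) (hF : MvPowerSeries.constantCoeff (family (curve k s) g) = 0)
    [IsLocalRing (Total (family (curve k s) g))] :
    RegMod ⊥ (param (family (curve k s) g) 0) ∧
    IsGerm (evTotal hF) (Ideal.span {param (family (curve k s) g) 0})
      (coord (family (curve k s) g) 0) (coord (family (curve k s) g) 1) := by
  have h0 := regMod_span_X (k := k) (∅ : Finset (Fin 2 ⊕ Fin 2)) (j := Sum.inr 0) (by simp)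
  have h1 := regMod_span_X (k := k) ({Sum.inr 0} : Finset (Fin 2 ⊕ Fin 2)) (j := Sum.inl 0) (by simp)
  have h2 := regMod_span_X (k := k) ({Sum.inr 0, Sum.inl 0} : Finset (Fin 2 ⊕ Fin 2))
    (j := Sum.inl 1) (by simp)
  have h3 := regMod_span_X (k := k) ({Sum.inr 0, Sum.inl 0, Sum.inl 1} : Finset (Fin 2 ⊕ Fin 2))
    (j := Sum.inr 1) (by simp)
  simp only [Finset.coe_empty, Set.image_empty, Ideal.span_empty] at h0
  simp only [Finset.coe_singleton, Set.image_singleton] at h1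
  simp only [Finset.coe_insert, Finset.coe_singleton, Set.image_pair, Ideal.span_insert] at h2
  simp only [Finset.coe_insert, Finset.coe_singleton, Set.image_insert_eq, Set.image_singleton,
    Ideal.span_insert, ← sup_assoc] at h3
  have h4 := isGerm_total hF (K := Ideal.span {MvPowerSeries.X (Sum.inr 0)})
    (x := MvPowerSeries.X (Sum.inl 0))
    (y := MvPowerSeries.X (Sum.inl 1)) (t := MvPowerSeries.X (Sum.inr 1)) (G := ofPlane k 2 (g 1))
    h1 h2 h3 ?_ ?_ ?_
  · rw [Ideal.map_span, Set.image_singleton] at h4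
    refine ⟨?_, h4.2⟩
    have h5 := (h0.swap (by rw [bot_sup_eq]; exact h4.1) ((mem_maximalIdeal_iff _).2 (by simp))).2
    rw [← Ideal.map_bot (f := Ideal.Quotient.mk (Ideal.span {family (curve k s) g}))]
    exact RegMod.map_mk h5
  · rw [maximalIdeal_eq_span_X]
    apply le_antisymm
    · refine sup_le (sup_le (sup_le ?_ ?_) ?_) ?_ <;> rw [Ideal.span_singleton_le_iff_mem] <;>
        exact Ideal.subset_span ⟨_, rfl⟩
    · rw [Ideal.span_le]
      rintro _ ⟨(i | i), rfl⟩ <;> fin_cases i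
      · exact Ideal.mem_sup_left (Ideal.mem_sup_left (self_mem_sup_span _ _))
      · exact Ideal.mem_sup_left (self_mem_sup_span _ _)
      · exact Ideal.mem_sup_left (Ideal.mem_sup_left (Ideal.mem_sup_left
          (Ideal.mem_span_singleton_self _)))
      · exact self_mem_sup_span _ _
  · rw [MvPowerSeries.isUnit_iff_constantCoeff, constantCoeff_ofPlane, isUnit_iff_ne_zero]
    exact hg
  · rw [family]
    simp only [Fin.sum_univ_two, map_sub, map_pow, ofPlane_X]
    rw [mem_sup_span_pair]
    refine ⟨MvPowerSeries.X (Sum.inr 0) * ofPlane k 2 (g 0),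
      Ideal.mul_mem_right _ _ (Ideal.mem_span_singleton_self _),
      -MvPowerSeries.X (Sum.inl 0) ^ (s - 1), MvPowerSeries.X (Sum.inl 1), ?_⟩
    obtain ⟨s, rfl⟩ := Nat.exists_eq_add_of_le' (show 1 ≤ s by omega)
    simp only [Nat.add_sub_cancel]
    ring

theorem mk_family_self_eq_zero {s : ℕ} (g : Fin r → Plane k) :
    coord (family (curve k s) g) 1 ^ 2 - coord (family (curve k s) g) 0 ^ s +
      ∑ j, param (family (curve k s) g) j * Ideal.Quotient.mk _ (ofPlane k r (g j)) = 0 := by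
  have h : Ideal.Quotient.mk (Ideal.span {family (curve k s) g}) (family (curve k s) g) = 0 :=
    Ideal.Quotient.eq_zero_iff_mem.2 (Ideal.mem_span_singleton_self _)
  conv at h => lhs; arg 2; rw [family]
  simpa only [map_add, map_sub, map_pow, map_sum, map_mul, ofPlane_X] using h

/-- On F = 0 one has t_j g_j = x^s - y² minus terms in K, and g_j is a unit. -/
theorem param_mem_errIdeal {s : ℕ} {g : Fin r → Plane k} {K : Ideal (Total (family (curve k s) g))}
    (j : Fin r) (hg : MvPowerSeries.constantCoeff (g j) ≠ 0)
    (hK : ∀ i ≠ j, param (family (curve k s) g) i ∈ K) (i : Fin r) :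
    param (family (curve k s) g) i ∈ errIdeal K (coord (family (curve k s) g) 0)
      (coord (family (curve k s) g) 1) s := by
  have hKE : ∀ i ≠ j, param (family (curve k s) g) i ∈ errIdeal K (coord (family (curve k s) g) 0)
      (coord (family (curve k s) g) 1) s := fun i hi =>
    Ideal.mem_sup_left (Ideal.mem_sup_left (hK i hi))
  by_cases hij : i = j
  · subst hij
    have h := mk_family_self_eq_zero (s := s) g
    rw [← Finset.add_sum_erase _ _ (Finset.mem_univ i)] at h
    have hu : IsUnit (Ideal.Quotient.mk (Ideal.span {family (curve k s) g}) (ofPlane k r (g i))) := by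
      refine IsUnit.map _ ?_
      rw [MvPowerSeries.isUnit_iff_constantCoeff, constantCoeff_ofPlane, isUnit_iff_ne_zero]
      exact hg
    rw [← Ideal.mul_unit_mem_iff_mem _ hu,
      show param (family (curve k s) g) i * Ideal.Quotient.mk _ (ofPlane k r (g i)) =
      coord (family (curve k s) g) 0 ^ s - coord (family (curve k s) g) 1 ^ 2 -
        ∑ j ∈ Finset.univ.erase i, param (family (curve k s) g) j *
          Ideal.Quotient.mk _ (ofPlane k r (g j)) by linear_combination h]
    refine sub_mem (sub_mem (self_mem_sup_span _ _) (Ideal.mem_sup_left (self_mem_sup_span _ _)))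
      (Ideal.sum_mem _ fun l hl => Ideal.mul_mem_right _ _ (hKE l (Finset.ne_of_mem_erase hl)))
  · exact hKE i hij

end Family

/-! ### Jets of the equation and of the sections on the total space -/

section GermJet

variable {k : Type*} [Field k] {r : ℕ}

/-- The jet data of the function `F` and of normalized sections on the total space of the family
`F = 0`. -/
def germJet (F : Amb k r) (h : Fin 3 → Dbl k r) : JetData (Total F) :=
  let x := MvPowerSeries.pderiv k (Sum.inl 0 : Fin 2 ⊕ Fin r)
  let y := MvPowerSeries.pderiv k (Sum.inl 1 : Fin 2 ⊕ Fin r)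
  let q := Ideal.Quotient.mk (Ideal.span {F})
  normalJet (q (y F)) (q (-x F)) (q (x (x F))) (q (x (y F))) (q (y (y F))) (q (x (x (x F))))
    (q (x (x (y F)))) (q (x (y (y F)))) (q (y (y (y F))))
    (normalize ((jetMatrix h).map (Ideal.Quotient.mk (Ideal.span {F}))))

/-- The parameters lie in the error ideal, so each derivative of F agrees there with the same
derivative of y² - x^s. -/
theorem hasShape_germJet {s : ℕ} (hs : 2 ≤ s) (g : Fin r → Plane k) (h : Fin 3 → Dbl k r)
    {K : Ideal (Total (family (curve k s) g))}
    (ht : ∀ j, param (family (curve k s) g) j ∈ errIdeal K (coord (family (curve k s) g) 0)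
      (coord (family (curve k s) g) 1) s) :
    HasShape K (coord (family (curve k s) g) 0) (coord (family (curve k s) g) 1) s
      (germJet (family (curve k s) g) h) := by
  have hx : MvPowerSeries.pderiv k 0 (curve k s) = -((s : Plane k) * MvPowerSeries.X 0 ^ (s - 1)) := by
    simp [curve, Derivation.leibniz_pow, MvPowerSeries.pderiv_X_self,
      MvPowerSeries.pderiv_X_of_ne (R := k) (i := (0 : Fin 2)) (j := 1)]
  have hy : MvPowerSeries.pderiv k 1 (curve k s) = 2 * MvPowerSeries.X 1 := by
    simp [curve, Derivation.leibniz_pow, MvPowerSeries.pderiv_X_self,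
      MvPowerSeries.pderiv_X_of_ne (R := k) (i := (1 : Fin 2)) (j := 0)]
  have hxx : MvPowerSeries.pderiv k 0 (MvPowerSeries.pderiv k 0 (curve k s)) =
      -((s : Plane k) * ((s : Plane k) - 1) * MvPowerSeries.X 0 ^ (s - 2)) := by
    rw [hx]
    simp [Derivation.leibniz, Derivation.leibniz_pow, MvPowerSeries.pderiv_X_self,
      show s - 1 - 1 = s - 2 by omega, Nat.cast_sub (show 1 ≤ s by omega)]
    ring
  have hxxx : MvPowerSeries.pderiv k 0 (MvPowerSeries.pderiv k 0
      (MvPowerSeries.pderiv k 0 (curve k s))) =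
      -((s : Plane k) * ((s : Plane k) - 1) * ((s : Plane k) - 2) * MvPowerSeries.X 0 ^ (s - 3)) := by
    rw [hxx]
    simp [Derivation.leibniz, Derivation.leibniz_pow, MvPowerSeries.pderiv_X_self,
      show s - 2 - 1 = s - 3 by omega, Nat.cast_sub hs]
    ring
  have hd2 : ∀ i : Fin 2, MvPowerSeries.pderiv k i 2 = 0 := fun i => Derivation.map_natCast _ 2
  have h2 : Ideal.Quotient.mk (Ideal.span {family (curve k s) g}) (ofPlane k r 2) = 2 := by
    rw [map_ofNat (ofPlane k r) 2]; exact map_ofNat _ 2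
  have hyy : MvPowerSeries.pderiv k 1 (MvPowerSeries.pderiv k 1 (curve k s)) = 2 := by
    rw [hy]
    simp [Derivation.leibniz, MvPowerSeries.pderiv_X_self, hd2]
  have hxy : MvPowerSeries.pderiv k 0 (MvPowerSeries.pderiv k 1 (curve k s)) = 0 := by
    rw [hy]
    simp [Derivation.leibniz, MvPowerSeries.pderiv_X_of_ne (R := k) (i := (0 : Fin 2)) (j := 1), hd2]
  constructor
  · have h1 := mk_family ht (MvPowerSeries.pderiv k 1 (curve k s))
      fun j => MvPowerSeries.pderiv k 1 (g j)
    rw [hy] at h1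
    simpa [germJet, normalJet, pderiv_family, hy, ofPlane_X, h2] using h1
  · have h1 := neg_mem (mk_family ht (MvPowerSeries.pderiv k 0 (curve k s))
      fun j => MvPowerSeries.pderiv k 0 (g j))
    rw [hx] at h1
    simp only [germJet, normalJet, pderiv_family, hx]
    convert! h1 using 1
    simp [ofPlane_X]
    ring
  · have h1 := mk_family ht (MvPowerSeries.pderiv k 0 (MvPowerSeries.pderiv k 0 (curve k s)))
      fun j => MvPowerSeries.pderiv k 0 (MvPowerSeries.pderiv k 0 (g j))
    rw [hxx] at h1
    simp only [germJet, normalJet, pderiv_family, hxx]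
    convert! h1 using 1
    simp [ofPlane_X]
  · have h1 := mk_family ht (MvPowerSeries.pderiv k 0 (MvPowerSeries.pderiv k 1 (curve k s)))
      fun j => MvPowerSeries.pderiv k 0 (MvPowerSeries.pderiv k 1 (g j))
    rw [hxy] at h1
    simp only [germJet, normalJet, pderiv_family, hxy]
    simpa using h1
  · have h1 := mk_family ht (MvPowerSeries.pderiv k 1 (MvPowerSeries.pderiv k 1 (curve k s)))
      fun j => MvPowerSeries.pderiv k 1 (MvPowerSeries.pderiv k 1 (g j))
    rw [hyy] at h1
    simp only [germJet, normalJet, pderiv_family, hyy]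
    simpa [h2] using h1
  · have h1 := mk_family ht (MvPowerSeries.pderiv k 0 (MvPowerSeries.pderiv k 0
      (MvPowerSeries.pderiv k 0 (curve k s))))
      fun j => MvPowerSeries.pderiv k 0 (MvPowerSeries.pderiv k 0 (MvPowerSeries.pderiv k 0 (g j)))
    rw [hxxx] at h1
    simp only [germJet, normalJet, pderiv_family, hxxx]
    convert! h1 using 1
    simp [ofPlane_X, h2]
  · have h1 := mk_family ht (MvPowerSeries.pderiv k 0 (MvPowerSeries.pderiv k 0
      (MvPowerSeries.pderiv k 1 (curve k s))))
      fun j => MvPowerSeries.pderiv k 0 (MvPowerSeries.pderiv k 0 (MvPowerSeries.pderiv k 1 (g j)))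
    rw [hxy, map_zero] at h1
    simp only [germJet, normalJet, pderiv_family, hxy, map_zero]
    simpa using h1
  · have hxyy : MvPowerSeries.pderiv k 0 (MvPowerSeries.pderiv k 1
      (MvPowerSeries.pderiv k 1 (curve k s))) = 0 := by
      rw [hyy, hd2]
    have h1 := mk_family ht (MvPowerSeries.pderiv k 0 (MvPowerSeries.pderiv k 1
      (MvPowerSeries.pderiv k 1 (curve k s))))
      fun j => MvPowerSeries.pderiv k 0 (MvPowerSeries.pderiv k 1 (MvPowerSeries.pderiv k 1 (g j)))
    rw [hxyy] at h1
    simp only [germJet, normalJet, pderiv_family, hxyy]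
    simpa using h1
  · have hyyy : MvPowerSeries.pderiv k 1 (MvPowerSeries.pderiv k 1
      (MvPowerSeries.pderiv k 1 (curve k s))) = 0 := by
      rw [hyy, hd2]
    have h1 := mk_family ht (MvPowerSeries.pderiv k 1 (MvPowerSeries.pderiv k 1
      (MvPowerSeries.pderiv k 1 (curve k s))))
      fun j => MvPowerSeries.pderiv k 1 (MvPowerSeries.pderiv k 1 (MvPowerSeries.pderiv k 1 (g j)))
    rw [hyyy] at h1
    simp only [germJet, normalJet, pderiv_family, hyyy]
    simpa using h1

/-! ### Genericity of the sections -/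

/-- The values at the origin of the partial derivatives of three functions. -/
def constJet (h : Fin 3 → Dbl k r) : Matrix (Fin 10) (Fin 3) k :=
  Matrix.of fun i j => MvPowerSeries.constantCoeff (jet (h j) i)

theorem map_jetMatrix {F : Amb k r} (hF : MvPowerSeries.constantCoeff F = 0)
    (h : Fin 3 → Dbl k r) :
    ((jetMatrix h).map (Ideal.Quotient.mk (Ideal.span {F}))).map (evTotal hF : Total F →+* k) =
      constJet h := by
  ext i j
  exact constantCoeff_rename _ _

section Numerators

variable {A : Type*} [CommRing A]

/-- The normalized derivatives, multiplied by the determinant of the top block. -/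
def numerator (Γ : Matrix (Fin 10) (Fin 3) A) : Matrix (Fin 10) (Fin 3) A :=
  Γ * (topBlock Γ).adjugate

/-- A polynomial in the derivatives of three functions whose non-vanishing expresses that the
functions are general. -/
def genericity (Γ : Matrix (Fin 10) (Fin 3) A) : A :=
  let Δ := (topBlock Γ).det
  let n := numerator Γ
  let p := 2 * n 4 2 - n 5 1 - n 3 1
  let q := n 3 2 + n 5 2 - 2 * n 4 1
  -- The factors are, up to powers of Δ, the numerators of conditions used later: c20 ≠ 0; ρ ≠ 0 and
  -- δ ≠ 0 at s = 4; b2 ≠ 0 at s = 2; and e ≠ 0 at s = 2, where b = p / q at the closed point.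
  Δ * n 3 2 * (3 * n 3 2 ^ 2 - 8 * Δ ^ 2) *
    (n 3 2 ^ 4 - 12 * n 3 2 ^ 2 * Δ ^ 2 + 32 * Δ ^ 4) * q * (p ^ 2 - q ^ 2)

theorem map_genericity {B : Type*} [CommRing B] (φ : A →+* B) (Γ : Matrix (Fin 10) (Fin 3) A) :
    genericity (Γ.map φ) = φ (genericity Γ) := by
  have h1 : (topBlock (Γ.map φ)).det = φ (topBlock Γ).det := by
    rw [show topBlock (Γ.map φ) = (topBlock Γ).map φ from rfl, RingHom.map_det]; rfl
  have h2 : ∀ i j, numerator (Γ.map φ) i j = φ (numerator Γ i j) := by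
    intro i j
    rw [numerator, numerator, show topBlock (Γ.map φ) = φ.mapMatrix (topBlock Γ) from rfl,
      ← RingHom.map_adjugate]
    simp [Matrix.mul_apply]
  simp only [genericity, h1, h2, map_mul, map_sub, map_add, map_pow, map_ofNat]

theorem numerator_eq {Γ : Matrix (Fin 10) (Fin 3) k} (h : (topBlock Γ).det ≠ 0) (i j) :
    numerator Γ i j = (topBlock Γ).det * normalize Γ i j := by
  rw [numerator, normalize, Matrix.inv_def, Matrix.mul_smul, Matrix.smul_apply, smul_eq_mul,
    Ring.inverse_eq_inv', mul_inv_cancel_left₀ h]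

end Numerators

/-- The number `5 (s - 1)` for `s ≤ 3` and `6 (s - 1)` for `s ≥ 4`. -/
def degValue (s : ℕ) : ℕ := 5 * (s - 1) + if s ≤ 3 then 0 else s - 1

/-- The conditions on the second-order parts of normalized sections. -/
structure IsGeneral (a20 a11 a02 c20 c11 c02 : k) : Prop where
  ne_zero : c20 ≠ 0
  rho_ne : 3 * c20 ^ 2 - 8 ≠ 0
  del_ne : c20 ^ 4 - 12 * c20 ^ 2 + 32 ≠ 0
  b2_ne : c20 + c02 - 2 * a11 ≠ 0
  e_ne : (2 * c11 - a02 - a20) ^ 2 - (c20 + c02 - 2 * a11) ^ 2 ≠ 0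

theorem isGeneral_of_genericity {Γ : Matrix (Fin 10) (Fin 3) k} (h : genericity Γ ≠ 0) :
    (topBlock Γ).det ≠ 0 ∧ IsGeneral (normalize Γ 3 1) (normalize Γ 4 1) (normalize Γ 5 1)
      (normalize Γ 3 2) (normalize Γ 4 2) (normalize Γ 5 2) := by
  have hΔ : (topBlock Γ).det ≠ 0 := by
    intro h0; apply h; simp [genericity, h0]
  refine ⟨hΔ, ?_⟩
  simp only [genericity, numerator_eq hΔ] at h
  set Δ := (topBlock Γ).det
  constructor <;> intro h0 <;> apply h
  · rw [h0]; ring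
  · linear_combination (Δ * (Δ * normalize Γ 3 2) * Δ ^ 2 * ((Δ * normalize Γ 3 2) ^ 4 -
      12 * (Δ * normalize Γ 3 2) ^ 2 * Δ ^ 2 + 32 * Δ ^ 4) * (Δ * normalize Γ 3 2 +
      Δ * normalize Γ 5 2 - 2 * (Δ * normalize Γ 4 1)) * ((2 * (Δ * normalize Γ 4 2) -
      Δ * normalize Γ 5 1 - Δ * normalize Γ 3 1) ^ 2 - (Δ * normalize Γ 3 2 +
      Δ * normalize Γ 5 2 - 2 * (Δ * normalize Γ 4 1)) ^ 2)) * h0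
  · linear_combination (Δ * (Δ * normalize Γ 3 2) * (3 * (Δ * normalize Γ 3 2) ^ 2 - 8 * Δ ^ 2) *
      Δ ^ 4 * (Δ * normalize Γ 3 2 +
      Δ * normalize Γ 5 2 - 2 * (Δ * normalize Γ 4 1)) * ((2 * (Δ * normalize Γ 4 2) -
      Δ * normalize Γ 5 1 - Δ * normalize Γ 3 1) ^ 2 - (Δ * normalize Γ 3 2 +
      Δ * normalize Γ 5 2 - 2 * (Δ * normalize Γ 4 1)) ^ 2)) * h0
  · linear_combination (Δ * (Δ * normalize Γ 3 2) * (3 * (Δ * normalize Γ 3 2) ^ 2 - 8 * Δ ^ 2) *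
      ((Δ * normalize Γ 3 2) ^ 4 - 12 * (Δ * normalize Γ 3 2) ^ 2 * Δ ^ 2 + 32 * Δ ^ 4) *
      Δ * ((2 * (Δ * normalize Γ 4 2) -
      Δ * normalize Γ 5 1 - Δ * normalize Γ 3 1) ^ 2 - (Δ * normalize Γ 3 2 +
      Δ * normalize Γ 5 2 - 2 * (Δ * normalize Γ 4 1)) ^ 2)) * h0
  · linear_combination (Δ * (Δ * normalize Γ 3 2) * (3 * (Δ * normalize Γ 3 2) ^ 2 - 8 * Δ ^ 2) *
      ((Δ * normalize Γ 3 2) ^ 4 - 12 * (Δ * normalize Γ 3 2) ^ 2 * Δ ^ 2 + 32 * Δ ^ 4) *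
      (Δ * normalize Γ 3 2 + Δ * normalize Γ 5 2 - 2 * (Δ * normalize Γ 4 1)) * Δ ^ 2) * h0

section Length

variable {S : Type*} [CommRing S] [Algebra k S] [IsLocalRing S] [CharZero k]
  {ev : S →ₐ[k] k} {K : Ideal S} {x y : S} {s : ℕ} {j : JetData S}

theorem IsGerm.isUnit_b2 (h : IsGerm ev K x y) (hj : HasShape K x y s j) (hs : 2 ≤ s)
    (hg : IsGeneral (ev j.a20) (ev j.a11) (ev j.a02) (ev j.c20) (ev j.c11) (ev j.c02)) :
    IsUnit j.b2 := by
  rw [h.isUnit_iff, h.ev_b2 hj hs]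
  rcases hs.eq_or_lt with rfl | hs
  · intro h0
    apply hg.b2_ne
    norm_num at h0
    linear_combination h0 / 6
  · rw [zero_pow (by omega)]
    simpa using hg.ne_zero

/-- At the closed point e = 2 (1 - b²) for s = 2, which the generality condition keeps away from
zero. For s = 3, e = -2 b² with b b2 = 6, so e cannot vanish. -/
theorem IsGerm.isUnit_e (h : IsGerm ev K x y) (hj : HasShape K x y s j) (hs : 2 ≤ s) (hs3 : s ≤ 3)
    (hg : IsGeneral (ev j.a20) (ev j.a11) (ev j.a02) (ev j.c20) (ev j.c11) (ev j.c02)) :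
    IsUnit j.e := by
  have h2 := h.isUnit_b2 hj hs hg
  have h3 : ev j.b = (ev j.b2)⁻¹ * ev j.b1 := by rw [JetData.b, map_mul, ev_inverse h2]
  have h4 : ev j.b2 ≠ 0 := h.isUnit_iff.1 h2
  have h5 : ev j.b * ev j.b2 = ev j.b1 := by rw [h3]; field_simp
  rw [h.isUnit_iff, h.ev_e hj hs]
  intro h0
  rw [h.ev_b1 hj hs, h.ev_b2 hj hs] at h5
  obtain rfl | rfl : s = 2 ∨ s = 3 := by omega
  · norm_num at h0 h5
    apply hg.e_ne
    linear_combination (-(6 * ev j.c20 + 6 * (ev j.c02 - 2 * ev j.a11)) ^ 2 / 72) * h0 -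
      ((2 * ev j.c11 - ev j.a02 - ev j.a20) + ev j.b * (ev j.c20 + ev j.c02 - 2 * ev j.a11)) / 6 * h5
  · norm_num at h0 h5
    rw [h0] at h5
    norm_num at h5

theorem del_ne_zero {γ : k} (hs : 4 ≤ s) (h0 : γ ≠ 0) (h1 : γ ^ 4 - 12 * γ ^ 2 + 32 ≠ 0) :
    del s γ ≠ 0 := by
  rw [del, rho]
  split_ifs with h
  · subst h
    intro h2
    apply h1
    field_simp at h2
    linear_combination h2 / 4
  · rw [sub_zero]
    exact Nat.cast_ne_zero.2 (by omega)

theorem rho_ne_zero {γ : k} (hs : 4 ≤ s) (h0 : γ ≠ 0) (h1 : 3 * γ ^ 2 - 8 ≠ 0) :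
    rho s γ ≠ 0 := by
  rw [rho]
  split_ifs with h
  · subst h
    intro h2
    apply h1
    field_simp at h2
    linear_combination h2 / 4
  · rw [sub_zero]
    have h2 : (s : k) - 1 = ((s - 1 : ℕ) : k) := by rw [Nat.cast_sub (by omega)]; simp
    rw [h2]
    exact mul_ne_zero (Nat.cast_ne_zero.2 (by omega)) (Nat.cast_ne_zero.2 (by omega))

theorem IsGerm.len_normalIdeal_eq [IsNoetherianRing S] (h : IsGerm ev K x y) (hj : HasShape K x y s j) (hs : 2 ≤ s)
    (hg : IsGeneral (ev j.a20) (ev j.a11) (ev j.a02) (ev j.c20) (ev j.c11) (ev j.c02)) :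
    len k (K ⊔ j.normalIdeal) = degValue s := by
  rw [degValue]
  split_ifs with h3
  · rw [h.len_normalIdeal_of_isUnit hj hs (h.isUnit_e hj hs h3 hg), add_zero]
    norm_num
  · have h4 : 4 ≤ s := by omega
    have h5 := h.regMod_e hj h4 hg.ne_zero (del_ne_zero h4 hg.ne_zero hg.del_ne)
    rw [h.len_normalIdeal hj hs h5.2.1, h5.2.2]
    norm_num

end Length

theorem map_symbolMatrix {A B : Type*} [CommRing A] [CommRing B] (φ : A →+* B)
    (ξ η fxx fxy fyy fxxx fxxy fxyy fyyy : A) :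
    (symbolMatrix ξ η fxx fxy fyy fxxx fxxy fxyy fyyy).map φ =
      symbolMatrix (φ ξ) (φ η) (φ fxx) (φ fxy) (φ fyy) (φ fxxx) (φ fxxy) (φ fxyy) (φ fyyy) := by
  have h2 : φ 2 = 2 := map_ofNat φ 2
  have h3 : φ 3 = 3 := map_ofNat φ 3
  refine Matrix.ext fun i j => ?_
  fin_cases i <;> fin_cases j <;> simp [symbolMatrix, h2, h3]

/-- The degeneracy ideal of general sections in normal form. -/
theorem degIdeal_eq_normalIdeal [CharZero k] {s : ℕ} (hs : 2 ≤ s) {F : Amb k r}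
    [IsLocalRing (Total F)] (hF : MvPowerSeries.constantCoeff F = 0)
    {K : Ideal (Total F)} {x y : Total F} (hK : IsGerm (evTotal hF) K x y)
    {h : Fin 3 → Dbl k r} (hj : HasShape K x y s (germJet F h))
    (hh : genericity (constJet h) ≠ 0) (h1 : RegMod ⊥ (germJet F h).ξ)
    (h2 : RegMod (⊥ ⊔ Ideal.span {(germJet F h).ξ}) (germJet F h).η) :
    degIdeal F 4 (fun j => Ideal.Quotient.mk (ppIdeal F 4) (h j)) = (germJet F h).normalIdeal ∧
      IsGeneral (evTotal hF (germJet F h).a20) (evTotal hF (germJet F h).a11)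
        (evTotal hF (germJet F h).a02) (evTotal hF (germJet F h).c20)
        (evTotal hF (germJet F h).c11) (evTotal hF (germJet F h).c02) := by
  obtain ⟨hΔ, hg⟩ := isGeneral_of_genericity hh
  set Γ := (jetMatrix h).map (Ideal.Quotient.mk (Ideal.span {F})) with hΓ
  have hmap : Γ.map (evTotal hF : Total F →+* k) = constJet h := map_jetMatrix hF h
  have hC : IsUnit (topBlock Γ).det := by
    rw [hK.isUnit_iff]
    rw [← hmap, show topBlock (Γ.map (evTotal hF : Total F →+* k)) =
      (topBlock Γ).map (evTotal hF : Total F →+* k) from rfl] at hΔ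
    intro h0
    apply hΔ
    rw [← RingHom.mapMatrix_apply, ← RingHom.map_det]
    exact h0
  have hev : ∀ i j, evTotal hF (normalize Γ i j) = normalize (constJet h) i j := by
    intro i j
    rw [← hmap]
    exact map_normalize (evTotal hF : Total F →+* k) hC i j
  have hg' : IsGeneral (evTotal hF (germJet F h).a20) (evTotal hF (germJet F h).a11)
        (evTotal hF (germJet F h).a02) (evTotal hF (germJet F h).c20)
        (evTotal hF (germJet F h).c11) (evTotal hF (germJet F h).c02) := by
    simpa only [germJet, normalJet, ← hΓ, hev] using hg
  refine ⟨?_, hg'⟩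
  rw [degIdeal_eq_minorIdeal h1 h2, opMatrix_eq, Matrix.map_mul]
  have hsym : (ambSymbol F).map (Ideal.Quotient.mk (Ideal.span {F})) = (germJet F h).symbol := by
    exact map_symbolMatrix _ _ _ _ _ _ _ _ _ _
  rw [hsym]
  exact minorIdeal_symbolMatrix_mul hC (hK.isUnit_L21 hj hs) (hK.isUnit_b2 hj hs hg')

end GermJet

/-! ### Finite colength and semicontinuity -/

section Colength

variable (k : Type*) [Field k] {S : Type*} [CommRing S] [Algebra k S]

theorem len_ne_top_iff {K : Ideal S} : len k K ≠ ⊤ ↔ Module.Finite k (S ⧸ K) := by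
  rw [len, Module.length_ne_top_iff, isFiniteLength_iff_isNoetherian_isArtinian]
  refine ⟨fun h => ?_, fun h => ⟨inferInstance, inferInstance⟩⟩
  have := h.1
  infer_instance

theorem len_map_mk (I J : Ideal S) : len k (J.map (Ideal.Quotient.mk I)) = len k (I ⊔ J) :=
  (DoubleQuot.quotQuotEquivQuotSupₐ k I J).toLinearEquiv.length_eq

theorem len_add_one_le {K L : Ideal S} (h : K < L) : len k L + 1 ≤ len k K := by
  obtain ⟨z, hz, hz'⟩ := SetLike.exists_of_lt h
  let C : Ideal S :=
    { carrier := {r | z * r ∈ K}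
      add_mem' := fun {x y} hx hy => by
        simp only [Set.mem_ofPred_eq] at *
        rw [mul_add]; exact add_mem hx hy
      zero_mem' := by simp
      smul_mem' := fun c x hx => by
        simp only [Set.mem_ofPred_eq, smul_eq_mul] at *
        rw [mul_left_comm]; exact Ideal.mul_mem_left _ _ hx }
  rw [len_eq_add_of_colon k (K := K) (C := C) (z := z) (fun r => Iff.rfl), add_comm]
  refine add_le_add ?_ (len_mono k (sup_le h.le ((Ideal.span_singleton_le_iff_mem _).2 hz)))
  have : Nontrivial (S ⧸ C) := Ideal.Quotient.nontrivial_iff.2 fun h => hz' (by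
    have : (1 : S) ∈ C := h ▸ Submodule.mem_top
    simpa [C] using this)
  exact Order.one_le_iff_pos.2 Module.length_pos

/-- The ideals K + m^i decrease strictly until Nakayama gives m^i ≤ K, and each strict step costs at
least one unit of length. -/
theorem pow_le_of_len_le [IsLocalRing S] [IsNoetherianRing S] {K : Ideal S} {n : ℕ}
    (h : len k K ≤ n) : IsLocalRing.maximalIdeal S ^ (n + 1) ≤ K := by
  have key : ∀ i : ℕ, IsLocalRing.maximalIdeal S ^ i ≤ K ∨
      (i : ℕ∞) ≤ len k (K ⊔ IsLocalRing.maximalIdeal S ^ i) := by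
    intro i
    induction i with
    | zero => right; simp
    | succ i ih =>
      rcases ih with ih | ih
      · exact Or.inl ((Ideal.pow_le_pow_right (Nat.le_succ i)).trans ih)
      by_cases h1 : IsLocalRing.maximalIdeal S ^ i ≤ K ⊔ IsLocalRing.maximalIdeal S ^ (i + 1)
      · left
        refine (Ideal.pow_le_pow_right (Nat.le_succ i)).trans ?_
        rw [pow_succ', ← smul_eq_mul] at h1
        exact Submodule.le_of_le_smul_of_le_jacobson_bot (IsNoetherian.noetherian _)
          (IsLocalRing.maximalIdeal_le_jacobson _) h1
      · right
        refine le_trans ?_ (len_add_one_le k (K := K ⊔ IsLocalRing.maximalIdeal S ^ (i + 1))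
          (L := K ⊔ IsLocalRing.maximalIdeal S ^ i) ?_)
        · push_cast
          exact add_le_add ih le_rfl
        · refine lt_of_le_of_ne (sup_le_sup_left (Ideal.pow_le_pow_right (Nat.le_succ i)) _) ?_
          intro h2
          exact h1 (h2 ▸ le_sup_right)
  rcases key (n + 1) with h1 | h1
  · exact h1
  · have h2 := (h1.trans (len_mono k (le_sup_left))).trans h
    norm_cast at h2
    omega

/-- Each of the finitely many generators of m^n adds at most one to the length of S / m^(n+1),
because the residue field is k. -/
theorem finite_quotient_maximalIdeal_pow [IsLocalRing S] [IsNoetherianRing S]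
    (hS : ∀ a : S, ∃ c : k, a - algebraMap k S c ∈ IsLocalRing.maximalIdeal S) (n : ℕ) :
    Module.Finite k (S ⧸ IsLocalRing.maximalIdeal S ^ n) := by
  rw [← len_ne_top_iff]
  induction n with
  | zero => rw [pow_zero, Ideal.one_eq_top, len_top]; simp
  | succ n ih =>
    obtain ⟨T, hT⟩ := IsNoetherian.noetherian (IsLocalRing.maximalIdeal S ^ n)
    have hfin : ∀ T : Finset S, (∀ z ∈ T, z ∈ IsLocalRing.maximalIdeal S ^ n) →
        len k (IsLocalRing.maximalIdeal S ^ (n + 1)) ≤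
          len k (IsLocalRing.maximalIdeal S ^ (n + 1) ⊔ Ideal.span (T : Set S)) + T.card := by
      classical
      intro T
      induction T using Finset.induction_on with
      | empty => simp
      | insert z T hz ihT =>
        intro hzT
        refine (ihT fun w hw => hzT w (Finset.mem_insert_of_mem hw)).trans ?_
        rw [Finset.coe_insert, Ideal.span_insert, sup_comm (Ideal.span {z}), ← sup_assoc,
          Finset.card_insert_of_notMem hz]
        set K := IsLocalRing.maximalIdeal S ^ (n + 1) ⊔ Ideal.span (T : Set S)
        by_cases h1 : z ∈ K
        · rw [sup_eq_left.2 ((Ideal.span_singleton_le_iff_mem _).2 h1)]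
          gcongr
          simp
        · have h2 : len k K = len k (IsLocalRing.maximalIdeal S) + len k (K ⊔ Ideal.span {z}) := by
            apply len_eq_add_of_colon
            intro r
            constructor
            · intro hr
              rw [IsLocalRing.mem_maximalIdeal, mem_nonunits_iff]
              intro hu
              exact h1 ((Ideal.mul_unit_mem_iff_mem _ hu).1 hr)
            · intro hr
              refine Ideal.mem_sup_left ?_
              rw [pow_succ]
              exact Ideal.mul_mem_mul (hzT z (Finset.mem_insert_self _ _)) hr
          have h3 : len k (IsLocalRing.maximalIdeal S) ≤ 1 := by
            have h4 : Function.Surjective (Algebra.linearMap k (S ⧸ IsLocalRing.maximalIdeal S)) := by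
              intro a
              obtain ⟨a, rfl⟩ := Ideal.Quotient.mk_surjective a
              obtain ⟨c, hc⟩ := hS a
              exact ⟨c, (Ideal.Quotient.eq.2 hc).symm⟩
            refine (Module.length_le_of_surjective _ h4).trans ?_
            rw [Module.length_eq_finrank, Module.finrank_self]; rfl
          rw [h2]
          push_cast
          calc _ ≤ 1 + len k (K ⊔ Ideal.span {z}) + T.card := by gcongr
            _ = _ := by ring
    have h1 := hfin T fun z hz => by rw [← hT]; exact Submodule.subset_span hz
    have h2 : Ideal.span (T : Set S) = IsLocalRing.maximalIdeal S ^ n := hT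
    rw [h2, sup_eq_right.2 (Ideal.pow_le_pow_right (Nat.le_succ n))] at h1
    refine ne_top_of_le_ne_top ?_ h1
    exact WithTop.add_ne_top.2 ⟨ih, ENat.natCast_ne_top _⟩

end Colength

/-! ### Upper semicontinuity of the colength in polynomial families -/

section Semicontinuity

variable {k : Type*} [Field k]

theorem exists_polynomial_eval_eq {A : Type*} [CommRing A] [Algebra k A] (l : A →ₗ[k] k)
    (p : Polynomial A) : ∃ q : Polynomial k, ∀ z, q.eval z = l (p.eval (algebraMap k A z)) := by
  refine ⟨∑ i ∈ Finset.range (p.natDegree + 1), Polynomial.C (l (p.coeff i)) * Polynomial.X ^ i,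
    fun z => ?_⟩
  rw [Polynomial.eval_finsetSum, Polynomial.eval_eq_sum_range (p := p), map_sum]
  refine Finset.sum_congr rfl fun i _ => ?_
  rw [Polynomial.eval_mul, Polynomial.eval_C, Polynomial.eval_pow, Polynomial.eval_X, ← map_pow,
    mul_comm (p.coeff i), ← Algebra.smul_def, map_smul, smul_eq_mul, mul_comm]

/-- The dimension of the quotient by an ideal that depends polynomially on a parameter is
upper semicontinuous. -/
theorem exists_finrank_quotient_le {A ι : Type*} [CommRing A] [Algebra k A] [Module.Finite k A]
    [Fintype ι] (p : ι → Polynomial A) :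
    ∃ q : Polynomial k, q.eval 0 ≠ 0 ∧ ∀ z, q.eval z ≠ 0 →
      Module.finrank k (A ⧸ Ideal.span (Set.range fun i => (p i).eval (algebraMap k A z))) ≤
        Module.finrank k (A ⧸ Ideal.span (Set.range fun i => (p i).eval (algebraMap k A 0))) := by
  set J : k → Ideal A := fun z => Ideal.span (Set.range fun i => (p i).eval (algebraMap k A z)) with hJ
  set W : k → Submodule k A := fun z => (J z).restrictScalars k with hW
  have hq : ∀ z, Module.finrank k (A ⧸ J z) + Module.finrank k (W z) = Module.finrank k A :=
    fun z => Submodule.finrank_quotient_add_finrank (W z)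
  let b := Module.finBasis k (W 0)
  set n := Module.finrank k (W 0)
  have hb : ∀ l : Fin n, ∃ w : ι → A, (b l : A) = ∑ i, w i * (p i).eval (algebraMap k A 0) := by
    intro l
    have h1 : (b l : A) ∈ Submodule.span A (Set.range fun i => (p i).eval (algebraMap k A 0)) :=
      (b l).2
    obtain ⟨w, hw⟩ := (Submodule.mem_span_range_iff_exists_fun A).1 h1
    exact ⟨w, hw.symm⟩
  choose w hw using hb
  -- A basis of the ideal at 0, written in the generators, is transported to z with the same
  -- coefficients w. The vectors stay in the ideal at z, and remain independent wherever the
  -- determinant of their images under the fixed left inverse π is nonzero; that determinant is a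
  -- polynomial in z with value 1 at 0.
  set u : Fin n → k → A := fun l z => ∑ i, w l i * (p i).eval (algebraMap k A z) with hu
  have hinj : LinearMap.ker (Fintype.linearCombination k fun l => (b l : A)) = ⊥ := by
    rw [LinearMap.ker_eq_bot]
    refine linearIndependent_iff_injective_fintypeLinearCombination.1 ?_
    exact b.linearIndependent.map' (W 0).subtype (Submodule.ker_subtype _)
  obtain ⟨π, hπ⟩ := LinearMap.exists_leftInverse_of_injective _ hinj
  have hpoly : ∀ l m : Fin n, ∃ q : Polynomial k, ∀ z, q.eval z = π (u l z) m := by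
    intro l m
    obtain ⟨q, hq⟩ := exists_polynomial_eval_eq ((LinearMap.proj m).comp π)
      (∑ i, Polynomial.C (w l i) * p i)
    refine ⟨q, fun z => ?_⟩
    rw [hq, Polynomial.eval_finsetSum]
    simp [hu]
  choose Q hQ using hpoly
  have hdet : ∀ z, (Matrix.of Q).det.eval z = (Matrix.of fun l m => π (u l z) m).det := by
    intro z
    rw [← Polynomial.coe_evalRingHom, RingHom.map_det]
    congr 1
    ext l m
    exact hQ l m z
  refine ⟨(Matrix.of Q).det, ?_, fun z hz => ?_⟩
  · rw [hdet]
    have : (Matrix.of fun l m => π (u l 0) m) = 1 := by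
      ext l m
      have h1 : u l 0 = Fintype.linearCombination k (fun l => (b l : A)) (Pi.single l 1) := by
        rw [Fintype.linearCombination_apply_single, one_smul, hw]
      have h2 := LinearMap.congr_fun hπ (Pi.single l 1)
      rw [LinearMap.comp_apply, ← h1, LinearMap.id_apply] at h2
      rw [Matrix.of_apply, h2, Matrix.one_apply, Pi.single_apply]
      simp [eq_comm]
    rw [this, Matrix.det_one]
    exact one_ne_zero
  · rw [hdet] at hz
    have h1 := Matrix.linearIndependent_rows_of_det_ne_zero hz
    have h2 : LinearIndependent k (fun l => u l z) := by
      refine LinearIndependent.of_comp π ?_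
      exact h1
    have hmem : ∀ l, u l z ∈ W z := fun l =>
      Ideal.sum_mem _ fun i _ => Ideal.mul_mem_left _ _ (Ideal.subset_span ⟨i, rfl⟩)
    have h3 : LinearIndependent k (fun l => (⟨u l z, hmem l⟩ : W z)) :=
      LinearIndependent.of_comp (W z).subtype h2
    have h4 := h3.fintype_card_le_finrank
    rw [Fintype.card_fin] at h4
    have h5 := hq z
    have h6 := hq 0
    change Module.finrank k (A ⧸ J z) ≤ Module.finrank k (A ⧸ J 0)
    omega

theorem exists_len_le {S ι : Type*} [CommRing S] [Algebra k S] [Fintype ι] (M : Ideal S)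
    [Module.Finite k (S ⧸ M)] (p : ι → Polynomial S) :
    ∃ q : Polynomial k, q.eval 0 ≠ 0 ∧ ∀ z, q.eval z ≠ 0 →
      len k (M ⊔ Ideal.span (Set.range fun i => (p i).eval (algebraMap k S z))) ≤
        len k (M ⊔ Ideal.span (Set.range fun i => (p i).eval (algebraMap k S 0))) := by
  obtain ⟨q, hq0, hq⟩ := exists_finrank_quotient_le (k := k) (A := S ⧸ M)
    (fun i => (p i).map (Ideal.Quotient.mk M))
  refine ⟨q, hq0, fun z hz => ?_⟩
  have h1 : ∀ z, len k (M ⊔ Ideal.span (Set.range fun i => (p i).eval (algebraMap k S z))) =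
      Module.finrank k ((S ⧸ M) ⧸ Ideal.span (Set.range fun i =>
        ((p i).map (Ideal.Quotient.mk M)).eval (algebraMap k (S ⧸ M) z))) := by
    intro z
    have h2 : ∀ i, Ideal.Quotient.mk M ((p i).eval (algebraMap k S z)) =
        ((p i).map (Ideal.Quotient.mk M)).eval (algebraMap k (S ⧸ M) z) := by
      intro i
      change _ = Polynomial.eval (Ideal.Quotient.mk M (algebraMap k S z)) _
      rw [Polynomial.eval_map, Polynomial.eval₂_at_apply]
    have h3 : (Ideal.span (Set.range fun i => (p i).eval (algebraMap k S z))).map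
        (Ideal.Quotient.mk M) = Ideal.span (Set.range fun i =>
        ((p i).map (Ideal.Quotient.mk M)).eval (algebraMap k (S ⧸ M) z)) := by
      rw [Ideal.map_span, ← Set.range_comp]
      exact congrArg _ (congrArg _ (funext h2))
    rw [← len_map_mk, h3, len, Module.length_eq_finrank]
  rw [h1, h1]
  exact_mod_cast hq z hz

end Semicontinuity

/-! ### The automatic degeneracy -/

section AD

variable {k : Type*} [Field k]

theorem colength_eq_len {r : ℕ} (F : Amb k r) (I : Ideal (Total F)) : colength F I = len k I :=
  (Module.length_eq_rank k _).symm

theorem RegMod.neg {S : Type*} [CommRing S] {K : Ideal S} {a : S} (h : RegMod K a) :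
    RegMod K (-a) := h.congr (u := -1) isUnit_one.neg (by simp)

/-- Moves the last element of a regular sequence to the front, giving regularity of the others on
the hypersurface it defines. -/
theorem RegMod.front {S : Type*} [CommRing S] [IsNoetherianRing S] [IsLocalRing S] {K : Ideal S}
    {a b c : S} (ha : RegMod K a) (hb : RegMod (K ⊔ Ideal.span {a}) b)
    (hc : RegMod (K ⊔ Ideal.span {a} ⊔ Ideal.span {b}) c)
    (ham : a ∈ IsLocalRing.maximalIdeal S) (hbm : b ∈ IsLocalRing.maximalIdeal S) :
    RegMod (K ⊔ Ideal.span {c}) a ∧ RegMod (K ⊔ Ideal.span {c} ⊔ Ideal.span {a}) b := by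
  have h1 := hb.swap hc hbm
  have h2 := ha.swap h1.1 ham
  refine ⟨h2.2, ?_⟩
  rw [sup_right_comm]
  exact h1.2

/-- In an admissible deformation, `F_y` and `-F_x` form a regular sequence on the total space. -/
theorem regMod_of_isAdmissible [CharZero k] {s : ℕ} (hs : 2 ≤ s) (g : Fin 1 → Plane k)
    (hadm : IsAdmissible (family (curve k s) g)) :
    RegMod ⊥ (Ideal.Quotient.mk (Ideal.span {family (curve k s) g})
      (MvPowerSeries.pderiv k (Sum.inl 1) (family (curve k s) g))) ∧
    RegMod (⊥ ⊔ Ideal.span {Ideal.Quotient.mk (Ideal.span {family (curve k s) g})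
      (MvPowerSeries.pderiv k (Sum.inl 1) (family (curve k s) g))})
      (Ideal.Quotient.mk (Ideal.span {family (curve k s) g})
        (-MvPowerSeries.pderiv k (Sum.inl 0) (family (curve k s) g))) := by
  set F := family (curve k s) g with hF
  set x : Amb k 1 := MvPowerSeries.X (Sum.inl 0) with hx
  set y : Amb k 1 := MvPowerSeries.X (Sum.inl 1) with hy
  set t : Amb k 1 := MvPowerSeries.X (Sum.inr 0) with ht
  set Fx := MvPowerSeries.pderiv k (Sum.inl 0) F with hFx
  set Fy := MvPowerSeries.pderiv k (Sum.inl 1) F with hFy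
  have eFx : ∃ c, Fx = -((s : Amb k 1) * x ^ (s - 1)) + t * c := by
    refine ⟨ofPlane k 1 (MvPowerSeries.pderiv k 0 (g 0)), ?_⟩
    rw [hFx, hF, pderiv_family, family]
    simp [curve, Derivation.leibniz_pow, MvPowerSeries.pderiv_X_self, ofPlane_X,
      MvPowerSeries.pderiv_X_of_ne (R := k) (i := (0 : Fin 2)) (j := 1), hx, ht]
  have eFy : ∃ c, Fy = 2 * y + t * c := by
    refine ⟨ofPlane k 1 (MvPowerSeries.pderiv k 1 (g 0)), ?_⟩
    have h2 : ofPlane k 1 2 = 2 := map_ofNat _ 2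
    rw [hFy, hF, pderiv_family, family]
    simp [curve, Derivation.leibniz_pow, MvPowerSeries.pderiv_X_self, ofPlane_X,
      MvPowerSeries.pderiv_X_of_ne (R := k) (i := (1 : Fin 2)) (j := 0), hy, ht, h2]
  obtain ⟨c, eFx⟩ := eFx
  obtain ⟨c', eFy⟩ := eFy
  have hu : ∀ n : ℕ, n ≠ 0 → IsUnit (n : Amb k 1) := by
    intro n hn
    rw [MvPowerSeries.isUnit_iff_constantCoeff, map_natCast, isUnit_iff_ne_zero]
    exact Nat.cast_ne_zero.2 hn
  have hu2 : IsUnit (2 : Amb k 1) := by simpa using hu 2 two_ne_zero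
  have h1 := regMod_span_X (k := k) (∅ : Finset (Fin 2 ⊕ Fin 1)) (j := Sum.inr 0) (by simp)
  have h2 := regMod_span_X (k := k) ({Sum.inr 0} : Finset (Fin 2 ⊕ Fin 1)) (j := Sum.inl 1) (by simp)
  have h3 := regMod_span_X (k := k) ({Sum.inr 0, Sum.inl 1} : Finset (Fin 2 ⊕ Fin 1))
    (j := Sum.inl 0) (by simp)
  simp only [Finset.coe_empty, Set.image_empty, Ideal.span_empty] at h1
  simp only [Finset.coe_singleton, Set.image_singleton] at h2
  simp only [Finset.coe_insert, Finset.coe_singleton, Set.image_pair, Ideal.span_insert] at h3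
  rw [← ht] at h1
  rw [← ht, ← hy] at h2
  rw [← ht, ← hy, ← hx] at h3
  have hspan : Ideal.span {t} ⊔ Ideal.span {Fy} = Ideal.span {t} ⊔ Ideal.span {y} := by
    apply le_antisymm <;> refine sup_le le_sup_left ?_ <;> rw [Ideal.span_singleton_le_iff_mem]
    · exact mem_sup_span.2 ⟨t * c', Ideal.mul_mem_right _ _ (Ideal.mem_span_singleton_self t), 2,
        by rw [eFy]; ring⟩
    · rw [← Ideal.unit_mul_mem_iff_mem _ hu2]
      exact mem_sup_span.2 ⟨-(t * c'),
        neg_mem (Ideal.mul_mem_right _ _ (Ideal.mem_span_singleton_self t)), 1, by rw [eFy]; ring⟩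
  have hFyr : RegMod (Ideal.span {t}) Fy := h2.congr hu2 (by
    rw [eFy, add_sub_cancel_left]; exact Ideal.mul_mem_right _ _ (Ideal.mem_span_singleton_self t))
  have hFxr : RegMod (Ideal.span {t} ⊔ Ideal.span {Fy}) Fx := by
    rw [hspan]
    refine (h3.pow (s - 1)).congr (hu s (by omega)).neg ?_
    rw [eFx, show -((s : Amb k 1) * x ^ (s - 1)) + t * c - -(s : Amb k 1) * x ^ (s - 1) = t * c by
      ring]
    exact Ideal.mem_sup_left (Ideal.mul_mem_right _ _ (Ideal.mem_span_singleton_self t))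
  have htm : t ∈ IsLocalRing.maximalIdeal (Amb k 1) := (mem_maximalIdeal_iff _).2 (by simp [ht])
  have hFym : Fy ∈ IsLocalRing.maximalIdeal (Amb k 1) := (mem_maximalIdeal_iff _).2 (by
    rw [eFy]; simp [ht, hy])
  have hFxm : Fx ∈ IsLocalRing.maximalIdeal (Amb k 1) := (mem_maximalIdeal_iff _).2 (by
    rw [eFx]; simp [ht, hx, show s - 1 ≠ 0 by omega])
  -- Modulo t the derivatives are unit multiples of y and x^(s-1), so t, F_y, F_x is regular in the
  -- ambient ring, and so is F_y, F_x, t.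
  obtain ⟨r1, r2, r3⟩ := h1.rotate (b := Fy) (c := Fx) (by rwa [bot_sup_eq])
    (by rwa [bot_sup_eq]) htm
  -- Admissibility enters here: a power of t lies in (F_y, F_x, F), so F inherits from t its
  -- regularity modulo (F_y, F_x).
  have hfin : ∃ N, t ^ N ∈ ⊥ ⊔ Ideal.span {Fy} ⊔ Ideal.span {Fx} ⊔ Ideal.span {F} := by
    have h4 : singIdeal F = (Ideal.span {Fy} ⊔ Ideal.span {Fx}).map
        (Ideal.Quotient.mk (Ideal.span {F})) := by
      rw [singIdeal, Ideal.map_sup, Ideal.map_span, Ideal.map_span, Set.image_singleton,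
        Set.image_singleton, sup_comm, Ideal.span_insert]
    have h5 : len k (singIdeal F) ≠ ⊤ := (len_ne_top_iff k).2 hadm
    rw [h4, len_map_mk] at h5
    obtain ⟨n, hn⟩ := ENat.ne_top_iff_exists.1 h5
    refine ⟨n + 1, ?_⟩
    rw [bot_sup_eq, sup_comm]
    exact pow_le_of_len_le k hn.symm.le (Ideal.pow_mem_pow htm _)
  obtain ⟨N, hN⟩ := hfin
  have r4 := r1.front r2 (r3.exchange hN) hFym hFxm
  rw [bot_sup_eq] at r4
  refine ⟨?_, ?_⟩
  · rw [← Ideal.map_bot (f := Ideal.Quotient.mk (Ideal.span {F}))]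
    exact RegMod.map_mk (by rw [bot_sup_eq]; exact r4.1)
  · rw [bot_sup_eq, ← Set.image_singleton (f := Ideal.Quotient.mk (Ideal.span {F})),
      ← Ideal.map_span]
    exact RegMod.map_mk (by rw [sup_comm]; exact r4.2.neg)

theorem map_minorIdeal {A B : Type*} [CommRing A] [CommRing B] (φ : A →+* B)
    (E : Matrix (Fin 4) (Fin 3) A) : minorIdeal (E.map φ) = (minorIdeal E).map φ := by
  rw [minorIdeal, minorIdeal, Ideal.map_span, ← Set.range_comp]
  congr 2
  funext ι
  rw [Function.comp_apply, RingHom.map_det]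
  rfl

theorem singIdeal_eq {r : ℕ} (F : Amb k r) (h : Fin 3 → Dbl k r) :
    singIdeal F = Ideal.span {(germJet F h).η} ⊔ Ideal.span {(germJet F h).ξ} := by
  have h1 : (germJet F h).η = -Ideal.Quotient.mk _ (MvPowerSeries.pderiv k (Sum.inl 0) F) :=
    map_neg _ _
  rw [h1, Ideal.span_singleton_neg, singIdeal, Ideal.span_insert]
  rfl

/-- The degeneracy ideal of general sections of a deformation with smooth total space. -/
theorem degIdeal_of_genericity [CharZero k] {s : ℕ} (hs : 2 ≤ s) {g : Fin 1 → Plane k}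
    (hg : MvPowerSeries.constantCoeff (g 0) ≠ 0) {h : Fin 3 → Dbl k 1}
    (hh : genericity (constJet h) ≠ 0) :
    IsAdmissible (family (curve k s) g) ∧
      len k (degIdeal (family (curve k s) g) 4
        (fun j => Ideal.Quotient.mk (ppIdeal (family (curve k s) g) 4) (h j))) = degValue s := by
  set F := family (curve k s) g with hFdef
  have hF : MvPowerSeries.constantCoeff F = 0 := by
    rw [hFdef, constantCoeff_family, constantCoeff_curve hs]
  have := isLocalRing_total hF
  have hK := isGerm_one hs hg hF
  have hj := hasShape_germJet hs g h
    (param_mem_errIdeal (K := ⊥) 0 hg (fun i hi => absurd (Subsingleton.elim i 0) hi))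
  have h1 := (hK.regMod_ξ hj hs 0).1
  rw [zero_mul, add_zero] at h1
  obtain ⟨h2, h3⟩ := degIdeal_eq_normalIdeal hs hF hK hj hh h1.1 h1.2
  refine ⟨?_, ?_⟩
  · have h4 := hK.len_ξ hj hs 0
    rw [zero_mul, add_zero, bot_sup_eq] at h4
    rw [IsAdmissible, ← len_ne_top_iff, singIdeal_eq F h, h4]
    exact ENat.natCast_ne_top _
  · rw [h2, ← hK.len_normalIdeal_eq hj hs h3, bot_sup_eq]

/-- The functions `1, u, v + 2 u²`. -/
def witness (k : Type*) [Field k] (r : ℕ) : Fin 3 → Dbl k r :=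
  ![1, MvPowerSeries.X (Sum.inl (Sum.inr 0)),
    MvPowerSeries.X (Sum.inl (Sum.inr 1)) + 2 * MvPowerSeries.X (Sum.inl (Sum.inr 0)) ^ 2]

theorem constJet_witness (r : ℕ) : constJet (witness k r) =
    !![1, 0, 0; 0, 1, 0; 0, 0, 1; 0, 0, 4; 0, 0, 0; 0, 0, 0; 0, 0, 0; 0, 0, 0; 0, 0, 0; 0, 0, 0] := by
  have h2 : ∀ i, MvPowerSeries.pderiv k i (2 : Dbl k r) = 0 := fun i => Derivation.map_natCast _ 2
  have h2' : MvPowerSeries.constantCoeff (2 : Dbl k r) = 2 := map_ofNat _ 2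
  have h1 : MvPowerSeries.pderiv k (Sum.inl (Sum.inr 0))
      (MvPowerSeries.X (Sum.inl (Sum.inr 1)) : Dbl k r) = 0 := MvPowerSeries.pderiv_X_of_ne (by simp)
  have h1' : MvPowerSeries.pderiv k (Sum.inl (Sum.inr 1))
      (MvPowerSeries.X (Sum.inl (Sum.inr 0)) : Dbl k r) = 0 := MvPowerSeries.pderiv_X_of_ne (by simp)
  refine Matrix.ext fun i j => ?_
  fin_cases i <;> fin_cases j <;>
    simp [constJet, jet, witness, Derivation.leibniz, Derivation.leibniz_pow, h1, h1', h2, h2',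
      MvPowerSeries.pderiv_X_self]
  norm_num

/-- The sections have c20 = 4. The value must avoid the zeros of (c20² - 4)(c20² - 8), so v + u²,
with c20 = 2, would not do. -/
theorem genericity_witness [CharZero k] (r : ℕ) : genericity (constJet (witness k r)) ≠ 0 := by
  rw [constJet_witness]
  set Γ : Matrix (Fin 10) (Fin 3) k :=
    !![1, 0, 0; 0, 1, 0; 0, 0, 1; 0, 0, 4; 0, 0, 0; 0, 0, 0; 0, 0, 0; 0, 0, 0; 0, 0, 0; 0, 0, 0]
    with hΓ
  have h1 : topBlock Γ = 1 := by
    refine Matrix.ext fun i j => ?_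
    fin_cases i <;> fin_cases j <;> rfl
  have h2 : numerator Γ = Γ := by rw [numerator, h1, Matrix.adjugate_one, Matrix.mul_one]
  rw [genericity, h1, h2, Matrix.det_one]
  have e1 : Γ 4 2 = 0 := rfl
  have e2 : Γ 5 1 = 0 := rfl
  have e3 : Γ 3 1 = 0 := rfl
  have e4 : Γ 3 2 = 4 := rfl
  have e5 : Γ 5 2 = 0 := rfl
  have e6 : Γ 4 1 = 0 := rfl
  simp only [e1, e2, e3, e4, e5, e6]
  norm_num

/-- The point of parameter `z` of the line through `a` and `b`. -/
def seg {M : Type*} [AddCommGroup M] [Module k M] (a b : M) (z : k) : M := a + z • (b - a)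

theorem map_seg {M N : Type*} [AddCommGroup M] [Module k M] [AddCommGroup N] [Module k N]
    (l : M →ₗ[k] N) (a b : M) (z : k) : l (seg a b z) = seg (l a) (l b) z := by
  simp [seg]

theorem seg_zero {M : Type*} [AddCommGroup M] [Module k M] (a b : M) : seg a b (0 : k) = a := by
  simp [seg]

theorem seg_one {M : Type*} [AddCommGroup M] [Module k M] (a b : M) : seg a b (1 : k) = b := by
  simp [seg]

theorem constantCoeff_seg {σ : Type*} (a b : MvPowerSeries σ k) (z : k) :
    MvPowerSeries.constantCoeff (seg a b z) =
      seg (MvPowerSeries.constantCoeff a) (MvPowerSeries.constantCoeff b) z := by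
  simpa using map_seg (MvPowerSeries.coeff (R := k) (0 : σ →₀ ℕ)) a b z

theorem jet_seg {r : ℕ} (h h' : Dbl k r) (i : Fin 10) (z : k) :
    jet (seg h h' z) i = seg (jet h i) (jet h' i) z := by
  have hd : ∀ i (a b : Dbl k r), MvPowerSeries.pderiv k i (seg a b z) =
      seg (MvPowerSeries.pderiv k i a) (MvPowerSeries.pderiv k i b) z := fun i a b =>
    map_seg (MvPowerSeries.pderiv k i).toLinearMap a b z
  simp only [jet, hd]
  fin_cases i <;> rfl

theorem constJet_seg {r : ℕ} (h h' : Fin 3 → Dbl k r) (z : k) (i : Fin 10) (j : Fin 3) :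
    constJet (fun j => seg (h j) (h' j) z) i j = seg (constJet h i j) (constJet h' i j) z := by
  rw [constJet, Matrix.of_apply, jet_seg, constantCoeff_seg]
  rfl

/-- The line through `a` and `b`, as a polynomial. -/
def linePoly {A : Type*} [CommRing A] (a b : A) : Polynomial A :=
  Polynomial.C a + Polynomial.X * Polynomial.C (b - a)

theorem eval_linePoly {A : Type*} [CommRing A] [Algebra k A] (a b : A) (z : k) :
    (linePoly a b).eval (algebraMap k A z) = seg a b z := by
  simp [linePoly, seg, Algebra.smul_def]

theorem family_seg {r : ℕ} (f : Plane k) (g g' : Fin r → Plane k) (z : k) :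
    family f (fun j => seg (g j) (g' j) z) = seg (family f g) (family f g') z := by
  simp only [family, seg, map_add, map_smul, map_sub, add_sub_add_left_eq_sub,
    ← Finset.sum_sub_distrib, Finset.smul_sum, mul_add, Finset.sum_add_distrib, add_assoc, mul_sub,
    mul_smul_comm]

/-- Along a line the derivatives of F and of the sections are linear in z, and the matrix is a
polynomial expression in them. -/
theorem exists_opMatrix_poly {r : ℕ} (F F' : Amb k r) (h h' : Fin 3 → Dbl k r) :
    ∃ E : Matrix (Fin 4) (Fin 3) (Polynomial (Amb k r)), ∀ z : k,
      opMatrix (seg F F' z) (fun j => seg (h j) (h' j) z) =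
        E.map (Polynomial.evalRingHom (algebraMap k (Amb k r) z)) := by
  let x : Amb k r →ₗ[k] Amb k r := (MvPowerSeries.pderiv k (Sum.inl 0 : Fin 2 ⊕ Fin r)).toLinearMap
  let y : Amb k r →ₗ[k] Amb k r := (MvPowerSeries.pderiv k (Sum.inl 1 : Fin 2 ⊕ Fin r)).toLinearMap
  let L : (Amb k r →ₗ[k] Amb k r) → Polynomial (Amb k r) := fun l => linePoly (l F) (l F')
  have hL : ∀ l z, Polynomial.evalRingHom (algebraMap k (Amb k r) z) (L l) = l (seg F F' z) :=
    fun l z => by rw [Polynomial.coe_evalRingHom, eval_linePoly, map_seg]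
  refine ⟨symbolMatrix (L y) (L (-x)) (L (x ∘ₗ x)) (L (x ∘ₗ y)) (L (y ∘ₗ y)) (L (x ∘ₗ x ∘ₗ x))
    (L (x ∘ₗ x ∘ₗ y)) (L (x ∘ₗ y ∘ₗ y)) (L (y ∘ₗ y ∘ₗ y)) *
    Matrix.of fun i j => linePoly (jetMatrix h i j) (jetMatrix h' i j), fun z => ?_⟩
  rw [opMatrix_eq, Matrix.map_mul, map_symbolMatrix]
  simp only [hL]
  congr 1
  refine Matrix.ext fun i j => ?_
  rw [Matrix.map_apply, Matrix.of_apply, Polynomial.coe_evalRingHom, eval_linePoly]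
  simp only [jetMatrix, Matrix.of_apply, jet_seg]
  exact map_seg (diag k r).toLinearMap _ _ z

theorem exists_sum_smul_sub_mem {f : Plane k} {d : ℕ} {δ : Fin d → Plane k} (hδ : IsDefBasis f δ)
    (p : Plane k) : ∃ a : Fin d → k, (∑ i, a i • δ i) - p ∈ tjurinaIdeal f := by
  have h1 : Ideal.Quotient.mk (tjurinaIdeal f) p ∈
      Submodule.span k (Set.range fun i => Ideal.Quotient.mk (tjurinaIdeal f) (δ i)) :=
    hδ.2 ▸ Submodule.mem_top
  obtain ⟨a, ha⟩ := (Submodule.mem_span_range_iff_exists_fun k).1 h1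
  refine ⟨a, Ideal.Quotient.eq.1 ?_⟩
  rw [← ha, map_sum]
  rfl

theorem pderiv_zero_curve (s : ℕ) : MvPowerSeries.pderiv k 0 (curve k s) =
    -((s : Plane k) * MvPowerSeries.X 0 ^ (s - 1)) := by
  simp [curve, Derivation.leibniz_pow, MvPowerSeries.pderiv_X_self,
    MvPowerSeries.pderiv_X_of_ne (R := k) (i := (0 : Fin 2)) (j := 1)]

theorem pderiv_one_curve (s : ℕ) : MvPowerSeries.pderiv k 1 (curve k s) = 2 * MvPowerSeries.X 1 := by
  simp [curve, Derivation.leibniz_pow, MvPowerSeries.pderiv_X_self,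
    MvPowerSeries.pderiv_X_of_ne (R := k) (i := (1 : Fin 2)) (j := 0)]

theorem tjurinaIdeal_curve_le {s : ℕ} (hs : 2 ≤ s) : tjurinaIdeal (curve k s) ≤
    Ideal.span {MvPowerSeries.X 1} ⊔ Ideal.span {MvPowerSeries.X 0 ^ (s - 1)} := by
  obtain ⟨s, rfl⟩ := Nat.exists_eq_add_of_le' (show 1 ≤ s by omega)
  rw [tjurinaIdeal, Ideal.span_le]
  rintro _ (rfl | rfl | rfl)
  · exact mem_sup_span.2 ⟨_, Ideal.mul_mem_left _ (MvPowerSeries.X 1)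
      (Ideal.mem_span_singleton_self _), -MvPowerSeries.X 0, by
        simp only [curve, Nat.add_sub_cancel]; ring⟩
  · rw [pderiv_zero_curve]
    exact neg_mem (Ideal.mul_mem_left _ _ (self_mem_sup_span _ _))
  · rw [pderiv_one_curve]
    exact Ideal.mem_sup_left (Ideal.mul_mem_left _ _ (Ideal.mem_span_singleton_self _))

theorem constantCoeff_eq_zero_of_mem_tjurinaIdeal {s : ℕ} (hs : 2 ≤ s) {p : Plane k}
    (hp : p ∈ tjurinaIdeal (curve k s)) : MvPowerSeries.constantCoeff p = 0 := by
  rw [← mem_maximalIdeal_iff]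
  refine (?_ : Ideal.span {(MvPowerSeries.X 1 : Plane k)} ⊔
    Ideal.span {MvPowerSeries.X 0 ^ (s - 1)} ≤ IsLocalRing.maximalIdeal _)
    (tjurinaIdeal_curve_le hs hp)
  refine sup_le ?_ ?_ <;> rw [Ideal.span_singleton_le_iff_mem, mem_maximalIdeal_iff]
  · simp
  · simp [show s - 1 ≠ 0 by omega]

/-- The upper bound comes from one explicit smoothing with explicit sections. For the lower bound,
any competitor is joined to that choice by a line; its general point has colength `degValue s`, and
the colength at the competitor is at least as large. -/
theorem AD2_curve [CharZero k] {s : ℕ} (hs : 2 ≤ s) {d : ℕ} {δ : Fin d → Plane k}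
    (hδ : IsDefBasis (curve k s) δ) : AD2 (curve k s) δ 4 = degValue s := by
  -- The direction a₁ represents the class of 1; its constant term is 1 because the Tjurina ideal
  -- lies in the maximal ideal.
  obtain ⟨a₁, ha₁⟩ := exists_sum_smul_sub_mem hδ 1
  have ha₁' : MvPowerSeries.constantCoeff (∑ i, a₁ i • δ i) = 1 := by
    have := constantCoeff_eq_zero_of_mem_tjurinaIdeal hs ha₁
    rw [map_sub, map_one, sub_eq_zero] at this
    exact this
  let g : (Fin d → k) → Fin 1 → Plane k := fun a _ => ∑ i, a i • δ i
  apply le_antisymm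
  · have h1 := degIdeal_of_genericity hs (g := g a₁) (by rw [ha₁']; exact one_ne_zero)
      (genericity_witness (k := k) 1)
    refine (iInf_le _ a₁).trans ((iInf_le _ h1.1).trans
      ((iInf_le _ fun j => Ideal.Quotient.mk _ (witness k 1 j)).trans ?_))
    rw [colength_eq_len]
    exact h1.2.le
  · refine le_iInf fun a => le_iInf fun hadm => le_iInf fun τ => ?_
    choose h hτ using fun j => Ideal.Quotient.mk_surjective (τ j)
    obtain rfl : (fun j => Ideal.Quotient.mk _ (h j)) = τ := funext hτ
    rw [colength_eq_len]
    change (degValue s : ℕ∞) ≤ len k (degIdeal (family (curve k s) (g a)) 4 fun j : Fin 3 =>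
      Ideal.Quotient.mk (ppIdeal (family (curve k s) (g a)) 4) (h j))
    have hreg := regMod_of_isAdmissible hs (g a) hadm
    rw [degIdeal_eq_minorIdeal hreg.1 hreg.2, map_minorIdeal, len_map_mk]
    set F := family (curve k s) (g a)
    set F₁ := family (curve k s) (g a₁)
    obtain ⟨E, hE⟩ := exists_opMatrix_poly F F₁ h (witness k 1)
    have hFz : ∀ z, family (curve k s) (fun j => seg (g a j) (g a₁ j) z) = seg F F₁ z :=
      family_seg _ _ _
    -- Since the total space varies along the line, the ideals are compared in the ambient power
    -- series ring: `none` indexes the equation, `some ι` the minors.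
    let p : Option (Fin 3 → Fin 4) → Polynomial (Amb k 1) := fun o =>
      o.elim (linePoly F F₁) fun ι => (E.submatrix ι id).det
    have hp : ∀ z, Ideal.span (Set.range fun o => (p o).eval (algebraMap k (Amb k 1) z)) =
        Ideal.span {seg F F₁ z} ⊔
          minorIdeal (opMatrix (seg F F₁ z) fun j => seg (h j) (witness k 1 j) z) := by
      intro z
      rw [hE, Option.range_eq, Ideal.span_insert, minorIdeal]
      congr 2
      · exact congrArg _ (eval_linePoly F F₁ z)
      · congr 1
        funext ι
        change Polynomial.evalRingHom (algebraMap k (Amb k 1) z) (E.submatrix ι id).det = _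
        rw [RingHom.map_det]
        rfl
    -- Truncation at this power of the maximal ideal makes the ambient algebra finite-dimensional,
    -- as semicontinuity requires.
    have hM := finite_quotient_maximalIdeal_pow k (S := Amb k 1) (fun b =>
      ⟨MvPowerSeries.constantCoeff b, (mem_maximalIdeal_iff _).2 (by
        rw [map_sub, sub_eq_zero]; exact (MvPowerSeries.constantCoeff_C _).symm)⟩) (degValue s + 1)
    obtain ⟨q, hq0, hq⟩ := exists_len_le (k := k)
      (IsLocalRing.maximalIdeal (Amb k 1) ^ (degValue s + 1)) p
    let q₁ : Polynomial k := genericity (Matrix.of fun i j =>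
      linePoly (constJet h i j) (constJet (witness k 1) i j))
    have hq₁ : ∀ z, q₁.eval z = genericity (constJet fun j => seg (h j) (witness k 1 j) z) := by
      intro z
      rw [← Polynomial.coe_evalRingHom, ← map_genericity]
      congr 1
      refine Matrix.ext fun i j => ?_
      exact (eval_linePoly _ _ z).trans (constJet_seg h (witness k 1) z i j).symm
    let q₂ : Polynomial k := linePoly (MvPowerSeries.constantCoeff (g a 0)) 1
    have hq₂ : ∀ z, q₂.eval z = MvPowerSeries.constantCoeff (seg (g a 0) (g a₁ 0) z) := by
      intro z
      rw [constantCoeff_seg, ha₁']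
      exact eval_linePoly _ _ z
    -- The three polynomials are nonzero: q at z = 0, the other two at z = 1. The field is infinite,
    -- so a common nonvanishing point exists.
    obtain ⟨z, hz⟩ : ∃ z, (q * q₁ * q₂).eval z ≠ 0 := by
      by_contra! h0
      have h1 : q * q₁ * q₂ = 0 := Polynomial.funext fun z => by rw [h0, Polynomial.eval_zero]
      rcases mul_eq_zero.1 h1 with h1 | h1
      · rcases mul_eq_zero.1 h1 with h1 | h1
        · exact hq0 (by rw [h1, Polynomial.eval_zero])
        · have h2 := hq₁ 1
          simp only [seg_one, h1, Polynomial.eval_zero] at h2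
          exact genericity_witness (k := k) 1 h2.symm
      · have h2 := hq₂ 1
        rw [seg_one, h1, Polynomial.eval_zero, ha₁'] at h2
        exact zero_ne_one h2
    rw [Polynomial.eval_mul, Polynomial.eval_mul] at hz
    have hz2 := right_ne_zero_of_mul hz
    have hz1 := right_ne_zero_of_mul (left_ne_zero_of_mul hz)
    have hz0 := left_ne_zero_of_mul (left_ne_zero_of_mul hz)
    rw [hq₂] at hz2
    rw [hq₁] at hz1
    obtain ⟨hadmz, hlen⟩ := degIdeal_of_genericity hs (g := fun j => seg (g a j) (g a₁ j) z) hz2 hz1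
    have hregz := regMod_of_isAdmissible hs _ hadmz
    rw [degIdeal_eq_minorIdeal hregz.1 hregz.2, map_minorIdeal, len_map_mk, hFz, ← hp] at hlen
    -- At z the ideal has colength `degValue s` and already contains the truncating power; at 0
    -- truncation can only lower the length.
    have h3 := hq z hz0
    rw [sup_eq_right.2 (pow_le_of_len_le k hlen.le), hlen, hp] at h3
    simp only [seg_zero] at h3
    exact h3.trans (len_mono k le_sup_right)

end AD

/-! ### Finite algebras over `k[[t]]` -/

section PowerSeriesAlgebra

theorem mem_span_singleton_pow_smul_top {R M : Type*} [CommRing R] [AddCommGroup M] [Module R M]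
    {r : R} {n : ℕ} {m : M} :
    m ∈ Ideal.span {r} ^ n • (⊤ : Submodule R M) ↔ ∃ w, m = r ^ n • w := by
  rw [Ideal.span_singleton_pow, Submodule.ideal_span_singleton_smul,
    Submodule.mem_smul_pointwise_iff_exists]
  exact ⟨fun ⟨w, _, hw⟩ => ⟨w, hw.symm⟩, fun ⟨w, hw⟩ => ⟨w, Submodule.mem_top, hw.symm⟩⟩

theorem isPrecomplete_pi {R ι : Type*} [CommRing R] (r : R) [IsPrecomplete (Ideal.span {r}) R] :
    IsPrecomplete (Ideal.span {r}) (ι → R) := by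
  refine ⟨fun f hf => ?_⟩
  have h1 : ∀ i, ∃ L : R, ∀ n, f n i ≡ L [SMOD (Ideal.span {r} ^ n • ⊤ : Submodule R R)] := by
    refine fun i => IsPrecomplete.prec' (fun n => f n i) fun {m n} hmn => ?_
    have h2 := hf hmn
    rw [SModEq.sub_mem, mem_span_singleton_pow_smul_top] at h2 ⊢
    obtain ⟨w, hw⟩ := h2
    exact ⟨w i, congrFun hw i⟩
  choose L hL using h1
  refine ⟨L, fun n => ?_⟩
  have h2 : ∀ i, ∃ w, f n i - L i = r ^ n • w := fun i => by
    have h3 := hL i n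
    rwa [SModEq.sub_mem, mem_span_singleton_pow_smul_top] at h3
  choose w hw using h2
  rw [SModEq.sub_mem, mem_span_singleton_pow_smul_top]
  exact ⟨w, funext hw⟩

variable {k : Type*} [Field k] {S : Type*} [CommRing S]
variable {A : Type*} [CommRing A] [Algebra k⟦X⟧ A] {π : S →+* A} {t : S}

theorem isTorsionFree_of_regMod (hπ : Function.Surjective π)
    (ht : π t = algebraMap k⟦X⟧ A PowerSeries.X) (hreg : RegMod (RingHom.ker π) t) :
    Module.IsTorsionFree k⟦X⟧ A := by
  refine ⟨fun r hr => ?_⟩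
  obtain ⟨n, u, hu⟩ := IsDiscreteValuationRing.associated_pow_irreducible hr.ne_zero
    PowerSeries.X_irreducible
  have hX : ∀ a : A, (PowerSeries.X : k⟦X⟧) ^ n • a = 0 → a = 0 := by
    intro a ha
    obtain ⟨z, rfl⟩ := hπ a
    rw [Algebra.smul_def, map_pow, ← ht, ← map_pow, ← map_mul] at ha
    exact RingHom.mem_ker.1 (hreg.pow n z (RingHom.mem_ker.2 ha))
  rw [isSMulRegular_iff_right_eq_zero_of_smul]
  intro a ha
  refine hX a ?_
  rw [← hu, mul_comm, mul_smul, ha, smul_zero]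

variable [Algebra k S]

/-- Nakayama in its complete form: lifts of a k-spanning set of A / tA generate A, because a finite
free k[[X]]-module is X-adically complete and A is X-adically separated. -/
theorem finite_powerSeries_of_len_ne_top [IsLocalRing S] [IsNoetherianRing S]
    (hπ : Function.Surjective π) (ht : π t = algebraMap k⟦X⟧ A PowerSeries.X)
    (hC : ∀ c, π (algebraMap k S c) = algebraMap k⟦X⟧ A (PowerSeries.C c))
    (htm : t ∈ IsLocalRing.maximalIdeal S) (hlen : len k (RingHom.ker π ⊔ Ideal.span {t}) ≠ ⊤) :
    Module.Finite k⟦X⟧ A := by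
  rcases subsingleton_or_nontrivial A with hA | hA
  · infer_instance
  have : IsLocalRing A := IsLocalRing.of_surjective' π hπ
  have : IsNoetherianRing A := isNoetherianRing_of_surjective S A π hπ
  have hfin := (len_ne_top_iff k).1 hlen
  obtain ⟨n, b, hb⟩ := Module.Finite.exists_fin (R := k)
    (M := S ⧸ (RingHom.ker π ⊔ Ideal.span {t}))
  choose σ hσ using fun i => Ideal.Quotient.mk_surjective (b i)
  let f : (Fin n → k⟦X⟧) →ₗ[k⟦X⟧] A := Fintype.linearCombination k⟦X⟧ fun i => π (σ i)
  have := isPrecomplete_pi (ι := Fin n) (PowerSeries.X : k⟦X⟧)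
  have hH : IsHausdorff (Ideal.span {(PowerSeries.X : k⟦X⟧)}) A := by
    rw [← IsHausdorff.map_algebraMap_iff (S := A)]
    refine IsHausdorff.of_isLocalRing _ _ ?_
    rw [Ideal.map_span, Set.image_singleton, ← ht, Ne, Ideal.span_singleton_eq_top]
    intro hu
    obtain ⟨a, ha⟩ := hu.exists_right_inv
    obtain ⟨w, rfl⟩ := hπ a
    have h1 : IsUnit (1 - t * w) := (IsLocalRing.isUnit_or_isUnit_one_sub_self (t * w)).resolve_left
      fun h => htm (isUnit_of_mul_isUnit_left h)
    refine (h1.map π).ne_zero ?_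
    rw [map_sub, map_one, map_mul, ha, sub_self]
  refine Module.Finite.of_surjective f
    (surjective_of_mkQ_comp_surjective (I := Ideal.span {(PowerSeries.X : k⟦X⟧)}) ?_)
  intro a
  obtain ⟨a, rfl⟩ := Submodule.mkQ_surjective _ a
  obtain ⟨z, rfl⟩ := hπ a
  have hz : Ideal.Quotient.mk (RingHom.ker π ⊔ Ideal.span {t}) z ∈ Submodule.span k (Set.range b) :=
    hb ▸ Submodule.mem_top
  obtain ⟨c, hc⟩ := (Submodule.mem_span_range_iff_exists_fun k).1 hz
  refine ⟨fun i => PowerSeries.C (c i), ?_⟩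
  have h1 : (∑ i, algebraMap k S (c i) * σ i) - z ∈ RingHom.ker π ⊔ Ideal.span {t} := by
    rw [← Ideal.Quotient.eq, ← hc, map_sum]
    refine Finset.sum_congr rfl fun i _ => ?_
    rw [map_mul, hσ, Algebra.smul_def]
    rfl
  obtain ⟨κ, hκ, w, hw⟩ := mem_sup_span.1 h1
  rw [LinearMap.comp_apply, ← sub_eq_zero, ← map_sub, Submodule.mkQ_apply,
    Submodule.Quotient.mk_eq_zero, ← pow_one (Ideal.span {(PowerSeries.X : k⟦X⟧)}),
    mem_span_singleton_pow_smul_top]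
  refine ⟨π w, ?_⟩
  rw [pow_one, Algebra.smul_def, ← ht, ← map_mul, Fintype.linearCombination_apply]
  have h2 : ∑ i, PowerSeries.C (c i) • π (σ i) = π (∑ i, algebraMap k S (c i) * σ i) := by
    rw [map_sum]
    refine Finset.sum_congr rfl fun i _ => ?_
    rw [map_mul, hC, Algebra.smul_def]
  rw [h2, ← map_sub, hw, map_add, (RingHom.mem_ker).1 hκ, zero_add]

/-- Both sides compute dim A / XA: the constant terms of the coordinates in a basis of A identify
this quotient with a power of k. -/
theorem len_eq_finrank [Module.Finite k⟦X⟧ A] [Module.Free k⟦X⟧ A]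
    (hπ : Function.Surjective π) (ht : π t = algebraMap k⟦X⟧ A PowerSeries.X)
    (hC : ∀ c, π (algebraMap k S c) = algebraMap k⟦X⟧ A (PowerSeries.C c)) :
    len k (RingHom.ker π ⊔ Ideal.span {t}) = Module.finrank k⟦X⟧ A := by
  let b := Module.finBasis k⟦X⟧ A
  set r := Module.finrank k⟦X⟧ A
  let Φ : S →ₗ[k] (Fin r → k) :=
    { toFun := fun z i => PowerSeries.constantCoeff (b.repr (π z) i)
      map_add' := fun z w => by ext i; simp
      map_smul' := fun c z => by
        ext i
        rw [Algebra.smul_def, map_mul, hC, ← Algebra.smul_def]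
        simp }
  have hΦ : Function.Surjective Φ := by
    intro v
    obtain ⟨z, hz⟩ := hπ (b.repr.symm (Finsupp.equivFunOnFinite.symm fun i => PowerSeries.C (v i)))
    refine ⟨z, ?_⟩
    ext i
    simp [Φ, hz]
  have hker : LinearMap.ker Φ = (RingHom.ker π ⊔ Ideal.span {t}).restrictScalars k := by
    ext z
    rw [LinearMap.mem_ker, Submodule.restrictScalars_mem, mem_sup_span]
    constructor
    · intro hz
      have h1 : ∀ i, ∃ q, b.repr (π z) i = PowerSeries.X * q := fun i =>
        PowerSeries.X_dvd_iff.2 (congrFun hz i)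
      choose q hq using h1
      obtain ⟨w, hw⟩ := hπ (b.repr.symm (Finsupp.equivFunOnFinite.symm q))
      refine ⟨z - t * w, ?_, w, by ring⟩
      rw [RingHom.mem_ker, map_sub, sub_eq_zero, map_mul, ht, ← Algebra.smul_def, hw]
      apply b.repr.injective
      ext1 i
      rw [hq]
      simp
    · rintro ⟨κ, hκ, w, rfl⟩
      ext i
      have h1 : π (κ + t * w) = (PowerSeries.X : k⟦X⟧) • π w := by
        rw [map_add, RingHom.mem_ker.1 hκ, zero_add, map_mul, ht, Algebra.smul_def]
      simp [Φ, h1]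
  have e := (Submodule.quotEquivOfEq _ _ hker.symm).trans (Φ.quotKerEquivOfSurjective hΦ)
  have e2 := (Submodule.Quotient.restrictScalarsEquiv k (RingHom.ker π ⊔ Ideal.span {t})).symm.trans e
  rw [len, e2.length_eq, Module.length_eq_finrank, Module.finrank_fin_fun]

end PowerSeriesAlgebra

/-! ### Multiplicities of a localization -/

section Multiplicity

variable {G B B' : Type*} [Field G] [CommRing B] [CommRing B'] [Algebra G B] [Algebra G B']
  [Algebra B B'] [IsScalarTower G B B'] [Module.Finite G B']

/-- The primes of the localization at x are those of B avoiding x, with the same local rings. The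
localization is Artinian, so its dimension is the sum over its primes. -/
theorem finsum_finrank_localization (x : B) [IsLocalization.Away x B'] :
    ∑ᶠ p : {p : PrimeSpectrum B // x ∉ p.asIdeal},
      Module.finrank G (Localization.AtPrime p.1.asIdeal) = Module.finrank G B' := by
  have : IsArtinianRing B' := IsArtinianRing.of_finite G B'
  have := Fintype.ofFinite (PrimeSpectrum B')
  rw [IsArtinianRing.finrank_eq_sum_primeSpectrum G (R := B'), ← finsum_eq_sum_of_fintype]
  have hx : ∀ q : PrimeSpectrum B', x ∉ (q.comap (algebraMap B B')).asIdeal := fun q hq =>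
    q.2.ne_top (Ideal.eq_top_of_isUnit_mem _ hq (IsLocalization.Away.algebraMap_isUnit x))
  symm
  refine finsum_eq_of_bijective (fun q => ⟨q.comap (algebraMap B B'), hx q⟩) ⟨?_, ?_⟩ ?_
  · intro q q' h
    exact PrimeSpectrum.localization_comap_injective B' (Submonoid.powers x) (congrArg Subtype.val h)
  · rintro ⟨p, hp⟩
    have h1 : p ∈ Set.range (PrimeSpectrum.comap (algebraMap B B')) := by
      rw [PrimeSpectrum.localization_comap_range B' (Submonoid.powers x)]
      refine (Ideal.disjoint_powers_iff_notMem _ ?_).2 hp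
      exact p.2.isRadical
    obtain ⟨q, hq⟩ := h1
    exact ⟨q, Subtype.ext hq⟩
  · intro q
    let _ : Algebra B (Localization.AtPrime q.asIdeal) := inferInstance
    have : IsScalarTower G B (Localization.AtPrime q.asIdeal) := inferInstance
    have h1 : IsLocalization.AtPrime (Localization.AtPrime q.asIdeal)
        (q.comap (algebraMap B B')).asIdeal :=
      IsLocalization.isLocalization_isLocalization_atPrime_isLocalization (Submonoid.powers x)
        (Localization.AtPrime q.asIdeal) q.asIdeal
    have h2 : IsLocalization (q.comap (algebraMap B B')).asIdeal.primeCompl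
      (Localization.AtPrime q.asIdeal) := h1
    have e := IsLocalization.algEquiv (q.comap (algebraMap B B')).asIdeal.primeCompl
      (Localization.AtPrime q.asIdeal) (Localization.AtPrime (q.comap (algebraMap B B')).asIdeal)
    exact (e.restrictScalars G).toLinearEquiv.finrank_eq

end Multiplicity

/-! ### Multiplicities after base change -/

section BaseChange

variable {R G A A' : Type*} [CommRing R] [Nontrivial R] [Field G] [Algebra R G] [CommRing A] [CommRing A']
  [Algebra R A] [Algebra R A']

/-- The kernel of A → A' is killed by x^n and x becomes invertible in G ⊗ A', so G ⊗ A' is the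
localization of G ⊗ A at x; its dimension is the rank of A'. -/
theorem finsum_finrank_localization_baseChange [Module.Finite R A'] [Module.Free R A'] (φ : A →ₐ[R] A')
    (hφ : Function.Surjective φ) {x : A} {n : ℕ} (hx : ∀ l, φ l = 0 → x ^ n * l = 0)
    (hu : IsUnit (1 ⊗ₜ φ x : G ⊗[R] A')) :
    ∑ᶠ p : {p : PrimeSpectrum (G ⊗[R] A) // (1 ⊗ₜ x : G ⊗[R] A) ∉ p.asIdeal},
      Module.finrank G (Localization.AtPrime p.1.asIdeal) = Module.finrank R A' := by
  let ψ : G ⊗[R] A →ₐ[G] G ⊗[R] A' := Algebra.TensorProduct.map (AlgHom.id G G) φ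
  have hψx : ψ (1 ⊗ₜ x) = 1 ⊗ₜ φ x := by simp [ψ]
  have hψ : Function.Surjective ψ := by
    intro z
    induction z using TensorProduct.induction_on with
    | zero => exact ⟨0, map_zero _⟩
    | tmul g a =>
      obtain ⟨a, rfl⟩ := hφ a
      exact ⟨g ⊗ₜ a, by simp [ψ]⟩
    | add z w hz hw =>
      obtain ⟨z, rfl⟩ := hz
      obtain ⟨w, rfl⟩ := hw
      exact ⟨z + w, map_add _ _ _⟩
  let _ : Algebra (G ⊗[R] A) (G ⊗[R] A') := ψ.toRingHom.toAlgebra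
  have halg : ∀ z, algebraMap (G ⊗[R] A) (G ⊗[R] A') z = ψ z := fun z => rfl
  have : IsScalarTower G (G ⊗[R] A) (G ⊗[R] A') := IsScalarTower.of_algebraMap_eq fun g =>
    (ψ.commutes g).symm
  have hker : ∀ z, ψ z = 0 → (1 ⊗ₜ x : G ⊗[R] A) ^ n * z = 0 := by
    intro z hz
    have h1 : z ∈ (RingHom.ker φ).map (Algebra.TensorProduct.includeRight : A →ₐ[R] G ⊗[R] A) := by
      rw [← Algebra.TensorProduct.lTensor_ker φ hφ, RingHom.mem_ker]
      exact hz
    refine Submodule.span_induction ?_ (mul_zero _) ?_ ?_ h1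
    · rintro _ ⟨l, hl, rfl⟩
      rw [Algebra.TensorProduct.includeRight_apply, Algebra.TensorProduct.tmul_pow,
        Algebra.TensorProduct.tmul_mul_tmul, hx l hl, TensorProduct.tmul_zero]
    · intro a b _ _ ha hb
      rw [mul_add, ha, hb, add_zero]
    · intro c a _ ha
      rw [smul_eq_mul, mul_left_comm, ha, mul_zero]
  have : IsLocalization.Away (1 ⊗ₜ x : G ⊗[R] A) (G ⊗[R] A') := by
    refine ⟨?_, ?_, ?_⟩
    · rintro ⟨_, m, rfl⟩
      rw [halg, map_pow, hψx]
      exact hu.pow m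
    · intro z
      obtain ⟨w, rfl⟩ := hψ z
      exact ⟨⟨w, 1⟩, by rw [halg, halg, OneMemClass.coe_one, map_one, mul_one]⟩
    · intro z w h
      rw [halg, halg, ← sub_eq_zero, ← map_sub] at h
      refine ⟨⟨_, n, rfl⟩, ?_⟩
      rw [← sub_eq_zero, ← mul_sub]
      exact hker _ h
  rw [finsum_finrank_localization (G := G) (B' := G ⊗[R] A') (1 ⊗ₜ x : G ⊗[R] A),
    Module.finrank_baseChange]

end BaseChange

/-! ### The geometric generic fiber of a degeneracy locus -/

section GenericFiber

variable {k : Type*} [Field k] {F : Amb k 2} {I I' : Ideal (Total F)}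

theorem toSub_surjective : Function.Surjective (toSub F I) := Ideal.Quotient.mk_surjective

theorem ker_toSub : RingHom.ker (toSub F I) = I := Ideal.mk_ker

theorem toSub_eq_zero {a : Total F} : toSub F I a = 0 ↔ a ∈ I := Ideal.Quotient.eq_zero_iff_mem

theorem algebraMap_sub (p : k⟦X⟧) : algebraMap k⟦X⟧ (Sub F I) p =
    toSub F I (Ideal.Quotient.mk _ (MvPowerSeries.rename
      (fun _ : Unit => (Sum.inr 0 : Fin 2 ⊕ Fin 2)) p)) := rfl

theorem toSub_param : toSub F I (param F 0) = algebraMap k⟦X⟧ (Sub F I) PowerSeries.X := by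
  rw [algebraMap_sub, PowerSeries.X, MvPowerSeries.rename_X]

theorem toSub_algebraMap (c : k) :
    toSub F I (algebraMap k _ c) = algebraMap k⟦X⟧ (Sub F I) (PowerSeries.C c) := by
  rw [algebraMap_sub]
  have h : MvPowerSeries.rename (fun _ : Unit => (Sum.inr 0 : Fin 2 ⊕ Fin 2)) (PowerSeries.C c) =
      algebraMap k (Amb k 2) c :=
    (MvPowerSeries.rename (fun _ : Unit => (Sum.inr 0 : Fin 2 ⊕ Fin 2))).commutes c
  rw [h]
  rfl

theorem finite_sub [IsLocalRing (Total F)] (hF : MvPowerSeries.constantCoeff F = 0)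
    (hI : len k (I ⊔ Ideal.span {param F 0}) ≠ ⊤) : Module.Finite k⟦X⟧ (Sub F I) := by
  refine finite_powerSeries_of_len_ne_top toSub_surjective toSub_param toSub_algebraMap ?_
    (by rwa [ker_toSub])
  exact (mk_mem_maximalIdeal_iff hF _).2 (by rw [evTotal_mk, MvPowerSeries.constantCoeff_X])

/-- Reduces questions about primes of the generic fibre to their contractions to O_X. -/
theorem genSing_le_iff (P : PrimeSpectrum (GenFiber F I)) : ∃ p : Ideal (Total F), p.IsPrime ∧
    I ≤ p ∧ (genSing F I ≤ P.asIdeal ↔ singIdeal F ≤ p) ∧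
      ∀ a, (1 ⊗ₜ toSub F I a : GenFiber F I) ∈ P.asIdeal ↔ a ∈ p := by
  refine ⟨P.asIdeal.comap ((Algebra.TensorProduct.includeRight :
    Sub F I →ₐ[k⟦X⟧] GenFiber F I).toRingHom.comp (toSub F I)), inferInstance, ?_,
    Ideal.map_le_iff_le_comap, fun a => Iff.rfl⟩
  intro a ha
  rw [Ideal.mem_comap, RingHom.comp_apply, toSub_eq_zero.2 ha, map_zero]
  exact zero_mem _

theorem smoothMultiplicity_eq_zero
    (h : ∀ p : Ideal (Total F), p.IsPrime → I ≤ p → singIdeal F ≤ p) :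
    smoothMultiplicity F I = 0 := by
  have : IsEmpty {P : PrimeSpectrum (GenFiber F I) // ¬ genSing F I ≤ P.asIdeal} := by
    refine ⟨fun ⟨P, hP⟩ => hP ?_⟩
    obtain ⟨p, hp, hI, h1, -⟩ := genSing_le_iff P
    exact h1.2 (h p hp hI)
  exact finsum_of_isEmpty _

/-- If the locus `I = 0` coincides with `I' = 0` where `ξ` is invertible, the complement of `ξ = 0`
is the part off the relative singular locus, and `I' = 0` is flat over `k[[t_0]]` with `ξ`
invertible on the generic fiber, then the multiplicity is the length of the special fiber. -/
theorem smoothMultiplicity_eq [IsLocalRing (Total F)] (hF : MvPowerSeries.constantCoeff F = 0)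
    {ξ : Total F} (hsing : ∀ p : Ideal (Total F), p.IsPrime → I ≤ p → (singIdeal F ≤ p ↔ ξ ∈ p))
    (hle : I ≤ I') {n : ℕ} (hpow : ∀ a ∈ I', ξ ^ n * a ∈ I)
    (ht : param F 0 ∈ I' ⊔ Ideal.span {ξ}) (hreg : RegMod I' (param F 0)) {N : ℕ}
    (hlen : len k (I' ⊔ Ideal.span {param F 0}) = N) : smoothMultiplicity F I = N := by
  have : Module.Finite k⟦X⟧ (Sub F I') := finite_sub hF (hlen ▸ ENat.natCast_ne_top _)
  have : Module.IsTorsionFree k⟦X⟧ (Sub F I') :=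
    isTorsionFree_of_regMod toSub_surjective toSub_param (by rwa [ker_toSub])
  have h1 := len_eq_finrank (toSub_surjective (F := F) (I := I')) toSub_param toSub_algebraMap
  rw [ker_toSub, hlen, Nat.cast_inj] at h1
  let φ : Sub F I →ₐ[k⟦X⟧] Sub F I' :=
    { Ideal.Quotient.factor hle with commutes' := fun p => rfl }
  have hφ : ∀ a, φ (toSub F I a) = toSub F I' a := fun a => rfl
  have hφs : Function.Surjective φ := fun a => by
    obtain ⟨a, rfl⟩ := toSub_surjective a
    exact ⟨_, hφ a⟩
  -- On I' = 0 the parameter t₀ is a multiple of ξ, and t₀ is invertible over the generic point.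
  have hu : IsUnit (1 ⊗ₜ φ (toSub F I ξ) : GenFiber F I') := by
    obtain ⟨a, ha, w, hw⟩ := mem_sup_span.1 ht
    refine isUnit_of_mul_isUnit_left (y := 1 ⊗ₜ toSub F I' w) ?_
    rw [hφ, Algebra.TensorProduct.tmul_mul_tmul, ← map_mul, mul_one,
      show toSub F I' (ξ * w) = toSub F I' (param F 0) by
        rw [hw, map_add, toSub_eq_zero.2 ha, zero_add], toSub_param,
      Algebra.algebraMap_eq_smul_one, TensorProduct.tmul_smul, TensorProduct.smul_tmul',
      ← Algebra.algebraMap_eq_smul_one]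
    have h2 : IsUnit (algebraMap k⟦X⟧ (GeomGen k) PowerSeries.X) := by
      rw [isUnit_iff_ne_zero, IsScalarTower.algebraMap_apply k⟦X⟧ (LaurentSeries k) (GeomGen k), Ne,
        map_eq_zero_iff _ (algebraMap (LaurentSeries k) (GeomGen k)).injective,
        map_eq_zero_iff _ (IsFractionRing.injective k⟦X⟧ (LaurentSeries k))]
      exact PowerSeries.X_ne_zero
    exact h2.map (Algebra.TensorProduct.includeLeft :
      GeomGen k →ₐ[GeomGen k] GenFiber F I')
  have h3 := finsum_finrank_localization_baseChange (G := GeomGen k) φ hφs (x := toSub F I ξ)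
    (n := n) (fun l hl => by
      obtain ⟨a, rfl⟩ := toSub_surjective l
      rw [← map_pow, ← map_mul, toSub_eq_zero]
      exact hpow a (toSub_eq_zero.1 hl)) hu
  rw [h1, ← h3]
  have h4 : ∀ P : PrimeSpectrum (GenFiber F I), ¬ genSing F I ≤ P.asIdeal ↔
      (1 ⊗ₜ toSub F I ξ : GenFiber F I) ∉ P.asIdeal := by
    intro P
    obtain ⟨p, hp, hI, h5, h6⟩ := genSing_le_iff P
    rw [h5, h6, hsing p hp hI]
  exact finsum_eq_of_bijective (Equiv.subtypeEquivRight h4) (Equiv.bijective _) fun P => rfl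

end GenericFiber

/-! ### Invertibility of F_y on the generic fibre -/

section Nakayama

variable {S : Type*} [CommRing S] [IsLocalRing S] [IsNoetherianRing S]

/-- A parameter lies in an ideal that contains the critical ideal and, modulo the parameter,
`x ^ (s - 2)`. -/
theorem param_mem_of_pow_mem {s : ℕ} (hs : 2 ≤ s) {x y t₀ t₁ ξ η g₀ g₁ a₀ a₁ b₀ b₁ : S} {Q : Ideal S}
    (hF : y ^ 2 - x ^ s + (t₀ * g₀ + t₁ * g₁) = 0) (hξ : ξ = 2 * y + (t₀ * b₀ + t₁ * b₁))
    (hη : η = s * x ^ (s - 1) - (t₀ * a₀ + t₁ * a₁)) (h2 : IsUnit (2 : S))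
    (hdet : IsUnit (g₁ * a₀ - g₀ * a₁)) (hx : x ∈ IsLocalRing.maximalIdeal S)
    (hy : y ∈ IsLocalRing.maximalIdeal S) (hξQ : ξ ∈ Q) (hηQ : η ∈ Q)
    (hQ : x ^ (s - 2) ∈ Q ⊔ Ideal.span {t₀}) : t₀ ∈ Q := by
  obtain ⟨s, rfl⟩ := Nat.exists_eq_add_of_le' hs
  simp only [Nat.add_sub_cancel, show s + 2 - 1 = s + 1 by omega] at hη hQ
  set m := IsLocalRing.maximalIdeal S
  set N := Ideal.span {t₀, t₁}
  set Q' := Q ⊔ Ideal.span {x ^ (s + 1)}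
  have hmj : m ≤ Ideal.jacobson ⊥ := IsLocalRing.maximalIdeal_le_jacobson _
  have hξ' : ξ ∈ Q' := Ideal.mem_sup_left hξQ
  have hη' : η ∈ Q' := Ideal.mem_sup_left hηQ
  have hx' : x ^ (s + 1) ∈ Q' := self_mem_sup_span _ _
  -- First use of Nakayama: modulo Q' + m N the equation and its x-derivative are two linear
  -- equations in t₀, t₁ with invertible determinant, so both parameters lie in Q'.
  have hN : N ≤ Q' := by
    refine Submodule.le_of_le_smul_of_le_jacobson_bot (IsNoetherian.noetherian _) hmj ?_
    have hyN : ∀ z ∈ N, y * z ∈ Q' ⊔ m • N := fun z hz =>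
      Ideal.mem_sup_right (Ideal.mul_mem_mul hy hz)
    have ht₀ : t₀ ∈ N := Ideal.subset_span (by simp)
    have ht₁ : t₁ ∈ N := Ideal.subset_span (by simp)
    have h3 : y ^ 2 ∈ Q' ⊔ m • N := by
      rw [← Ideal.unit_mul_mem_iff_mem _ h2, show 2 * y ^ 2 =
        y * ξ - (y * t₀ * b₀ + y * t₁ * b₁) by rw [hξ]; ring]
      exact sub_mem (Ideal.mul_mem_left _ _ (Ideal.mem_sup_left hξ')) (add_mem
        (Ideal.mul_mem_right _ _ (hyN _ ht₀)) (Ideal.mul_mem_right _ _ (hyN _ ht₁)))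
    have h4 : t₀ * g₀ + t₁ * g₁ ∈ Q' ⊔ m • N := by
      rw [show t₀ * g₀ + t₁ * g₁ = x * x ^ (s + 1) - y ^ 2 by linear_combination hF]
      exact sub_mem (Ideal.mul_mem_left _ _ (Ideal.mem_sup_left hx')) h3
    have h5 : t₀ * a₀ + t₁ * a₁ ∈ Q' ⊔ m • N := by
      rw [show t₀ * a₀ + t₁ * a₁ = ((s + 2 : ℕ) : S) * x ^ (s + 1) - η by rw [hη]; ring]
      exact Ideal.mem_sup_left (sub_mem (Ideal.mul_mem_left _ _ hx') hη')
    rw [Ideal.span_le, Set.insert_subset_iff, Set.singleton_subset_iff]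
    refine ⟨?_, ?_⟩ <;> rw [SetLike.mem_coe, ← Ideal.unit_mul_mem_iff_mem _ hdet]
    · rw [show (g₁ * a₀ - g₀ * a₁) * t₀ = g₁ * (t₀ * a₀ + t₁ * a₁) - a₁ * (t₀ * g₀ + t₁ * g₁) by ring]
      exact sub_mem (Ideal.mul_mem_left _ _ h5) (Ideal.mul_mem_left _ _ h4)
    · rw [show (g₁ * a₀ - g₀ * a₁) * t₁ = a₀ * (t₀ * g₀ + t₁ * g₁) - g₀ * (t₀ * a₀ + t₁ * a₁) by ring]
      exact sub_mem (Ideal.mul_mem_left _ _ h4) (Ideal.mul_mem_left _ _ h5)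
  rw [← Ideal.span_singleton_le_iff_mem]
  refine Submodule.le_of_le_smul_of_le_jacobson_bot (IsNoetherian.noetherian _) hmj ?_
  rw [Ideal.span_singleton_le_iff_mem]
  -- Second use: the hypothesis is one power of x better than needed, so the extra generator of Q'
  -- lies in Q + m t₀, whence t₀ ∈ Q + m t₀.
  have h6 : x ^ (s + 1) ∈ Q ⊔ m • Ideal.span {t₀} := by
    obtain ⟨q, hq, w, hw⟩ := mem_sup_span.1 hQ
    rw [pow_succ', hw, mul_add]
    exact add_mem (Ideal.mem_sup_left (Ideal.mul_mem_left _ _ hq)) (Ideal.mem_sup_right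
      (Ideal.mul_mem_mul hx (Ideal.mul_mem_right _ _ (Ideal.mem_span_singleton_self _))))
  exact (sup_le le_sup_left ((Ideal.span_singleton_le_iff_mem _).2 h6) : Q' ≤ _)
    (hN (Ideal.subset_span (by simp)))

end Nakayama

/-! ### Limiting inflection points -/

section Limiting

variable {k : Type*} [Field k] [CharZero k]

/-- Modulo ξ the first generator is -L₂₁ ζ² with L₂₁ a unit. So on the degeneracy locus the
vanishing of ξ forces that of η. -/
theorem prime_dichotomy {S : Type*} [CommRing S] {j : JetData S} (hL : IsUnit j.L21) {p : Ideal S}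
    (hp : p.IsPrime) (hI : j.normalIdeal ≤ p) (hξ : j.ξ ∈ p) :
    Ideal.span {j.η} ⊔ Ideal.span {j.ξ} ≤ p := by
  have h1 : j.e * j.ξ ^ 2 + j.f * j.ξ * j.ζ + -j.L21 * j.ζ ^ 2 ∈ p := hI (Ideal.subset_span (by simp))
  have h2 : j.L21 * j.ζ ^ 2 ∈ p := by
    rw [show j.L21 * j.ζ ^ 2 = j.ξ * (j.e * j.ξ + j.f * j.ζ) -
      (j.e * j.ξ ^ 2 + j.f * j.ξ * j.ζ + -j.L21 * j.ζ ^ 2) by ring]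
    exact sub_mem (Ideal.mul_mem_right _ _ hξ) h1
  have h3 : j.ζ ∈ p := hp.mem_of_pow_mem 2 ((Ideal.unit_mul_mem_iff_mem _ hL).1 h2)
  refine sup_le ?_ ?_ <;> rw [Ideal.span_singleton_le_iff_mem]
  · rw [show j.η = j.ζ - j.b * j.ξ by rw [JetData.ζ]; ring]
    exact sub_mem h3 (Ideal.mul_mem_left _ _ hξ)
  · exact hξ

theorem mem_prime_of_isUnit_e {S : Type*} [CommRing S] {j : JetData S} (he : IsUnit j.e)
    {p : Ideal S} (hp : p.IsPrime) (hI : j.normalIdeal ≤ p) : j.ξ ∈ p := by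
  have h1 : j.e * j.ξ ^ 2 + j.f * j.ξ * j.ζ + -j.L21 * j.ζ ^ 2 ∈ p := hI (Ideal.subset_span (by simp))
  have h2 : j.ξ ^ 2 * j.ζ ∈ p := hI (Ideal.subset_span (by simp))
  rcases hp.mem_or_mem h2 with h2 | h2
  · exact hp.mem_of_pow_mem 2 h2
  · refine hp.mem_of_pow_mem 2 ((Ideal.unit_mul_mem_iff_mem _ he).1 ?_)
    rw [show j.e * j.ξ ^ 2 = (j.e * j.ξ ^ 2 + j.f * j.ξ * j.ζ + -j.L21 * j.ζ ^ 2) -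
      j.ζ * (j.f * j.ξ - j.L21 * j.ζ) by ring]
    exact sub_mem h1 (Ideal.mul_mem_right _ _ h2)

theorem normalIdeal_le {S : Type*} [CommRing S] (j : JetData S) :
    j.normalIdeal ≤ Ideal.span {j.e} ⊔ Ideal.span {j.ζ} := by
  have he : j.e ∈ Ideal.span {j.e} ⊔ Ideal.span {j.ζ} :=
    Ideal.mem_sup_left (Ideal.mem_span_singleton_self _)
  have hζ : j.ζ ∈ Ideal.span {j.e} ⊔ Ideal.span {j.ζ} := self_mem_sup_span _ _
  rw [JetData.normalIdeal, Ideal.span_le]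
  rintro _ (rfl | rfl | rfl)
  · exact add_mem (add_mem (Ideal.mul_mem_right _ _ he) (Ideal.mul_mem_left _ _ hζ))
      (Ideal.mul_mem_left _ _ (Ideal.pow_mem_of_mem _ hζ 2 two_pos))
  · exact Ideal.mul_mem_left _ _ hζ
  · exact Ideal.mul_mem_left _ _ (Ideal.pow_mem_of_mem _ hζ 2 two_pos)

/-- Where ξ is invertible, ξ² ζ yields ζ, and then the first generator yields e; the exponent 3
clears denominators. -/
theorem pow_mul_mem_normalIdeal {S : Type*} [CommRing S] {j : JetData S} {a : S}
    (ha : a ∈ Ideal.span {j.e} ⊔ Ideal.span {j.ζ}) : j.ξ ^ 3 * a ∈ j.normalIdeal := by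
  obtain ⟨z, hz, r, rfl⟩ := mem_sup_span.1 ha
  obtain ⟨w, rfl⟩ := Ideal.mem_span_singleton'.1 hz
  refine mem_span_triple.2 ⟨j.ξ * w, j.ξ * r - j.f * w, j.L21 * w, ?_⟩
  ring

/-- Off the singular locus the degeneracy ideal is (e, ζ). For s ≤ 3 this is the unit ideal; for s ≥
4 it defines a finite flat scheme over k[[t₀]] whose special fibre has length s - 1 and whose
generic fibre avoids ξ = 0. -/
theorem limiting_of_genericity {s : ℕ} (hs : 2 ≤ s) {g : Fin 2 → Plane k}
    (hg : MvPowerSeries.constantCoeff (g 1) ≠ 0)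
    (hdet : 4 ≤ s → MvPowerSeries.constantCoeff
      (g 1 * MvPowerSeries.pderiv k 0 (g 0) - g 0 * MvPowerSeries.pderiv k 0 (g 1)) ≠ 0)
    {h : Fin 3 → Dbl k 2} (hh : genericity (constJet h) ≠ 0) :
    Module.Finite (GeomGen k) (GenFiber (family (curve k s) g) (degIdeal (family (curve k s) g) 4
        (fun j => Ideal.Quotient.mk (ppIdeal (family (curve k s) g) 4) (h j)))) ∧
      smoothMultiplicity (family (curve k s) g) (degIdeal (family (curve k s) g) 4
        (fun j => Ideal.Quotient.mk (ppIdeal (family (curve k s) g) 4) (h j))) =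
        if s ≤ 3 then 0 else s - 1 := by
  have hF : MvPowerSeries.constantCoeff (family (curve k s) g) = 0 := by
    rw [constantCoeff_family, constantCoeff_curve hs]
  have := isLocalRing_total hF
  obtain ⟨ht, hK⟩ := isGerm_two hs hg hF
  have hj := hasShape_germJet hs g h
    (param_mem_errIdeal (K := Ideal.span {param (family (curve k s) g) 0}) 1 hg (fun i hi => by
      obtain rfl : i = 0 := by omega
      exact Ideal.mem_span_singleton_self _))
  have htm : param (family (curve k s) g) 0 ∈ IsLocalRing.maximalIdeal (Total (family (curve k s) g)) :=
    (mk_mem_maximalIdeal_iff hF _).2 (by rw [evTotal_mk, MvPowerSeries.constantCoeff_X])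
  have h1 := (hK.regMod_ξ hj hs 0).1
  rw [zero_mul, add_zero] at h1
  -- Regularity of t₀, ξ, η gives that of ξ, η, t₀, so the description of the degeneracy ideal by
  -- minors applies on the whole total space.
  have h1' := ht.rotate (by rw [bot_sup_eq]; exact h1.1) (by rw [bot_sup_eq]; exact h1.2) htm
  obtain ⟨h2, hg'⟩ := degIdeal_eq_normalIdeal hs hF hK hj hh h1'.1 h1'.2.1
  rw [h2]
  have hlen := hK.len_normalIdeal_eq hj hs hg'
  have hfin : Module.Finite k⟦X⟧ (Sub (family (curve k s) g) (germJet (family (curve k s) g) h).normalIdeal) :=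
    finite_sub hF (by rw [sup_comm, hlen]; exact ENat.natCast_ne_top _)
  refine ⟨inferInstance, ?_⟩
  have hL := hK.isUnit_L21 hj hs
  split_ifs with hs3
  · refine smoothMultiplicity_eq_zero fun p hp hI => ?_
    rw [singIdeal_eq _ h]
    exact prime_dichotomy hL hp hI (mem_prime_of_isUnit_e (hK.isUnit_e hj hs hs3 hg') hp hI)
  · have hs4 : 4 ≤ s := by omega
    obtain ⟨⟨r1, r2⟩, -, r3⟩ := hK.regMod_e hj hs4 hg'.ne_zero (del_ne_zero hs4 hg'.ne_zero hg'.del_ne)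
    -- Likewise e, ζ, t₀ is regular, which is flatness of e = ζ = 0 over k[[t₀]].
    have r4 := ht.rotate (by rw [bot_sup_eq]; exact r1) (by rw [bot_sup_eq]; exact r2) htm
    refine smoothMultiplicity_eq hF (ξ := (germJet (family (curve k s) g) h).ξ) (fun p hp hI => ?_)
      (normalIdeal_le _) (fun a ha => pow_mul_mem_normalIdeal ha) ?_
      (by have := r4.2.2; rwa [bot_sup_eq] at this) ?_
    · rw [singIdeal_eq _ h]
      exact ⟨fun hle => hle (self_mem_sup_span _ _), prime_dichotomy hL hp hI⟩
    · have hQ := hK.pow_mem_sup hj hs4 hg'.ne_zero (rho_ne_zero hs4 hg'.ne_zero hg'.rho_ne)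
      set j := germJet (family (curve k s) g) h
      set Q := Ideal.span {j.e} ⊔ Ideal.span {j.ζ} ⊔ Ideal.span {j.ξ}
      have hξQ : j.ξ ∈ Q := self_mem_sup_span _ _
      have hζQ : j.ζ ∈ Q := Ideal.mem_sup_left (self_mem_sup_span _ _)
      have hη : j.η ∈ Q := by
        rw [show j.η = j.ζ - j.b * j.ξ by rw [JetData.ζ]; ring]
        exact sub_mem hζQ (Ideal.mul_mem_left _ _ hξQ)
      have hrel := mk_family_self_eq_zero (s := s) g
      rw [Fin.sum_univ_two] at hrel
      let D : Fin 2 → Fin 2 → Total (family (curve k s) g) := fun i l =>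
        Ideal.Quotient.mk _ (ofPlane k 2 (MvPowerSeries.pderiv k i (g l)))
      have hder : ∀ i, Ideal.Quotient.mk (Ideal.span {family (curve k s) g})
          (MvPowerSeries.pderiv k (Sum.inl i) (family (curve k s) g)) =
          Ideal.Quotient.mk _ (ofPlane k 2 (MvPowerSeries.pderiv k i (curve k s))) +
          (param (family (curve k s) g) 0 * D i 0 + param (family (curve k s) g) 1 * D i 1) := by
        intro i
        have h3 : family (MvPowerSeries.pderiv k i (curve k s))
            (fun j => MvPowerSeries.pderiv k i (g j)) =
            ofPlane k 2 (MvPowerSeries.pderiv k i (curve k s)) +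
            ∑ j, MvPowerSeries.X (Sum.inr j) * ofPlane k 2 (MvPowerSeries.pderiv k i (g j)) := rfl
        rw [pderiv_family, h3, Fin.sum_univ_two, map_add, map_add, map_mul, map_mul]
      have e1 : j.ξ = 2 * coord (family (curve k s) g) 1 +
          (param (family (curve k s) g) 0 * D 1 0 + param (family (curve k s) g) 1 * D 1 1) := by
        refine (hder 1).trans ?_
        rw [pderiv_one_curve, map_mul, map_mul, ofPlane_X, map_ofNat, map_ofNat]
      have e2 : j.η = s * coord (family (curve k s) g) 0 ^ (s - 1) -
          (param (family (curve k s) g) 0 * D 0 0 + param (family (curve k s) g) 1 * D 0 1) := by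
        have h3 : j.η = -Ideal.Quotient.mk _ (MvPowerSeries.pderiv k (Sum.inl 0)
          (family (curve k s) g)) := map_neg _ _
        rw [h3, hder 0, pderiv_zero_curve, map_neg, map_neg, map_mul, map_mul, map_pow, map_pow,
          ofPlane_X, map_natCast, map_natCast]
        ring
      have h2u : IsUnit (2 : Total (family (curve k s) g)) := by
        rw [hK.isUnit_iff, map_ofNat]
        exact two_ne_zero
      refine param_mem_of_pow_mem hs hrel e1 e2 h2u ?_
        ((mk_mem_maximalIdeal_iff hF _).2 hK.ev_x) ((mk_mem_maximalIdeal_iff hF _).2 hK.ev_y)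
        hξQ hη ?_
      · rw [← map_mul, ← map_mul, ← map_mul, ← map_mul, ← map_sub, ← map_sub, hK.isUnit_iff,
          evTotal_mk, constantCoeff_ofPlane]
        exact hdet hs4
      · refine (?_ : _ ≤ Q ⊔ Ideal.span {param (family (curve k s) g) 0}) hQ
        refine sup_le (sup_le (sup_le le_sup_right ?_) ?_) ?_ <;> refine le_trans ?_ le_sup_left
        · exact le_sup_right
        · exact le_sup_right.trans le_sup_left
        · exact le_sup_left.trans le_sup_left
    · rw [← r3]
      congr 1
      ac_rfl

end Limiting

/-! ### General deformations and general principal parts -/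

section General

variable {k : Type*} [Field k]

/-- Each derivative at the origin is a scalar multiple of a single coefficient, so genericity of the
sections is a polynomial condition on finitely many coefficients. -/
theorem exists_constantCoeff_jet {r : ℕ} (i : Fin 10) : ∃ (μ : k) (ν : (Fin 2 ⊕ Fin 2) ⊕ Fin r →₀ ℕ),
    ∀ h : Dbl k r, MvPowerSeries.constantCoeff (jet h i) = μ * MvPowerSeries.coeff ν h := by
  have h0 : ∃ (μ : k) (ν : (Fin 2 ⊕ Fin 2) ⊕ Fin r →₀ ℕ),
      ∀ h : Dbl k r, MvPowerSeries.constantCoeff h = μ * MvPowerSeries.coeff ν h :=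
    ⟨1, 0, fun h => (one_mul _).symm⟩
  have h1 : ∀ (l : (Fin 2 ⊕ Fin 2) ⊕ Fin r) {L : Dbl k r → k},
      (∃ (μ : k) (ν : (Fin 2 ⊕ Fin 2) ⊕ Fin r →₀ ℕ), ∀ h, L h = μ * MvPowerSeries.coeff ν h) →
      ∃ (μ : k) (ν : (Fin 2 ⊕ Fin 2) ⊕ Fin r →₀ ℕ),
        ∀ h, L (MvPowerSeries.pderiv k l h) = μ * MvPowerSeries.coeff ν h := by
    rintro l L ⟨μ, ν, hL⟩
    refine ⟨μ * (ν l + 1), ν + Finsupp.single l 1, fun h => ?_⟩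
    rw [hL, MvPowerSeries.coeff_pderiv]
    ring
  fin_cases i
  · exact h0
  · exact h1 _ h0
  · exact h1 _ h0
  · exact h1 _ (h1 _ h0)
  · exact h1 _ (h1 _ h0)
  · exact h1 _ (h1 _ h0)
  · exact h1 _ (h1 _ (h1 _ h0))
  · exact h1 _ (h1 _ (h1 _ h0))
  · exact h1 _ (h1 _ (h1 _ h0))
  · exact h1 _ (h1 _ (h1 _ h0))

theorem exists_genericity_polynomial [CharZero k] (r : ℕ) :
    ∃ q : MvPolynomial (Fin 3 × ((Fin 2 ⊕ Fin 2) ⊕ Fin r →₀ ℕ)) k, q ≠ 0 ∧ ∀ h : Fin 3 → Dbl k r,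
      MvPolynomial.eval (fun jν => MvPowerSeries.coeff jν.2 (h jν.1)) q = genericity (constJet h) := by
  choose μ ν hμ using exists_constantCoeff_jet (k := k) (r := r)
  let q : MvPolynomial (Fin 3 × ((Fin 2 ⊕ Fin 2) ⊕ Fin r →₀ ℕ)) k :=
    genericity (Matrix.of fun i j => MvPolynomial.C (μ i) * MvPolynomial.X (j, ν i))
  have hq : ∀ h : Fin 3 → Dbl k r,
      MvPolynomial.eval (fun jν => MvPowerSeries.coeff jν.2 (h jν.1)) q =
        genericity (constJet h) := by
    intro h
    rw [← map_genericity]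
    congr 1
    refine Matrix.ext fun i j => ?_
    rw [constJet, Matrix.of_apply, hμ]
    simp
  refine ⟨q, fun h0 => genericity_witness (k := k) r ?_, hq⟩
  rw [← hq, h0, map_zero]

/-- The value of a linear form at a combination of power series, as a linear polynomial in the
coefficients. -/
def linearPoly {d : ℕ} (δ : Fin d → Plane k) (l : Plane k →ₗ[k] k) (j : Fin 2) :
    MvPolynomial (Fin 2 × Fin d) k :=
  ∑ i, MvPolynomial.C (l (δ i)) * MvPolynomial.X (j, i)

theorem eval_linearPoly {d : ℕ} (δ : Fin d → Plane k) (l : Plane k →ₗ[k] k) (j : Fin 2)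
    (c : Fin 2 → Fin d → k) :
    MvPolynomial.eval (fun ji => c ji.1 ji.2) (linearPoly δ l j) = l (∑ i, c j i • δ i) := by
  simp [linearPoly, mul_comm]

theorem constantCoeff_pderiv_eq_zero_of_mem_tjurinaIdeal {s : ℕ} (hs : 3 ≤ s) {p : Plane k}
    (hp : p ∈ tjurinaIdeal (curve k s)) :
    MvPowerSeries.constantCoeff (MvPowerSeries.pderiv k 0 p) = 0 := by
  obtain ⟨κ, hκ, b, rfl⟩ := mem_sup_span.1 (tjurinaIdeal_curve_le (by omega) hp)
  obtain ⟨a, rfl⟩ := Ideal.mem_span_singleton'.1 hκ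
  simp [Derivation.leibniz, Derivation.leibniz_pow, show s - 1 ≠ 0 by omega,
    show s - 1 - 1 ≠ 0 by omega,
    MvPowerSeries.pderiv_X_of_ne (R := k) (i := (0 : Fin 2)) (j := 1)]

theorem hasLimitingNumber_curve [CharZero k] {s : ℕ} (hs : 2 ≤ s) {d : ℕ} {δ : Fin d → Plane k}
    (hδ : IsDefBasis (curve k s) δ) :
    HasLimitingNumber (curve k s) δ 4 (if s ≤ 3 then 0 else s - 1) := by
  let ε : Plane k →ₗ[k] k := MvPowerSeries.coeff 0
  let ε' : Plane k →ₗ[k] k := ε ∘ₗ (MvPowerSeries.pderiv k (0 : Fin 2)).toLinearMap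
  have hε : ∀ p, ε p = MvPowerSeries.constantCoeff p := fun p => rfl
  have hε' : ∀ p, ε' p = MvPowerSeries.constantCoeff (MvPowerSeries.pderiv k 0 p) := fun p => rfl
  let D := linearPoly δ ε 1 * linearPoly δ ε' 0 - linearPoly δ ε 0 * linearPoly δ ε' 1
  -- With g_j the coefficient of t_j, the conditions are g₁ ≠ 0 at the origin and, for s ≥ 4, g₁ ∂_x
  -- g₀ - g₀ ∂_x g₁ ≠ 0 there. They hold when g₀ and g₁ represent x and 1, so the polynomial is
  -- nonzero.
  refine ⟨linearPoly δ ε 1 * if 4 ≤ s then D else 1, fun h0 => ?_, fun c hc => ?_⟩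
  · obtain ⟨a₀, ha₀⟩ := exists_sum_smul_sub_mem hδ (MvPowerSeries.X 0)
    obtain ⟨a₁, ha₁⟩ := exists_sum_smul_sub_mem hδ 1
    have h1 := constantCoeff_eq_zero_of_mem_tjurinaIdeal hs ha₁
    have h2 := constantCoeff_eq_zero_of_mem_tjurinaIdeal hs ha₀
    rw [map_sub, sub_eq_zero, ← hε] at h1 h2
    have h3 := congrArg (MvPolynomial.eval fun ji : Fin 2 × Fin d =>
      (![a₀, a₁] : Fin 2 → Fin d → k) ji.1 ji.2) h0
    rw [map_zero, map_mul, eval_linearPoly] at h3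
    have h4 : ε (∑ i, (![a₀, a₁] : Fin 2 → Fin d → k) 1 i • δ i) = 1 := h1.trans (map_one _)
    rw [h4, one_mul] at h3
    split_ifs at h3 with hs4
    · have h5 := constantCoeff_pderiv_eq_zero_of_mem_tjurinaIdeal (by omega) ha₀
      rw [map_sub, map_sub, sub_eq_zero, ← hε', MvPowerSeries.pderiv_X_self, map_one] at h5
      have h6 : ε (∑ i, (![a₀, a₁] : Fin 2 → Fin d → k) 0 i • δ i) = 0 := h2.trans (by simp)
      have h7 : ε' (∑ i, (![a₀, a₁] : Fin 2 → Fin d → k) 0 i • δ i) = 1 := h5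
      rw [map_sub, map_mul, map_mul, eval_linearPoly, eval_linearPoly, eval_linearPoly, h4, h6, h7,
        one_mul, zero_mul, sub_zero] at h3
      exact one_ne_zero h3
    · exact one_ne_zero ((map_one _).symm.trans h3)
  · obtain ⟨q, hq0, hq⟩ := exists_genericity_polynomial (k := k) 2
    refine ⟨q, hq0, fun h hh => ?_⟩
    rw [map_mul, eval_linearPoly] at hc
    refine limiting_of_genericity hs (g := fun j => ∑ i, c j i • δ i) (left_ne_zero_of_mul hc)
      (fun hs4 => ?_) ((hq h).symm.trans_ne hh)
    have h1 := right_ne_zero_of_mul hc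
    rw [if_pos hs4, map_sub, map_mul, map_mul, eval_linearPoly, eval_linearPoly, eval_linearPoly,
      eval_linearPoly] at h1
    rwa [map_sub, map_mul, map_mul]

end General

end AutoDeg

end

theorem mainTheorem9 {k : Type*} [Field k] [IsAlgClosed k] [CharZero k] (s : ℕ) (hs : 2 ≤ s)
    {d : ℕ} (δ : Fin d → AutoDeg.Plane k)
    (hδ : AutoDeg.IsDefBasis (MvPowerSeries.X 1 ^ 2 - MvPowerSeries.X 0 ^ s) δ) :
    AutoDeg.AD2 (MvPowerSeries.X 1 ^ 2 - MvPowerSeries.X 0 ^ s) δ 4 =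
        ((if s = 2 then 5 else if s = 3 then 10 else 6 * (s - 1) : ℕ) : ℕ∞) ∧
      AutoDeg.HasLimitingNumber (MvPowerSeries.X 1 ^ 2 - MvPowerSeries.X 0 ^ s) δ 4
        (if s ≤ 3 then 0 else s - 1) := by
  refine ⟨(AutoDeg.AD2_curve hs hδ).trans ?_, AutoDeg.hasLimitingNumber_curve hs hδ⟩
  rw [AutoDeg.degValue]
  congr 1
  split_ifs <;> omega
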